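/- Let $M$ be a compact complex manifold of complex dimension $n\ge 1$ with a smooth Kähler metric $g=g_{i\bar j}\,dz^i\otimes d\bar z^j$. For a function $f$ write $f_{i\bar j}=\frac{\partial^2 f}{\partial z^i\partial\bar z^j}$, $\Delta f=g^{i\bar j}f_{i\bar j}$, $|\nabla f|^2=g^{i\bar j}f_i f_{\bar j}$, and let $\|f\|_{W^{1,p}}=\|f\|_{L^p}+\|\nabla f\|_{L^p}$ with respect to the volume measure of $g$. Let $p_0>2n$. Then for all real $A,B,K$ there is a constant $C$, depending only on $A,B,K,p_0,M,g,n$, such that the following holds. If $\phi$ and $F$ are smooth real functions on $M$ satisfying the complex Monge–Ampère equation $$\log\left(\frac{\det(g_{i\bar j}+\phi_{i\bar j})}{\det(g_{i\bar j})}\right)=F$$ (where the argument of the logarithm is positive), and if $\|\phi\|_{L^\infty}\le A$, $\|\nabla\phi\|_{L^\infty}\le B$ and $\|F\|_{W^{1,p_0}}\le K$, then $$0<n+\Delta\phi\le C\quad\text{on } M.$$ -/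

import Mathlib

open scoped Manifold ContDiff ComplexOrder
open MeasureTheory

noncomputable section

namespace KahlerMA

/-- The coordinate space `ℂⁿ`; its `volume` is Lebesgue measure `dx¹ dy¹ ⋯ dxⁿ dyⁿ`. -/
abbrev Cn (n : ℕ) : Type := Fin n → ℂ

/-- The Wirtinger derivative `∂f/∂zⁱ = (∂f/∂xⁱ - √-1 ∂f/∂yⁱ) / 2` on `ℂⁿ`. -/
def wirtinger {n : ℕ} (i : Fin n) (f : Cn n → ℂ) (z : Cn n) : ℂ :=
  (fderiv ℝ f z (Pi.single i 1) - Complex.I * fderiv ℝ f z (Pi.single i Complex.I)) / 2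

/-- The conjugate Wirtinger derivative `∂f/∂z̄ⁱ = (∂f/∂xⁱ + √-1 ∂f/∂yⁱ) / 2` on `ℂⁿ`. -/
def wirtingerBar {n : ℕ} (i : Fin n) (f : Cn n → ℂ) (z : Cn n) : ℂ :=
  (fderiv ℝ f z (Pi.single i 1) + Complex.I * fderiv ℝ f z (Pi.single i Complex.I)) / 2

/-- The complex Hessian matrix `∂²f/∂zⁱ∂z̄ʲ` (row `i`, column `j`). -/
def complexHessian {n : ℕ} (f : Cn n → ℂ) (z : Cn n) : Matrix (Fin n) (Fin n) ℂ :=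
  Matrix.of fun i j => wirtinger i (wirtingerBar j f) z

/-- A smooth Kähler metric `g = g_{i j̄} dzⁱ ⊗ dz̄ʲ` on a complex manifold, given by its components
in the holomorphic charts `e` of the atlas, as functions on `e.target ⊆ ℂⁿ`.
Only the values at `e ∈ atlas` and `z ∈ e.target` are meaningful. -/
structure KahlerMetric (n : ℕ) (M : Type*) [TopologicalSpace M] [ChartedSpace (Cn n) M] where
  /-- `coeff e z i j` is `g_{i j̄}` in the chart `e` at the point with coordinate `z`. -/
  coeff : OpenPartialHomeomorph M (Cn n) → Cn n → Matrix (Fin n) (Fin n) ℂ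
  /-- The components are smooth (in the real sense). -/
  smooth : ∀ e ∈ atlas (Cn n) M, ∀ i j,
    ContDiffOn ℝ ∞ (fun z => coeff e z i j) e.target
  /-- `(g_{i j̄})` is a positive definite Hermitian matrix. -/
  posDef : ∀ e ∈ atlas (Cn n) M, ∀ z ∈ e.target, (coeff e z).PosDef
  /-- Tensoriality: `g_{i j̄} = ∑ ∂wᵏ/∂zⁱ · conj (∂wˡ/∂zʲ) · g'_{k l̄}` under a holomorphic change of
  coordinates `w = w(z)`. -/
  transform : ∀ e ∈ atlas (Cn n) M, ∀ e' ∈ atlas (Cn n) M,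
    ∀ z ∈ e.target, e.symm z ∈ e'.source → ∀ i j,
      coeff e z i j = ∑ k, ∑ l,
        fderiv ℂ (e' ∘ e.symm) z (Pi.single i 1) k *
          (starRingEnd ℂ) (fderiv ℂ (e' ∘ e.symm) z (Pi.single j 1) l) *
          coeff e' (e' (e.symm z)) k l
  /-- The Kähler condition `dω = 0` for `ω = √-1 g_{i j̄} dzⁱ ∧ dz̄ʲ`, that is
  `∂g_{i j̄}/∂zᵏ = ∂g_{k j̄}/∂zⁱ` (the conjugate equations follow by Hermitian symmetry). -/
  closed : ∀ e ∈ atlas (Cn n) M, ∀ z ∈ e.target, ∀ i j k,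
    wirtinger k (fun w => coeff e w i j) z = wirtinger i (fun w => coeff e w k j) z

section

variable {n : ℕ} {M : Type*} [TopologicalSpace M] [ChartedSpace (Cn n) M]

/-- A real function on `M` read in the chart `e`, as a complex-valued function on `ℂⁿ`. -/
def inChart (e : OpenPartialHomeomorph M (Cn n)) (f : M → ℝ) : Cn n → ℂ :=
  fun z => (f (e.symm z) : ℂ)

/-- The matrix `(g_{i j̄})` at the point `x`, in the preferred chart at `x`. -/
def KahlerMetric.matrixAt (g : KahlerMetric n M) (x : M) : Matrix (Fin n) (Fin n) ℂ :=
  g.coeff (chartAt (Cn n) x) (chartAt (Cn n) x x)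

/-- The matrix `(f_{i j̄})` at the point `x`, in the preferred chart at `x`. -/
def hessianAt (f : M → ℝ) (x : M) : Matrix (Fin n) (Fin n) ℂ :=
  complexHessian (inChart (chartAt (Cn n) x) f) (chartAt (Cn n) x x)

/-- The Laplacian `Δf = g^{i j̄} f_{i j̄}`. Since `∑ⱼ g_{k j̄} g^{i j̄} = δ_{ki}`, the number `g^{i j̄}`
is the entry `(j, i)` of the inverse of the matrix `(g_{i j̄})`. The sum is a real number,
independent of the holomorphic chart. -/
def KahlerMetric.laplacian (g : KahlerMetric n M) (f : M → ℝ) (x : M) : ℝ :=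
  (∑ i, ∑ j, (g.matrixAt x)⁻¹ j i * hessianAt (n := n) f x i j).re

/-- The pointwise length of the gradient, `|∇f|² = g^{i j̄} f_i f_{j̄}`. -/
def KahlerMetric.gradNorm (g : KahlerMetric n M) (f : M → ℝ) (x : M) : ℝ :=
  Real.sqrt (∑ i, ∑ j, (g.matrixAt x)⁻¹ j i *
    wirtinger i (inChart (chartAt (Cn n) x) f) (chartAt (Cn n) x x) *
    wirtingerBar j (inChart (chartAt (Cn n) x) f) (chartAt (Cn n) x x)).re

/-- The ratio `det (g_{i j̄} + f_{i j̄}) / det (g_{i j̄})`, a real number independent of the chart. -/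
def KahlerMetric.volumeRatio (g : KahlerMetric n M) (f : M → ℝ) (x : M) : ℝ :=
  ((g.matrixAt x + hessianAt (n := n) f x).det / (g.matrixAt x).det).re

/-- `φ` is a smooth solution of the complex Monge-Ampère equation
`log (det (g_{i j̄} + φ_{i j̄}) / det (g_{i j̄})) = F`; the argument of the logarithm has to be positive.
(On a compact manifold this makes `(g_{i j̄} + φ_{i j̄})` positive definite, so that is not part of the
definition.) -/
structure KahlerMetric.IsSmoothSolution (g : KahlerMetric n M) (φ F : M → ℝ) : Prop where
  smooth : ContMDiff 𝓘(ℝ, Cn n) 𝓘(ℝ, ℝ) ∞ φ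
  ratio_pos : ∀ x, 0 < g.volumeRatio φ x
  equation : ∀ x, Real.log (g.volumeRatio φ x) = F x

variable [MeasurableSpace M]

/-- The measure `ωⁿ/n! = 2ⁿ det (g_{i j̄}) dx¹ dy¹ ⋯ dxⁿ dyⁿ` on the domain of the chart `e`, extended
by zero to `M`. -/
def KahlerMetric.chartVolume (g : KahlerMetric n M) (e : OpenPartialHomeomorph M (Cn n)) :
    Measure M :=
  Measure.map e.symm ((volume.restrict e.target).withDensity
    fun z => ENNReal.ofReal (2 ^ n * (g.coeff e z).det.re))

/-- The volume measure `dvol_g`: the least measure on `M` that dominates the local volume measures of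
all charts. These agree on overlaps, so that `dvol_g` restricts to each of them. -/
def KahlerMetric.dvol (g : KahlerMetric n M) : Measure M :=
  ⨆ e ∈ atlas (Cn n) M, g.chartVolume e

/-- The Sobolev norm `‖f‖_{W^{1,p}} = ‖f‖_{L^p} + ‖∇f‖_{L^p}` with respect to `g`, for smooth `f`
(for which the weak gradient is the classical one). -/
def KahlerMetric.sobolevNorm (g : KahlerMetric n M) (p : ℝ) (f : M → ℝ) : ENNReal :=
  eLpNorm f (ENNReal.ofReal p) g.dvol + eLpNorm (g.gradNorm f) (ENNReal.ofReal p) g.dvol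

end

end KahlerMA

end

set_option linter.unusedSectionVars false

noncomputable section

namespace KahlerMA

/-! Write h = g + ∂∂̄φ, u = tr_g h = n + Δφ and τ = tr_h g. Positivity of h is automatic: the set
where h fails to be positive definite is open and closed because det h never vanishes, and at a
minimum of φ over that set the complex Hessian of φ is nonnegative, so h is positive there after all
(`coeff_add_hess_posDef`). Hence h is a Kähler metric and u > 0. For the upper bound, F has only one
derivative in L^{p₀}, so ΔF must never be estimated pointwise. The maximum principle is therefore
replaced by integral estimates and Moser iteration.

Instead of u the proof uses the comparable function U = ∑ η² h_{i ī}, summed over finitely many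
charts and over i (`cutTrace`). In a fixed chart closedness gives ∂_k ∂_l̄ h_{i ī} = ∂_i ∂_ī h_{k
l̄}, and Cauchy-Schwarz then gives Δ_h log h_{i ī} ≥ ∂_i ∂_ī log det h, with no curvature term
(`flat_logDet_le`). The equation turns the right side into ∂_i ∂_ī F plus a term depending only on
g. The cut-off by η² costs a multiple of τu. Since Δ_h φ = n - τ, and u is controlled by τ^{n-1},
the function f = log U - lφ satisfies Δ_h f ≥ (LF - C)/U with L = ∑ η² ∂_i ∂_ī, for l large
(`exists_laplacian_bound`).

This inequality is multiplied by e^{(1+2s)f} and integrated against the volume of h, which is e^F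
times that of g. Integrating by parts leaves one derivative on F. With |∇f|²_g ≤ u |∇f|²_h and
Young's inequality this yields ∫ e^{2sf} |∇f|² ≤ C ∫ e^{2sf} (1 + |∇F|²), with C independent of s ≥
0 (`exists_energy_bound`). Here 1 + |∇F|² lies in L^{p₀/2} with p₀/2 > n, so Hölder's inequality and
the Sobolev inequality in real dimension 2n gain integrability at each step, and iteration bounds
sup e^f (`exists_moser_step`, `exists_sup_bound`).

The iteration starts from ∫ e^f, hence from ∫ U, which is bounded because both derivatives of φ can
be moved onto fixed smooth coefficients (`exists_integral_cutTrace_le`). The bound of |F| needed on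
the way comes from the same iteration applied to log (1 + F²) (`exists_abs_le_of_sobolevNorm_le`).
-/

/-- The complexified derivative `(∂f/∂xⁱ + c ∂f/∂yⁱ) / 2`, which is `∂f/∂zⁱ` for `c = -√-1` and
`∂f/∂z̄ⁱ` for `c = √-1`. -/
def cderiv {n : ℕ} (c : ℂ) (i : Fin n) (f : Cn n → ℂ) (z : Cn n) : ℂ :=
  (fderiv ℝ f z (Pi.single i 1) + c * fderiv ℝ f z (Pi.single i Complex.I)) / 2

/-! ### Calculus of Wirtinger derivatives -/

section Calculus

variable {n : ℕ} {c d : ℂ} {i j : Fin n} {f g : Cn n → ℂ} {z : Cn n} {T : Set (Cn n)}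

lemma wirtinger_eq (i : Fin n) (f : Cn n → ℂ) : wirtinger i f = cderiv (-Complex.I) i f := by
  funext z; simp only [wirtinger, cderiv]; ring

lemma wirtingerBar_eq (i : Fin n) (f : Cn n → ℂ) : wirtingerBar i f = cderiv Complex.I i f := rfl

lemma complexHessian_eq (f : Cn n → ℂ) (z : Cn n) (i j : Fin n) :
    complexHessian f z i j = cderiv (-Complex.I) i (cderiv Complex.I j f) z := by
  simp [complexHessian, wirtinger_eq, wirtingerBar_eq]

lemma cderiv_congr (h : f =ᶠ[nhds z] g) : cderiv c i f z = cderiv c i g z := by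
  simp only [cderiv, h.fderiv_eq]

lemma cderiv_congr' (h : f =ᶠ[nhds z] g) : cderiv c i f =ᶠ[nhds z] cderiv c i g := by
  filter_upwards [h.eventuallyEq_nhds] with w hw using cderiv_congr hw

lemma cderiv_const (a : ℂ) : cderiv c i (fun _ => a) z = 0 := by
  simp [cderiv]

lemma cderiv_add (hf : DifferentiableAt ℝ f z) (hg : DifferentiableAt ℝ g z) :
    cderiv c i (fun w => f w + g w) z = cderiv c i f z + cderiv c i g z := by
  simp only [cderiv, fderiv_fun_add hf hg, add_apply]; ring

lemma cderiv_sub (hf : DifferentiableAt ℝ f z) (hg : DifferentiableAt ℝ g z) :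
    cderiv c i (fun w => f w - g w) z = cderiv c i f z - cderiv c i g z := by
  simp only [cderiv, fderiv_fun_sub hf hg, sub_apply]; ring

lemma cderiv_mul (hf : DifferentiableAt ℝ f z) (hg : DifferentiableAt ℝ g z) :
    cderiv c i (fun w => f w * g w) z = cderiv c i f z * g z + f z * cderiv c i g z := by
  simp only [cderiv, fderiv_fun_mul hf hg, add_apply,
    smul_apply, smul_eq_mul]
  ring

lemma cderiv_const_mul (a : ℂ) (hf : DifferentiableAt ℝ f z) :
    cderiv c i (fun w => a * f w) z = a * cderiv c i f z := by
  rw [cderiv_mul (differentiableAt_const a) hf, cderiv_const]; ring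

lemma cderiv_sum {ι : Type*} (s : Finset ι) {f : ι → Cn n → ℂ}
    (hf : ∀ a ∈ s, DifferentiableAt ℝ (f a) z) :
    cderiv c i (fun w => ∑ a ∈ s, f a w) z = ∑ a ∈ s, cderiv c i (f a) z := by
  simp only [cderiv, fderiv_fun_sum hf, sum_apply, Finset.mul_sum,
    ← Finset.sum_add_distrib, Finset.sum_div]

lemma cderiv_sum_mul {ι : Type*} (s : Finset ι) {f g : ι → Cn n → ℂ}
    (hf : ∀ a ∈ s, DifferentiableAt ℝ (f a) z) (hg : ∀ a ∈ s, DifferentiableAt ℝ (g a) z) :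
    cderiv c i (fun w => ∑ a ∈ s, f a w * g a w) z =
      ∑ a ∈ s, (cderiv c i (f a) z * g a z + f a z * cderiv c i (g a) z) := by
  rw [cderiv_sum s (f := fun a w => f a w * g a w) fun a ha => (hf a ha).mul (hg a ha)]
  exact Finset.sum_congr rfl fun a ha => cderiv_mul (hf a ha) (hg a ha)

lemma cderiv_conj (c : ℂ) (i : Fin n) (f : Cn n → ℂ) (z : Cn n) :
    cderiv c i (fun w => (starRingEnd ℂ) (f w)) z =
      (starRingEnd ℂ) (cderiv ((starRingEnd ℂ) c) i f z) := by
  have h : fderiv ℝ (fun w => (starRingEnd ℂ) (f w)) z =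
      (Complex.conjCLE : ℂ →L[ℝ] ℂ).comp (fderiv ℝ f z) := by
    have := Complex.conjCLE.comp_fderiv (f := f) (x := z)
    rw [← this]; rfl
  simp [cderiv, h, show (starRingEnd ℂ) 2 = 2 from Complex.conj_ofNat 2]

lemma cderiv_ofReal_conj (c : ℂ) (i : Fin n) (u : Cn n → ℝ) (z : Cn n) :
    cderiv c i (fun w => (u w : ℂ)) z =
      (starRingEnd ℂ) (cderiv ((starRingEnd ℂ) c) i (fun w => (u w : ℂ)) z) := by
  rw [← cderiv_conj]; simp

lemma fderiv_ofReal {u : Cn n → ℝ} (hu : DifferentiableAt ℝ u z) (v : Cn n) :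
    fderiv ℝ (fun w => (u w : ℂ)) z v = (fderiv ℝ u z v : ℂ) := by
  have := (Complex.ofRealCLM.hasFDerivAt.comp z hu.hasFDerivAt).fderiv
  have h2 : fderiv ℝ (fun w => (u w : ℂ)) z = Complex.ofRealCLM.comp (fderiv ℝ u z) := this
  rw [h2]; rfl

lemma differentiableAt_ofReal {u : Cn n → ℝ} (hu : DifferentiableAt ℝ u z) :
    DifferentiableAt ℝ (fun w => (u w : ℂ)) z :=
  Complex.ofRealCLM.differentiableAt.comp z hu

/-- The chain rule for a function of one real variable. -/
lemma cderiv_comp_real {u : Cn n → ℝ} {θ : ℝ → ℝ} {θ' : ℝ} (hu : DifferentiableAt ℝ u z)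
    (hθ : HasDerivAt θ θ' (u z)) :
    cderiv c i (fun w => (θ (u w) : ℂ)) z = θ' * cderiv c i (fun w => (u w : ℂ)) z := by
  have h1 : HasFDerivAt (fun w => θ (u w)) (θ' • fderiv ℝ u z) z :=
    hθ.comp_hasFDerivAt z hu.hasFDerivAt
  simp only [cderiv, fderiv_ofReal hu, fderiv_ofReal h1.differentiableAt, h1.fderiv]
  simp; ring

lemma contDiffAt_cderiv {m : WithTop ℕ∞} (hf : ContDiffAt ℝ (m + 1) f z) :
    ContDiffAt ℝ m (cderiv c i f) z := by
  have h := hf.fderiv_right (m := m) le_rfl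
  exact ((h.clm_apply contDiffAt_const).add
    (contDiffAt_const.mul (h.clm_apply contDiffAt_const))).div_const 2

lemma contDiffOn_cderiv (hT : IsOpen T) (hf : ContDiffOn ℝ ∞ f T) :
    ContDiffOn ℝ ∞ (cderiv c i f) T := fun w hw =>
  (contDiffAt_cderiv (m := ∞) ((hf.contDiffAt (hT.mem_nhds hw)).of_le (by simp))).contDiffWithinAt

/-- Both operators are constant complex combinations of real directional derivatives, so this is the
symmetry of the second real derivative. With `c` and `d` free it covers all mixed derivatives in z
and z̄. -/
lemma cderiv_comm (hf : ContDiffAt ℝ 2 f z) :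
    cderiv c i (cderiv d j f) z = cderiv d j (cderiv c i f) z := by
  have hs : IsSymmSndFDerivAt ℝ f z := hf.isSymmSndFDerivAt (by simp)
  have hd : DifferentiableAt ℝ (fderiv ℝ f) z :=
    (hf.fderiv_right (m := 1) (by norm_num)).differentiableAt (by norm_num)
  have key : ∀ (c : ℂ) (i : Fin n) (v : Cn n), fderiv ℝ (cderiv c i f) z v =
      (fderiv ℝ (fderiv ℝ f) z v (Pi.single i 1) +
        c * fderiv ℝ (fderiv ℝ f) z v (Pi.single i Complex.I)) / 2 := by
    intro c i v
    have ha : ∀ a : Cn n, HasFDerivAt (fun w => fderiv ℝ f w a)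
        ((fderiv ℝ (fderiv ℝ f) z).flip a) z := fun a => by
      have := hd.hasFDerivAt.clm_apply (hasFDerivAt_const a z)
      simpa using this
    have h := ((ha (Pi.single i 1)).add ((ha (Pi.single i Complex.I)).const_mul c)).mul_const
      ((2 : ℂ)⁻¹)
    have h' : HasFDerivAt (cderiv c i f) _ z := h
    rw [h'.fderiv]
    simp only [smul_apply, add_apply, ContinuousLinearMap.flip_apply, smul_eq_mul]
    ring
  rw [cderiv, cderiv, key, key, key, key,
    hs.eq (Pi.single i 1) (Pi.single j 1), hs.eq (Pi.single i 1) (Pi.single j Complex.I),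
    hs.eq (Pi.single i Complex.I) (Pi.single j 1),
    hs.eq (Pi.single i Complex.I) (Pi.single j Complex.I)]
  ring

/-- The splitting of a real linear form into its complex linear and conjugate linear parts, that is
df = ∂f + ∂̄f. -/
lemma realLinear_eq_sum (l : Cn n →L[ℝ] ℂ) (v : Cn n) :
    l v = ∑ k, (v k * ((l (Pi.single k 1) + (-Complex.I) * l (Pi.single k Complex.I)) / 2) +
      (starRingEnd ℂ) (v k) *
        ((l (Pi.single k 1) + Complex.I * l (Pi.single k Complex.I)) / 2)) := by
  have hv : v = ∑ k, ((v k).re • (Pi.single k 1 : Cn n) +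
      (v k).im • (Pi.single k Complex.I : Cn n)) := by
    funext m
    rw [Finset.sum_apply, Finset.sum_eq_single m]
    · simp
    · intro b _ hb; simp [hb.symm]
    · simp
  conv_lhs => rw [hv]
  rw [map_sum]
  refine Finset.sum_congr rfl fun k _ => ?_
  rw [map_add, map_smul, map_smul]
  have h1 := Complex.re_add_im (v k)
  have h2 : (starRingEnd ℂ) (v k) = (v k).re - (v k).im * Complex.I := by
    apply Complex.ext <;> simp
  rw [h2]
  nth_rewrite 3 [← h1]
  simp only [Complex.real_smul]
  linear_combination ((v k).im * l (Pi.single k Complex.I)) * Complex.I_mul_I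

/-- The chain rule for a holomorphic change of coordinates. -/
lemma cderiv_comp_holomorphic {Φ : Cn n → Cn n} {Φ' : Cn n →L[ℂ] Cn n}
    (hΦ : HasFDerivAt Φ Φ' z) (hf : DifferentiableAt ℝ f (Φ z)) :
    cderiv (-Complex.I) i (f ∘ Φ) z =
      ∑ k, Φ' (Pi.single i 1) k * cderiv (-Complex.I) k f (Φ z) := by
  have h1 := (hf.hasFDerivAt.comp z (hΦ.restrictScalars ℝ)).fderiv
  have hI : Φ' (Pi.single i Complex.I) = Complex.I • Φ' (Pi.single i 1) := by
    rw [← map_smul]; congr 1; rw [← Pi.single_smul]; simp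
  simp only [cderiv, h1, ContinuousLinearMap.comp_apply, ContinuousLinearMap.coe_restrictScalars',
    hI]
  rw [realLinear_eq_sum _ (Φ' (Pi.single i 1)),
    realLinear_eq_sum _ (Complex.I • Φ' (Pi.single i 1)), Finset.mul_sum, ← Finset.sum_add_distrib,
    Finset.sum_div]
  refine Finset.sum_congr rfl fun k _ => ?_
  simp only [Pi.smul_apply, smul_eq_mul, map_mul, Complex.conj_I]
  generalize Φ' (Pi.single i 1) k = a
  generalize (starRingEnd ℂ) a = b
  ring_nf
  simp only [Complex.I_sq, show Complex.I ^ 3 = -Complex.I by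
    rw [pow_succ, Complex.I_sq]; ring]
  ring

/-- The conjugate of `cderiv_comp_holomorphic` applied to the conjugate function. -/
lemma cderiv_bar_comp_holomorphic {Φ : Cn n → Cn n} {Φ' : Cn n →L[ℂ] Cn n}
    (hΦ : HasFDerivAt Φ Φ' z) (hf : DifferentiableAt ℝ f (Φ z)) :
    cderiv Complex.I i (f ∘ Φ) z =
      ∑ k, (starRingEnd ℂ) (Φ' (Pi.single i 1) k) * cderiv Complex.I k f (Φ z) := by
  have h := cderiv_comp_holomorphic (i := i) (f := fun w => (starRingEnd ℂ) (f w)) hΦ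
    (Complex.conjCLE.differentiableAt.comp _ hf)
  have h2 := congrArg (starRingEnd ℂ) h
  simp only [map_sum, map_mul] at h2
  have h3 : ((fun w => (starRingEnd ℂ) (f w)) ∘ Φ) = fun w => (starRingEnd ℂ) ((f ∘ Φ) w) := rfl
  rw [h3] at h2
  simpa only [cderiv_conj, Complex.conj_conj, map_neg, Complex.conj_I, neg_neg] using h2

end Calculus

/-! ### Trace, determinant and Cauchy-Schwarz inequalities for positive matrices -/

section LinearAlgebra

open Matrix

variable {m : Type*} [Fintype m]

/-- The squared Euclidean norm of a complex vector. -/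
def nsq (v : m → ℂ) : ℝ := ∑ k, ‖v k‖ ^ 2

/-- The squared Frobenius norm. -/
def fro (A : Matrix m m ℂ) : ℝ := ∑ i, ∑ j, ‖A i j‖ ^ 2

/-- The real number `ξᴴ A ξ` for a Hermitian matrix `A`. -/
def qform (A : Matrix m m ℂ) (ξ : m → ℂ) : ℝ := (star ξ ⬝ᵥ (A *ᵥ ξ)).re

lemma nsq_nonneg (v : m → ℂ) : 0 ≤ nsq v := Finset.sum_nonneg fun _ _ => sq_nonneg _

lemma nsq_eq (v : m → ℂ) : ((nsq v : ℝ) : ℂ) = star v ⬝ᵥ v := by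
  simp only [nsq, dotProduct, Complex.ofReal_sum, Pi.star_apply]
  refine Finset.sum_congr rfl fun k _ => ?_
  rw [mul_comm, Complex.star_def, Complex.mul_conj, Complex.normSq_eq_norm_sq]

lemma fro_eq (A : Matrix m m ℂ) : ((fro A : ℝ) : ℂ) = (Aᴴ * A).trace := by
  simp only [fro, trace, diag_apply, mul_apply, conjTranspose_apply, Complex.ofReal_sum]
  rw [Finset.sum_comm]
  refine Finset.sum_congr rfl fun k _ => Finset.sum_congr rfl fun l _ => ?_
  rw [mul_comm, Complex.star_def, Complex.mul_conj, Complex.normSq_eq_norm_sq]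

lemma fro_conjTranspose (A : Matrix m m ℂ) : fro Aᴴ = fro A := by
  rw [fro, fro, Finset.sum_comm]; simp

lemma nsq_mulVec_le (A : Matrix m m ℂ) (v : m → ℂ) : nsq (A *ᵥ v) ≤ fro A * nsq v := by
  rw [nsq, fro, Finset.sum_mul]
  refine Finset.sum_le_sum fun i _ => ?_
  calc ‖(A *ᵥ v) i‖ ^ 2 ≤ (∑ j, ‖A i j‖ * ‖v j‖) ^ 2 := by
        gcongr
        exact (norm_sum_le _ _).trans (le_of_eq (by simp))
    _ ≤ _ := Finset.sum_mul_sq_le_sq_mul_sq _ _ _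

lemma fro_mul_le (A B : Matrix m m ℂ) : fro (A * B) ≤ fro A * fro B := by
  have h : ∀ C : Matrix m m ℂ, fro C = ∑ j, nsq (fun i => C i j) := fun C => by
    rw [fro, Finset.sum_comm]; rfl
  rw [h (A * B), h B, Finset.mul_sum]
  exact Finset.sum_le_sum fun j _ => nsq_mulVec_le A fun i => B i j

/-- The factor R reduces the inequalities between Hermitian matrices below to Euclidean and
Frobenius norms; no simultaneous diagonalization is needed for them. -/
lemma PosDef.exists_factor [DecidableEq m] {H : Matrix m m ℂ} (hH : H.PosDef) :
    ∃ R : Matrix m m ℂ, IsUnit R.det ∧ H = Rᴴ * R := by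
  open scoped MatrixOrder in
  obtain ⟨R, hR⟩ := CStarAlgebra.nonneg_iff_eq_star_mul_self.mp
    (Matrix.nonneg_iff_posSemidef.mpr hH.posSemidef)
  have hR' : H = Rᴴ * R := hR
  refine ⟨R, ?_, hR'⟩
  have h := hH.det_pos.ne'
  rw [hR', det_mul] at h
  exact isUnit_iff_ne_zero.mpr (right_ne_zero_of_mul h)

lemma PosSemidef.exists_factor {H : Matrix m m ℂ} (hH : H.PosSemidef) :
    ∃ R : Matrix m m ℂ, H = Rᴴ * R := by
  classical
  open scoped MatrixOrder in
  obtain ⟨R, hR⟩ := CStarAlgebra.nonneg_iff_eq_star_mul_self.mp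
    (Matrix.nonneg_iff_posSemidef.mpr hH)
  exact ⟨R, hR⟩

lemma factor_inv [DecidableEq m] (R : Matrix m m ℂ) : (Rᴴ * R)⁻¹ = R⁻¹ * (R⁻¹)ᴴ := by
  rw [Matrix.mul_inv_rev, conjTranspose_nonsing_inv]

lemma qform_factor_inv [DecidableEq m] (R : Matrix m m ℂ) (ξ : m → ℂ) :
    qform (Rᴴ * R)⁻¹ ξ = nsq ((R⁻¹)ᴴ *ᵥ ξ) := by
  have h : star ξ ⬝ᵥ ((Rᴴ * R)⁻¹ *ᵥ ξ) = ((nsq ((R⁻¹)ᴴ *ᵥ ξ) : ℝ) : ℂ) := by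
    rw [nsq_eq, factor_inv, ← mulVec_mulVec, dotProduct_mulVec, star_mulVec,
      conjTranspose_conjTranspose]
  rw [qform, h, Complex.ofReal_re]

lemma qform_factor (R : Matrix m m ℂ) (ξ : m → ℂ) : qform (Rᴴ * R) ξ = nsq (R *ᵥ ξ) := by
  have h : star ξ ⬝ᵥ ((Rᴴ * R) *ᵥ ξ) = ((nsq (R *ᵥ ξ) : ℝ) : ℂ) := by
    rw [nsq_eq, ← mulVec_mulVec, dotProduct_mulVec, star_mulVec]
  rw [qform, h, Complex.ofReal_re]

lemma qform_inv_nonneg [DecidableEq m] {H : Matrix m m ℂ} (hH : H.PosDef) (ξ : m → ℂ) :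
    0 ≤ qform H⁻¹ ξ := by
  obtain ⟨R, -, rfl⟩ := PosDef.exists_factor hH
  rw [qform_factor_inv]; exact nsq_nonneg _

/-- For A = CᴴC and B = DᴴD the left side is the squared Frobenius norm of C Dᴴ, and that norm is
submultiplicative. -/
lemma trace_mul_le {A B : Matrix m m ℂ} (hA : A.PosSemidef) (hB : B.PosSemidef) :
    (A * B).trace.re ≤ A.trace.re * B.trace.re := by
  obtain ⟨C, rfl⟩ := PosSemidef.exists_factor hA
  obtain ⟨D, rfl⟩ := PosSemidef.exists_factor hB
  have h : (Cᴴ * C * (Dᴴ * D)).trace = ((C * Dᴴ)ᴴ * (C * Dᴴ)).trace := by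
    rw [conjTranspose_mul, conjTranspose_conjTranspose, ← Matrix.mul_assoc, trace_mul_comm]
    simp only [Matrix.mul_assoc]
  rw [h, ← fro_eq, ← fro_eq, ← fro_eq]
  simp only [Complex.ofReal_re]
  exact (fro_mul_le _ _).trans_eq (by rw [fro_conjTranspose])

/-- `tr (G⁻¹ H)` as the trace of a matrix congruent to `H`. -/
lemma trace_factor_inv_mul [DecidableEq m] {S H : Matrix m m ℂ} :
    ((Sᴴ * S)⁻¹ * H).trace = ((S⁻¹)ᴴ * H * S⁻¹).trace := by
  rw [factor_inv, Matrix.mul_assoc, trace_mul_comm]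

lemma posDef_congr [DecidableEq m] {S H : Matrix m m ℂ} (hS : IsUnit S.det) (hH : H.PosDef) :
    ((S⁻¹)ᴴ * H * S⁻¹).PosDef := by
  refine hH.conjTranspose_mul_mul_same ?_
  refine Matrix.mulVec_injective_of_isUnit ?_
  rw [Matrix.isUnit_iff_isUnit_det]
  simpa using hS

/-- The source of the lower bound n + Δφ > 0; `Nonempty` stands for n ≥ 1. -/
lemma trace_inv_mul_pos [DecidableEq m] [Nonempty m] {G H : Matrix m m ℂ} (hG : G.PosDef)
    (hH : H.PosDef) :
    0 < (G⁻¹ * H).trace.re := by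
  obtain ⟨S, hS, rfl⟩ := PosDef.exists_factor hG
  rw [trace_factor_inv_mul]
  exact (Complex.lt_def.mp (posDef_congr hS hH).trace_pos).1

lemma trace_le_trace_inv_mul [DecidableEq m] {G H : Matrix m m ℂ} (hG : G.PosDef) (hH : H.PosDef) :
    H.trace.re ≤ G.trace.re * (G⁻¹ * H).trace.re := by
  obtain ⟨S, hS, rfl⟩ := PosDef.exists_factor hG
  have h1 : H.trace = (S * Sᴴ * ((S⁻¹)ᴴ * H * S⁻¹)).trace := by
    have e1 : Sᴴ * (S⁻¹)ᴴ = 1 := by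
      rw [← conjTranspose_mul, nonsing_inv_mul _ hS, conjTranspose_one]
    have e2 : S * Sᴴ * ((S⁻¹)ᴴ * H * S⁻¹) = S * (H * S⁻¹) := by
      calc _ = S * (Sᴴ * (S⁻¹)ᴴ) * (H * S⁻¹) := by simp only [Matrix.mul_assoc]
        _ = _ := by rw [e1, Matrix.mul_one]
    rw [e2, trace_mul_comm, Matrix.mul_assoc, nonsing_inv_mul _ hS, Matrix.mul_one]
  rw [h1, trace_factor_inv_mul]
  refine (trace_mul_le (posSemidef_self_mul_conjTranspose S)
    (posDef_congr hS hH).posSemidef).trans_eq ?_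
  rw [trace_mul_comm S]

lemma trace_inv_mul_le [DecidableEq m] {G H : Matrix m m ℂ} (hG : G.PosDef) (hH : H.PosDef) :
    (G⁻¹ * H).trace.re ≤ G⁻¹.trace.re * H.trace.re :=
  trace_mul_le hG.inv.posSemidef hH.posSemidef

lemma trace_inv_le [DecidableEq m] {G H : Matrix m m ℂ} (hG : G.PosDef) (hH : H.PosDef) :
    H⁻¹.trace.re ≤ G⁻¹.trace.re * (H⁻¹ * G).trace.re := by
  have h := trace_le_trace_inv_mul hG.inv hH.inv
  rwa [nonsing_inv_nonsing_inv _ (isUnit_iff_ne_zero.mpr hG.det_pos.ne'), trace_mul_comm G] at h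

/-- With G = SᴴS and H = RᴴR one vector is the image of the other under S⁻ᴴ Rᴴ, whose squared
Frobenius norm is tr (G⁻¹ H). Applied to gradients this is |∇f|²_g ≤ tr_g h · |∇f|²_h. -/
lemma qform_inv_le [DecidableEq m] {G H : Matrix m m ℂ} (hG : G.PosDef) (hH : H.PosDef)
    (ξ : m → ℂ) :
    qform G⁻¹ ξ ≤ (G⁻¹ * H).trace.re * qform H⁻¹ ξ := by
  obtain ⟨S, hS, rfl⟩ := PosDef.exists_factor hG
  obtain ⟨R, hR, rfl⟩ := PosDef.exists_factor hH
  have h1 : (S⁻¹)ᴴ *ᵥ ξ = ((S⁻¹)ᴴ * Rᴴ) *ᵥ ((R⁻¹)ᴴ *ᵥ ξ) := by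
    rw [mulVec_mulVec, Matrix.mul_assoc, ← conjTranspose_mul R⁻¹, nonsing_inv_mul _ hR,
      conjTranspose_one, Matrix.mul_one]
  have h2 : ((Sᴴ * S)⁻¹ * (Rᴴ * R)).trace.re = fro ((S⁻¹)ᴴ * Rᴴ) := by
    have : ((Sᴴ * S)⁻¹ * (Rᴴ * R)).trace = ((fro ((S⁻¹)ᴴ * Rᴴ) : ℝ) : ℂ) := by
      rw [fro_eq, trace_factor_inv_mul, conjTranspose_mul, conjTranspose_conjTranspose,
        conjTranspose_conjTranspose, ← Matrix.mul_assoc, Matrix.mul_assoc, trace_mul_comm]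
    rw [this, Complex.ofReal_re]
  rw [qform_factor_inv, qform_factor_inv, h1, h2]
  exact nsq_mulVec_le _ _

lemma qform_one [DecidableEq m] (ξ : m → ℂ) : qform 1 ξ = nsq ξ := by
  rw [qform, one_mulVec, ← nsq_eq, Complex.ofReal_re]

lemma qform_inv_le_trace [DecidableEq m] {H : Matrix m m ℂ} (hH : H.PosDef) (ξ : m → ℂ) :
    qform H⁻¹ ξ ≤ H⁻¹.trace.re * nsq ξ := by
  have h := qform_inv_le hH PosDef.one ξ
  rwa [Matrix.mul_one, inv_one, qform_one] at h

lemma nsq_le_qform_inv [DecidableEq m] {H : Matrix m m ℂ} (hH : H.PosDef) (ξ : m → ℂ) :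
    nsq ξ ≤ H.trace.re * qform H⁻¹ ξ := by
  have h := qform_inv_le PosDef.one hH ξ
  rwa [inv_one, Matrix.one_mul, qform_one] at h

/-- The Cauchy-Schwarz inequality behind the subharmonicity of the logarithm of a component of a
Kähler metric. -/
lemma qform_inv_col_le [DecidableEq m] {H : Matrix m m ℂ} (hH : H.PosDef) (B : Matrix m m ℂ)
    (i : m) :
    qform H⁻¹ (fun k => B k i) ≤ (H i i).re * (H⁻¹ * B * H⁻¹ * Bᴴ).trace.re := by
  obtain ⟨R, hR, rfl⟩ := PosDef.exists_factor hH
  have hB : (fun k => B k i) = B *ᵥ Pi.single i 1 := by funext k; simp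
  -- The column B eᵢ is written as (R⁻ᴴ B R⁻¹)(R eᵢ) after applying R⁻ᴴ: the first factor gives the
  -- trace on the right, the second gives Hᵢᵢ.
  have h1 : (R⁻¹)ᴴ *ᵥ (B *ᵥ Pi.single i 1) =
      ((R⁻¹)ᴴ * B * R⁻¹) *ᵥ (R *ᵥ Pi.single i 1) := by
    rw [mulVec_mulVec, mulVec_mulVec, Matrix.mul_assoc _ R⁻¹ R, nonsing_inv_mul _ hR,
      Matrix.mul_one]
  have h2 : ((Rᴴ * R) i i).re = nsq (R *ᵥ Pi.single i 1) := by
    rw [← qform_factor, qform]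
    congr 1
    simp only [mulVec_single_one]
    rw [show star (Pi.single i (1 : ℂ)) = (Pi.single i 1 : m → ℂ) from by
      rw [← Pi.single_star]; simp]
    simp
  have h3 : ((Rᴴ * R)⁻¹ * B * (Rᴴ * R)⁻¹ * Bᴴ).trace.re = fro ((R⁻¹)ᴴ * B * R⁻¹) := by
    have : ((Rᴴ * R)⁻¹ * B * (Rᴴ * R)⁻¹ * Bᴴ).trace =
        ((fro ((R⁻¹)ᴴ * B * R⁻¹) : ℝ) : ℂ) := by
      rw [fro_eq, factor_inv, trace_mul_comm (((R⁻¹)ᴴ * B * R⁻¹)ᴴ)]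
      simp only [conjTranspose_mul, conjTranspose_conjTranspose, Matrix.mul_assoc]
      rw [trace_mul_comm]
      simp only [Matrix.mul_assoc]
    rw [this, Complex.ofReal_re]
  rw [hB, qform_factor_inv, h1, h2, h3, mul_comm]
  exact nsq_mulVec_le _ _

lemma norm_entry_le_trace {A : Matrix m m ℂ} (hA : A.PosSemidef) (i j : m) :
    ‖A i j‖ ≤ A.trace.re := by
  obtain ⟨C, rfl⟩ := PosSemidef.exists_factor hA
  rw [← fro_eq, Complex.ofReal_re, mul_apply]
  have hsq : ∀ i : m, ∑ k, ‖C k i‖ ^ 2 ≤ fro C := fun i => by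
    rw [fro]
    exact Finset.sum_le_sum fun k _ =>
      Finset.single_le_sum (f := fun j => ‖C k j‖ ^ 2) (fun _ _ => sq_nonneg _) (Finset.mem_univ i)
  calc _ ≤ ∑ k, ‖C k i‖ * ‖C k j‖ := (norm_sum_le _ _).trans (le_of_eq (by simp))
    _ ≤ ∑ k, (‖C k i‖ ^ 2 + ‖C k j‖ ^ 2) / 2 :=
        Finset.sum_le_sum fun k _ => by nlinarith [sq_nonneg (‖C k i‖ - ‖C k j‖)]
    _ = (∑ k, ‖C k i‖ ^ 2 + ∑ k, ‖C k j‖ ^ 2) / 2 := by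
        rw [← Finset.sum_add_distrib, Finset.sum_div]
    _ ≤ _ := by linarith [hsq i, hsq j]

lemma norm_trace_mul_le {A : Matrix m m ℂ} (hA : A.PosSemidef) (B : Matrix m m ℂ) :
    ‖(A * B).trace‖ ≤ A.trace.re * ∑ i, ∑ j, ‖B i j‖ := by
  calc ‖(A * B).trace‖ ≤ ∑ i, ∑ j, ‖A i j‖ * ‖B j i‖ := by
        refine (norm_sum_le _ _).trans (Finset.sum_le_sum fun i _ => ?_)
        rw [diag_apply, mul_apply]
        exact (norm_sum_le _ _).trans (le_of_eq (by simp))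
    _ ≤ ∑ i, ∑ j, A.trace.re * ‖B j i‖ := by
        gcongr; exact norm_entry_le_trace hA _ _
    _ = _ := by
        rw [Finset.sum_comm]; simp only [Finset.mul_sum]

/-- Weighted Cauchy-Schwarz. It lets logarithmic Laplacian inequalities for the summands pass to
their sum. Where a weight vanishes the quotient is zero by convention, so the vector has to vanish
there too. -/
lemma qform_inv_sum_le [DecidableEq m] {H : Matrix m m ℂ} (hH : H.PosDef) {ι : Type*} (t : Finset ι)
    (s : ι → ℝ) (v : ι → m → ℂ) (hs : ∀ a ∈ t, 0 ≤ s a) (hv : ∀ a ∈ t, s a = 0 → v a = 0) :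
    qform H⁻¹ (∑ a ∈ t, v a) ≤ (∑ a ∈ t, s a) * ∑ a ∈ t, qform H⁻¹ (v a) / s a := by
  obtain ⟨R, hR, rfl⟩ := PosDef.exists_factor hH
  simp only [qform_factor_inv]
  have h1 : (R⁻¹)ᴴ *ᵥ (∑ a ∈ t, v a) = ∑ a ∈ t, (R⁻¹)ᴴ *ᵥ v a :=
    map_sum (Matrix.mulVecLin (R⁻¹)ᴴ) _ _
  rw [h1]
  set w : ι → m → ℂ := fun a => (R⁻¹)ᴴ *ᵥ v a with hw
  have hw0 : ∀ a ∈ t, s a = 0 → w a = 0 := fun a ha h0 => by simp [hw, hv a ha h0]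
  have h2 : ∑ a ∈ t, nsq (w a) / s a = ∑ k, ∑ a ∈ t, ‖w a k‖ ^ 2 / s a := by
    rw [Finset.sum_comm]; simp only [nsq, Finset.sum_div]
  rw [h2, Finset.mul_sum, nsq]
  refine Finset.sum_le_sum fun k _ => ?_
  calc ‖(∑ a ∈ t, w a) k‖ ^ 2 ≤ (∑ a ∈ t, ‖w a k‖) ^ 2 := by
        rw [Finset.sum_apply]; gcongr; exact norm_sum_le _ _
    _ ≤ _ := by
        refine Finset.sum_sq_le_sum_mul_sum_of_sq_le_mul t hs
          (fun a ha => div_nonneg (sq_nonneg _) (hs a ha)) fun a ha => ?_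
        rcases eq_or_ne (s a) 0 with h0 | h0
        · simp [h0, hw0 a ha h0]
        · exact le_of_eq (by field_simp)

/-- For G = SᴴS all three quantities are symmetric functions of the eigenvalues of the single
Hermitian matrix S⁻ᴴ H S⁻¹. -/
lemma trace_inv_mul_eigen [DecidableEq m] {G H : Matrix m m ℂ} (hG : G.PosDef) (hH : H.PosDef) :
    ∃ l : m → ℝ, (∀ i, 0 < l i) ∧ (G⁻¹ * H).trace.re = ∑ i, l i ∧
      (H⁻¹ * G).trace.re = ∑ i, (l i)⁻¹ ∧ (H.det / G.det).re = ∏ i, l i := by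
  obtain ⟨S, hS, rfl⟩ := PosDef.exists_factor hG
  have hP := posDef_congr hS hH
  set P := (S⁻¹)ᴴ * H * S⁻¹ with hPdef
  have hSc : IsUnit (Sᴴ).det := by rw [det_conjTranspose]; exact hS.star
  refine ⟨hP.1.eigenvalues, hP.eigenvalues_pos, ?_, ?_, ?_⟩
  · rw [trace_factor_inv_mul, ← hPdef, hP.1.trace_eq_sum_eigenvalues]
    simp
  · have h1 : H⁻¹ * (Sᴴ * S) = S⁻¹ * P⁻¹ * S := by
      rw [hPdef, Matrix.mul_inv_rev, Matrix.mul_inv_rev, nonsing_inv_nonsing_inv _ hS,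
        conjTranspose_nonsing_inv, nonsing_inv_nonsing_inv _ hSc]
      simp only [← Matrix.mul_assoc]
      rw [nonsing_inv_mul _ hS, Matrix.one_mul]
    have h2 : P⁻¹.trace = ∑ i, (((hP.1.eigenvalues i)⁻¹ : ℝ) : ℂ) := by
      have hs := hP.1.spectral_theorem
      set V := hP.1.eigenvectorUnitary
      have hD : P⁻¹ = (V : Matrix m m ℂ) *
          diagonal (fun i => (((hP.1.eigenvalues i)⁻¹ : ℝ) : ℂ)) * star (V : Matrix m m ℂ) := by
        refine inv_eq_left_inv ?_
        refine (congrArg _ (hs.trans (Unitary.conjStarAlgAut_apply ..))).trans ?_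
        have hVV : star (V : Matrix m m ℂ) * (V : Matrix m m ℂ) = 1 := Unitary.coe_star_mul_self V
        calc _ = (V : Matrix m m ℂ) * (diagonal (fun i => (((hP.1.eigenvalues i)⁻¹ : ℝ) : ℂ)) *
              ((star (V : Matrix m m ℂ) * (V : Matrix m m ℂ)) *
              diagonal (RCLike.ofReal ∘ hP.1.eigenvalues))) * star (V : Matrix m m ℂ) := by
              simp only [Matrix.mul_assoc]
          _ = 1 := by
              rw [hVV, Matrix.one_mul, diagonal_mul_diagonal]
              have : (fun i => (((hP.1.eigenvalues i)⁻¹ : ℝ) : ℂ) *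
                  (RCLike.ofReal ∘ hP.1.eigenvalues) i) = fun _ => (1 : ℂ) := by
                funext i
                have := (hP.eigenvalues_pos i).ne'
                simp only [Function.comp_apply, Complex.coe_algebraMap]
                rw [← Complex.ofReal_mul, inv_mul_cancel₀ this, Complex.ofReal_one]
              rw [this, diagonal_one, Matrix.mul_one]
              exact Unitary.coe_mul_star_self V
      rw [hD, trace_mul_comm, ← Matrix.mul_assoc, Unitary.coe_star_mul_self, Matrix.one_mul,
        trace_diagonal]
    rw [h1, Matrix.mul_assoc, trace_mul_comm, Matrix.mul_assoc, mul_nonsing_inv _ hS,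
      Matrix.mul_one, h2, ← Complex.ofReal_sum, Complex.ofReal_re]
  · have h1 : H.det / (Sᴴ * S).det = P.det := by
      rw [hPdef, det_mul, det_mul, det_mul, det_conjTranspose, det_conjTranspose,
        Matrix.det_nonsing_inv, Ring.inverse_eq_inv', star_inv₀]
      have h1 := hS.ne_zero
      have h2 : star S.det ≠ 0 := by simpa using h1
      field_simp
    rw [h1, hP.1.det_eq_prod_eigenvalues]
    simp only [Complex.coe_algebraMap]
    rw [← Complex.ofReal_prod, Complex.ofReal_re]

/-- Each eigenvalue is the product of all of them times the inverses of the other ones, and each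
inverse is at most the sum of the inverses. With a bounded volume ratio this bounds tr_g h once tr_h
g is bounded. -/
lemma trace_le_det_mul_trace_pow [DecidableEq m] {G H : Matrix m m ℂ} (hG : G.PosDef)
    (hH : H.PosDef) :
    (G⁻¹ * H).trace.re ≤ Fintype.card m * ((H.det / G.det).re *
      (H⁻¹ * G).trace.re ^ (Fintype.card m - 1)) := by
  obtain ⟨l, hl, h1, h2, h3⟩ := trace_inv_mul_eigen hG hH
  rw [h1, h2, h3, ← nsmul_eq_mul, ← Finset.card_univ]
  refine Finset.sum_le_card_nsmul _ _ _ fun i _ => ?_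
  have h4 : l i = (∏ j, l j) * ∏ j ∈ Finset.univ.erase i, (l j)⁻¹ := by
    rw [← Finset.mul_prod_erase _ _ (Finset.mem_univ i), mul_assoc, ← Finset.prod_mul_distrib,
      Finset.prod_eq_one fun j _ => mul_inv_cancel₀ (hl j).ne', mul_one]
  calc l i = (∏ j, l j) * ∏ j ∈ Finset.univ.erase i, (l j)⁻¹ := h4
    _ ≤ _ := by
      refine mul_le_mul_of_nonneg_left ?_ (Finset.prod_nonneg fun j _ => (hl j).le)
      rw [← Finset.card_erase_of_mem (Finset.mem_univ i)]
      refine (Finset.prod_le_prod (fun j _ => (inv_pos.mpr (hl j)).le)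
        (g := fun _ => ∑ k, (l k)⁻¹) fun j _ => Finset.single_le_sum (f := fun k => (l k)⁻¹)
          (fun k _ => (inv_pos.mpr (hl k)).le) (Finset.mem_univ j)).trans_eq ?_
      simp

end LinearAlgebra

/-! ### Derivatives of determinants and inverse matrices -/

section MatrixCalculus

open Matrix

variable {n : ℕ} {m : Type*} [Fintype m] [DecidableEq m] {c : ℂ} {i : Fin n} {z : Cn n}
  {T : Set (Cn n)} {A : Cn n → Matrix m m ℂ}

lemma contDiffAt_det {r : WithTop ℕ∞} (hA : ∀ k l, ContDiffAt ℝ r (fun w => A w k l) z) :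
    ContDiffAt ℝ r (fun w => (A w).det) z := by
  simp only [det_apply']
  exact ContDiffAt.sum fun σ _ => contDiffAt_const.mul (contDiffAt_prod fun k _ => hA _ _)

lemma contDiffAt_inv {r : WithTop ℕ∞} (hA : ∀ k l, ContDiffAt ℝ r (fun w => A w k l) z)
    (h0 : (A z).det ≠ 0) (k l : m) : ContDiffAt ℝ r (fun w => (A w)⁻¹ k l) z := by
  simp only [inv_def, Matrix.smul_apply, smul_eq_mul, Ring.inverse_eq_inv', adjugate_apply]
  refine ((contDiffAt_det hA).inv h0).mul (contDiffAt_det fun a b => ?_)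
  by_cases h : a = l
  · subst h; simpa using contDiffAt_const
  · simpa [updateRow_ne h] using hA a b

/-- Jacobi's formula. -/
lemma cderiv_det (hA : ∀ k l, DifferentiableAt ℝ (fun w => A w k l) z) (h0 : (A z).det ≠ 0) :
    cderiv c i (fun w => (A w).det) z =
      (A z).det * ((A z)⁻¹ * of fun k l => cderiv c i (fun w => A w k l) z).trace := by
  set B : Matrix m m ℂ := of fun k l => cderiv c i (fun w => A w k l) z with hB
  -- The product rule in the Leibniz expansion differentiates one column at a time; Cramer's rule
  -- then turns the sum into the trace of the adjugate times the derivative.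
  have h1 : cderiv c i (fun w => (A w).det) z =
      ∑ j, ((A z).updateCol j fun k => B k j).det := by
    have hprod : ∀ σ : Equiv.Perm m, HasFDerivAt (fun w => ∏ k, A w (σ k) k)
        (∑ j, (∏ k ∈ Finset.univ.erase j, A z (σ k) k) • fderiv ℝ (fun w => A w (σ j) j) z) z :=
      fun σ => HasFDerivAt.finsetProd fun j _ => (hA _ _).hasFDerivAt
    have hcp : ∀ σ : Equiv.Perm m, cderiv c i (fun w => ∏ k, A w (σ k) k) z =
        ∑ j, (∏ k ∈ Finset.univ.erase j, A z (σ k) k) * B (σ j) j := fun σ => by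
      rw [cderiv, (hprod σ).fderiv]
      simp only [hB, of_apply, cderiv, _root_.sum_apply, _root_.smul_apply, smul_eq_mul, Finset.mul_sum,
        ← Finset.sum_add_distrib, Finset.sum_div]
      exact Finset.sum_congr rfl fun j _ => by ring
    simp only [det_apply']
    rw [cderiv_sum_mul _ (f := fun (σ : Equiv.Perm m) _ => ((Equiv.Perm.sign σ : ℤ) : ℂ))
      (g := fun σ w => ∏ k, A w (σ k) k) (fun σ _ => differentiableAt_const _)
      (fun σ _ => (hprod σ).differentiableAt)]
    simp only [cderiv_const, zero_mul, zero_add, hcp, Finset.mul_sum]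
    rw [Finset.sum_comm]
    refine Finset.sum_congr rfl fun j _ => Finset.sum_congr rfl fun σ _ => ?_
    rw [← Finset.mul_prod_erase _ _ (Finset.mem_univ j), updateCol_self]
    have : ∏ k ∈ Finset.univ.erase j, (A z).updateCol j (fun k => B k j) (σ k) k =
        ∏ k ∈ Finset.univ.erase j, A z (σ k) k :=
      Finset.prod_congr rfl fun k hk => by rw [updateCol_ne (Finset.ne_of_mem_erase hk)]
    rw [this]; ring
  have h2 : (A z).det * ((A z)⁻¹ * B).trace = ((A z).adjugate * B).trace := by
    rw [inv_def, Matrix.smul_mul, trace_smul, smul_eq_mul, Ring.inverse_eq_inv',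
      mul_inv_cancel_left₀ h0]
  rw [h1, h2, trace]
  refine Finset.sum_congr rfl fun j _ => ?_
  rw [← cramer_apply, cramer_eq_adjugate_mulVec, diag_apply, mul_apply]
  rfl

/-- Obtained by differentiating A⁻¹ A = 1, which holds near the point since the determinant stays
nonzero. -/
lemma cderiv_inv (hA : ∀ k l, ContDiffAt ℝ 1 (fun w => A w k l) z) (h0 : (A z).det ≠ 0) :
    (of fun k l => cderiv c i (fun w => (A w)⁻¹ k l) z) =
      -((A z)⁻¹ * (of fun k l => cderiv c i (fun w => A w k l) z) * (A z)⁻¹) := by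
  set B : Matrix m m ℂ := of fun k l => cderiv c i (fun w => A w k l) z with hB
  set D : Matrix m m ℂ := of fun k l => cderiv c i (fun w => (A w)⁻¹ k l) z with hD
  have hAd : ∀ k l, DifferentiableAt ℝ (fun w => A w k l) z := fun k l =>
    (hA k l).differentiableAt (by norm_num)
  have hId : ∀ k l, DifferentiableAt ℝ (fun w => (A w)⁻¹ k l) z := fun k l =>
    (contDiffAt_inv hA h0 k l).differentiableAt (by norm_num)
  have hne : ∀ᶠ w in nhds z, (A w).det ≠ 0 :=
    (contDiffAt_det hA).continuousAt.eventually_ne h0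
  have h1 : D * A z + (A z)⁻¹ * B = 0 := by
    ext k l
    have hc : (fun w => ∑ j, (A w)⁻¹ k j * A w j l) =ᶠ[nhds z] fun _ => (1 : Matrix m m ℂ) k l := by
      filter_upwards [hne] with w hw
      rw [← nonsing_inv_mul (A w) (isUnit_iff_ne_zero.mpr hw), mul_apply]
    have h2 := cderiv_congr (c := c) (i := i) hc
    rw [cderiv_const, cderiv_sum_mul _ (f := fun j w => (A w)⁻¹ k j) (g := fun j w => A w j l)
      (fun j _ => hId k j) (fun j _ => hAd j l), Finset.sum_add_distrib] at h2
    simpa [mul_apply, hD, hB] using h2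
  have hu : IsUnit (A z).det := isUnit_iff_ne_zero.mpr h0
  calc D = D * A z * (A z)⁻¹ := by rw [Matrix.mul_assoc, mul_nonsing_inv _ hu, Matrix.mul_one]
    _ = _ := by rw [eq_neg_of_add_eq_zero_left h1, Matrix.neg_mul]

end MatrixCalculus

/-! ### Functions, gradients and Hessians in holomorphic charts -/

section Charts

open Matrix

variable {n : ℕ} {M : Type*} [TopologicalSpace M] [ChartedSpace (Cn n) M]

/-- Real functions on `M` that are smooth in every chart of the atlas. -/
def Sm (f : M → ℝ) : Prop :=
  ∀ e ∈ atlas (Cn n) M, ContDiffOn ℝ ∞ (fun z => f (e.symm z)) e.target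

/-- The complex gradient `(∂f/∂zⁱ)ᵢ` in a chart. -/
def grad (e : OpenPartialHomeomorph M (Cn n)) (f : M → ℝ) (z : Cn n) : Fin n → ℂ :=
  fun i => cderiv (-Complex.I) i (inChart e f) z

/-- The complex Hessian in a chart. -/
def hess (e : OpenPartialHomeomorph M (Cn n)) (f : M → ℝ) (z : Cn n) : Matrix (Fin n) (Fin n) ℂ :=
  complexHessian (inChart e f) z

/-- The Jacobian matrix `∂wᵏ/∂zⁱ` (row `i`, column `k`) of a change of coordinates. -/
def jac (e e' : OpenPartialHomeomorph M (Cn n)) (z : Cn n) : Matrix (Fin n) (Fin n) ℂ :=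
  of fun i k => fderiv ℂ (e' ∘ e.symm) z (Pi.single i 1) k

variable {e e' : OpenPartialHomeomorph M (Cn n)} {z : Cn n} {f : M → ℝ}

section Transition

variable [IsManifold 𝓘(ℂ, Cn n) ω M]

lemma contDiffAt_transition (he : e ∈ atlas (Cn n) M) (he' : e' ∈ atlas (Cn n) M)
    (hz : z ∈ e.target) (hz' : e.symm z ∈ e'.source) : ContDiffAt ℂ ω (e' ∘ e.symm) z := by
  have h := HasGroupoid.compatible (G := contDiffGroupoid ω 𝓘(ℂ, Cn n)) he he'
  rw [contDiffGroupoid, mem_groupoid_of_pregroupoid] at h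
  have h1 : ContDiffOn ℂ ω (e' ∘ e.symm) (e.symm ≫ₕ e').source := by
    simpa [contDiffPregroupoid] using h.1
  refine h1.contDiffAt ((e.symm ≫ₕ e').open_source.mem_nhds ?_)
  simp [hz, hz']

lemma contDiffAt_transition_real (he : e ∈ atlas (Cn n) M) (he' : e' ∈ atlas (Cn n) M)
    (hz : z ∈ e.target) (hz' : e.symm z ∈ e'.source) : ContDiffAt ℝ ∞ (e' ∘ e.symm) z :=
  ((contDiffAt_transition he he' hz hz').of_le (by simp)).restrict_scalars ℝ

lemma eventually_chart (e e' : OpenPartialHomeomorph M (Cn n)) (hz : z ∈ e.target)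
    (hz' : e.symm z ∈ e'.source) :
    ∀ᶠ w in nhds z, w ∈ e.target ∧ e.symm w ∈ e'.source :=
  (e.open_target.mem_nhds hz |> Filter.eventually_of_mem <| fun _ h => h).and
    ((e.continuousAt_symm hz).eventually (e'.open_source.mem_nhds hz'))

lemma isManifold_real : IsManifold 𝓘(ℝ, Cn n) ∞ M := by
  refine isManifold_of_contDiffOn _ _ _ fun e e' he he' => ?_
  simp only [modelWithCornersSelf_coe, modelWithCornersSelf_coe_symm, Function.id_comp,
    Function.comp_id, Set.preimage_id, Set.range_id, Set.inter_univ]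
  intro z hz
  have hz' : z ∈ e.target ∧ e.symm z ∈ e'.source := by simpa using hz
  exact (contDiffAt_transition_real he he' hz'.1 hz'.2).contDiffWithinAt

lemma sm_of_contMDiff (hf : ContMDiff 𝓘(ℝ, Cn n) 𝓘(ℝ, ℝ) ∞ f) : Sm (n := n) f := by
  intro e he
  have : IsManifold 𝓘(ℝ, Cn n) ∞ M := isManifold_real
  have h1 := contMDiffOn_symm_of_mem_maximalAtlas
    (IsManifold.subset_maximalAtlas (I := 𝓘(ℝ, Cn n)) (n := ∞) he)
  have h2 : ContMDiffOn 𝓘(ℝ, Cn n) 𝓘(ℝ, ℝ) ∞ (f ∘ e.symm) e.target :=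
    hf.comp_contMDiffOn h1
  exact contMDiffOn_iff_contDiffOn.mp h2

end Transition

lemma Sm.contDiffAt (hf : Sm (n := n) f) (he : e ∈ atlas (Cn n) M) (hz : z ∈ e.target) :
    ContDiffAt ℝ ∞ (fun w => f (e.symm w)) z :=
  (hf e he).contDiffAt (e.open_target.mem_nhds hz)

lemma Sm.inChart_contDiffAt (hf : Sm (n := n) f) (he : e ∈ atlas (Cn n) M) (hz : z ∈ e.target) :
    ContDiffAt ℝ ∞ (inChart e f) z :=
  Complex.ofRealCLM.contDiff.contDiffAt.comp z (hf.contDiffAt he hz)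

lemma Sm.inChart_contDiffOn (hf : Sm (n := n) f) (he : e ∈ atlas (Cn n) M) :
    ContDiffOn ℝ ∞ (inChart e f) e.target := fun _ hz =>
  (hf.inChart_contDiffAt he hz).contDiffWithinAt

lemma Sm.differentiableAt (hf : Sm (n := n) f) (he : e ∈ atlas (Cn n) M) (hz : z ∈ e.target) :
    DifferentiableAt ℝ (fun w => f (e.symm w)) z :=
  (hf.contDiffAt he hz).differentiableAt (by simp)

lemma Sm.inChart_differentiableAt (hf : Sm (n := n) f) (he : e ∈ atlas (Cn n) M)
    (hz : z ∈ e.target) : DifferentiableAt ℝ (inChart e f) z :=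
  (hf.inChart_contDiffAt he hz).differentiableAt (by simp)

lemma Sm.grad_contDiffOn (hf : Sm (n := n) f) (he : e ∈ atlas (Cn n) M) (i : Fin n) :
    ContDiffOn ℝ ∞ (fun w => grad e f w i) e.target :=
  contDiffOn_cderiv e.open_target (hf.inChart_contDiffOn he)

lemma hess_apply (e : OpenPartialHomeomorph M (Cn n)) (f : M → ℝ) (z : Cn n) (i j : Fin n) :
    hess e f z i j = cderiv (-Complex.I) i (cderiv Complex.I j (inChart e f)) z :=
  complexHessian_eq _ _ _ _

lemma Sm.hess_contDiffOn (hf : Sm (n := n) f) (he : e ∈ atlas (Cn n) M) (i j : Fin n) :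
    ContDiffOn ℝ ∞ (fun w => hess e f w i j) e.target := by
  simp only [hess_apply]
  exact contDiffOn_cderiv e.open_target
    (contDiffOn_cderiv e.open_target (hf.inChart_contDiffOn he))

/-- The objects on `M` are defined pointwise in a preferred chart that jumps from point to point, so
their continuity is seen only after rewriting them in one fixed chart. -/
lemma continuous_of_charts {G : M → ℝ}
    (hG : ∀ e ∈ atlas (Cn n) M, ContinuousOn (fun z => G (e.symm z)) e.target) :
    Continuous G := by
  rw [continuous_iff_continuousAt]
  intro x
  set e := chartAt (Cn n) x
  have hx : x ∈ e.source := mem_chart_source _ x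
  have h1 : ContinuousAt (fun z => G (e.symm z)) (e x) :=
    (hG e (chart_mem_atlas _ x)).continuousAt (e.open_target.mem_nhds (e.map_source hx))
  have h2 : ContinuousAt (fun y => G (e.symm (e y))) x :=
    ContinuousAt.comp (f := e) (g := fun z => G (e.symm z)) h1 (e.continuousAt hx)
  refine h2.congr ?_
  filter_upwards [e.open_source.mem_nhds hx] with y hy
  rw [e.left_inv hy]

lemma Sm.continuous (hf : Sm (n := n) f) : Continuous f :=
  continuous_of_charts (n := n) fun e he => (hf e he).continuousOn

lemma Sm.const (a : ℝ) : Sm (n := n) (fun _ : M => a) := fun _ _ => contDiffOn_const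

lemma Sm.add {f g : M → ℝ} (hf : Sm (n := n) f) (hg : Sm (n := n) g) :
    Sm (n := n) (fun x => f x + g x) := fun e he => (hf e he).add (hg e he)

lemma Sm.sub {f g : M → ℝ} (hf : Sm (n := n) f) (hg : Sm (n := n) g) :
    Sm (n := n) (fun x => f x - g x) := fun e he => (hf e he).sub (hg e he)

lemma Sm.mul {f g : M → ℝ} (hf : Sm (n := n) f) (hg : Sm (n := n) g) :
    Sm (n := n) (fun x => f x * g x) := fun e he => (hf e he).mul (hg e he)

lemma Sm.sum {ι : Type*} {s : Finset ι} {f : ι → M → ℝ} (hf : ∀ a ∈ s, Sm (n := n) (f a)) :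
    Sm (n := n) (fun x => ∑ a ∈ s, f a x) := fun e he =>
  ContDiffOn.sum fun a ha => hf a ha e he

lemma Sm.exp {f : M → ℝ} (hf : Sm (n := n) f) : Sm (n := n) (fun x => Real.exp (f x)) :=
  fun e he => (hf e he).exp

lemma Sm.log {f : M → ℝ} (hf : Sm (n := n) f) (h0 : ∀ x, f x ≠ 0) :
    Sm (n := n) (fun x => Real.log (f x)) :=
  fun e he => (hf e he).log fun _ _ => h0 _

lemma grad_conj (e : OpenPartialHomeomorph M (Cn n)) (f : M → ℝ) (z : Cn n) (i : Fin n) :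
    cderiv Complex.I i (inChart e f) z = (starRingEnd ℂ) (grad e f z i) := by
  have := cderiv_ofReal_conj Complex.I i (fun w => f (e.symm w)) z
  rw [Complex.conj_I] at this
  exact this

section Invariance

variable [IsManifold 𝓘(ℂ, Cn n) ω M]

lemma inChart_eventuallyEq (f : M → ℝ) (hz : z ∈ e.target)
    (hz' : e.symm z ∈ e'.source) :
    inChart e f =ᶠ[nhds z] inChart e' f ∘ (e' ∘ e.symm) := by
  filter_upwards [eventually_chart e e' hz hz'] with w hw
  simp [inChart, e'.left_inv hw.2]

lemma hasFDerivAt_transition (he : e ∈ atlas (Cn n) M) (he' : e' ∈ atlas (Cn n) M)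
    (hz : z ∈ e.target) (hz' : e.symm z ∈ e'.source) :
    HasFDerivAt (e' ∘ e.symm) (fderiv ℂ (e' ∘ e.symm) z) z :=
  ((contDiffAt_transition he he' hz hz').differentiableAt (by simp)).hasFDerivAt

lemma grad_transform (hf : Sm (n := n) f) (he : e ∈ atlas (Cn n) M) (he' : e' ∈ atlas (Cn n) M)
    (hz : z ∈ e.target) (hz' : e.symm z ∈ e'.source) :
    grad e f z = jac e e' z *ᵥ grad e' f (e' (e.symm z)) := by
  funext i
  rw [grad, cderiv_congr (inChart_eventuallyEq f hz hz'),
    cderiv_comp_holomorphic (hasFDerivAt_transition he he' hz hz')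
      (hf.inChart_differentiableAt he' (e'.map_source hz'))]
  rfl

/-- No second derivatives of the coordinate change survive: after ∂̄ the coefficients are conjugates
of holomorphic functions, and ∂ kills them. -/
lemma hess_transform (hf : Sm (n := n) f) (he : e ∈ atlas (Cn n) M) (he' : e' ∈ atlas (Cn n) M)
    (hz : z ∈ e.target) (hz' : e.symm z ∈ e'.source) :
    hess e f z = jac e e' z * hess e' f (e' (e.symm z)) * (jac e e' z)ᴴ := by
  ext i j
  have hw' : e' (e.symm z) ∈ e'.target := e'.map_source hz'
  have hJ : ∀ j l, ContDiffAt ℂ ω (fun w => jac e e' w j l) z := fun j l => by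
    have h1 := (contDiffAt_transition he he' hz hz').fderiv_right (m := ω) (by simp)
    have h2 : ContDiffAt ℂ ω (fun w => fderiv ℂ (e' ∘ e.symm) w (Pi.single j 1)) z :=
      h1.clm_apply contDiffAt_const
    exact contDiffAt_pi.mp h2 l
  have hJc : ∀ j l, cderiv (-Complex.I) i (fun w => (starRingEnd ℂ) (jac e e' w j l)) z = 0 := by
    intro j l
    rw [cderiv_conj, map_neg, Complex.conj_I, neg_neg]
    have h1 := ((hJ j l).differentiableAt (by simp)).hasFDerivAt.restrictScalars ℝ
    have h2 : fderiv ℂ (fun w => jac e e' w j l) z (Pi.single i Complex.I) =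
        Complex.I * fderiv ℂ (fun w => jac e e' w j l) z (Pi.single i 1) := by
      rw [← smul_eq_mul, ← map_smul]; congr 1; rw [← Pi.single_smul]; simp
    rw [cderiv, h1.fderiv]
    simp only [ContinuousLinearMap.coe_restrictScalars', h2, ← mul_assoc, Complex.I_mul_I]
    simp
  have hJd : ∀ j l, DifferentiableAt ℝ (fun w => (starRingEnd ℂ) (jac e e' w j l)) z :=
    fun j l => Complex.conjCLE.differentiableAt.comp z
      (((hJ j l).restrict_scalars ℝ).differentiableAt (by simp))
  have hbar : cderiv Complex.I j (inChart e f) =ᶠ[nhds z] fun w =>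
      ∑ l, (starRingEnd ℂ) (jac e e' w j l) *
        (cderiv Complex.I l (inChart e' f) ∘ (e' ∘ e.symm)) w := by
    filter_upwards [eventually_chart e e' hz hz'] with w hw
    rw [cderiv_congr (inChart_eventuallyEq f hw.1 hw.2),
      cderiv_bar_comp_holomorphic (hasFDerivAt_transition he he' hw.1 hw.2)
        (hf.inChart_differentiableAt he' (e'.map_source hw.2))]
    rfl
  have hfd : ∀ l, DifferentiableAt ℝ (cderiv Complex.I l (inChart e' f)) (e' (e.symm z)) :=
    fun l => (contDiffAt_cderiv (m := 1)
      ((hf.inChart_contDiffAt he' hw').of_le (by norm_cast))).differentiableAt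
        (by simp)
  have hΦ := hasFDerivAt_transition he he' hz hz'
  have hfd' : ∀ l, DifferentiableAt ℝ (cderiv Complex.I l (inChart e' f) ∘ (e' ∘ e.symm)) z :=
    fun l => (hfd l).comp z (hΦ.restrictScalars ℝ).differentiableAt
  rw [hess_apply, cderiv_congr hbar, cderiv_sum_mul _ (f := fun l w => (starRingEnd ℂ) (jac e e' w j l))
      (fun l _ => hJd j l) (fun l _ => hfd' l)]
  simp_rw [hJc, fun l => cderiv_comp_holomorphic (i := i) hΦ (hfd l)]
  simp only [mul_apply, conjTranspose_apply, hess_apply, zero_mul, zero_add, Finset.mul_sum,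
    Finset.sum_mul]
  refine Finset.sum_congr rfl fun l _ => Finset.sum_congr rfl fun k _ => ?_
  simp only [jac, of_apply, Complex.star_def, Function.comp_apply]
  ring

end Invariance

end Charts

/-! ### Traces, Laplacians and gradient pairings of Kähler metrics -/

section Metric

open Matrix

variable {n : ℕ} {M : Type*} [TopologicalSpace M] [ChartedSpace (Cn n) M]
  {e e' : OpenPartialHomeomorph M (Cn n)} {z : Cn n} {f ψ : M → ℝ} (g h : KahlerMetric n M)

/-- The trace `tr_g h = g^{i j̄} h_{i j̄}` in a chart. -/
def trE (e : OpenPartialHomeomorph M (Cn n)) (z : Cn n) : ℝ :=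
  ((g.coeff e z)⁻¹ * h.coeff e z).trace.re

/-- The Laplacian `g^{i j̄} f_{i j̄}` in a chart. -/
def lapE (e : OpenPartialHomeomorph M (Cn n)) (f : M → ℝ) (z : Cn n) : ℝ :=
  ((g.coeff e z)⁻¹ * hess e f z).trace.re

/-- The pairing `g^{i j̄} f_i ψ_{j̄}` of two gradients in a chart. -/
def pairE (e : OpenPartialHomeomorph M (Cn n)) (f ψ : M → ℝ) (z : Cn n) : ℝ :=
  (star (grad e ψ z) ⬝ᵥ ((g.coeff e z)⁻¹ *ᵥ grad e f z)).re

/-- `tr_g h` as a function on `M`. -/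
def KahlerMetric.trM (x : M) : ℝ := trE g h (chartAt (Cn n) x) (chartAt (Cn n) x x)

/-- The pairing of the gradients as a function on `M`. -/
def KahlerMetric.pairM (f ψ : M → ℝ) (x : M) : ℝ :=
  pairE g (chartAt (Cn n) x) f ψ (chartAt (Cn n) x x)

variable {g h}

lemma pairE_self : pairE g e f f z = qform (g.coeff e z)⁻¹ (grad e f z) := rfl

lemma isUnit_det (he : e ∈ atlas (Cn n) M) (hz : z ∈ e.target) : IsUnit (g.coeff e z).det :=
  isUnit_iff_ne_zero.mpr (g.posDef e he z hz).det_pos.ne'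

lemma coeff_transform (he : e ∈ atlas (Cn n) M) (he' : e' ∈ atlas (Cn n) M)
    (hz : z ∈ e.target) (hz' : e.symm z ∈ e'.source) :
    g.coeff e z = jac e e' z * g.coeff e' (e' (e.symm z)) * (jac e e' z)ᴴ := by
  ext i j
  rw [g.transform e he e' he' z hz hz' i j]
  simp only [mul_apply, conjTranspose_apply, Finset.sum_mul]
  rw [Finset.sum_comm]
  refine Finset.sum_congr rfl fun l _ => Finset.sum_congr rfl fun k _ => ?_
  simp only [jac, of_apply, Complex.star_def]
  ring

lemma isUnit_jac_det (g : KahlerMetric n M) (he : e ∈ atlas (Cn n) M) (he' : e' ∈ atlas (Cn n) M)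
    (hz : z ∈ e.target) (hz' : e.symm z ∈ e'.source) : IsUnit (jac e e' z).det := by
  have h1 := isUnit_det (g := g) he hz
  rw [coeff_transform he he' hz hz', det_mul, det_mul] at h1
  exact isUnit_of_mul_isUnit_left (isUnit_of_mul_isUnit_left h1)

lemma trace_congr {P A B : Matrix (Fin n) (Fin n) ℂ} (hP : IsUnit P.det) :
    ((P * A * Pᴴ)⁻¹ * (P * B * Pᴴ)).trace = (A⁻¹ * B).trace := by
  have hP' : IsUnit (Pᴴ).det := by rw [det_conjTranspose]; exact hP.star
  rw [Matrix.mul_inv_rev, Matrix.mul_inv_rev, trace_mul_comm]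
  calc _ = (P * B * (Pᴴ * (Pᴴ)⁻¹) * A⁻¹ * P⁻¹).trace := by simp only [Matrix.mul_assoc]
    _ = _ := by
      rw [mul_nonsing_inv _ hP', Matrix.mul_one, trace_mul_comm, ← Matrix.mul_assoc,
        ← Matrix.mul_assoc, nonsing_inv_mul _ hP, Matrix.one_mul, trace_mul_comm]

lemma pair_congr {P A : Matrix (Fin n) (Fin n) ℂ} (hP : IsUnit P.det) (v w : Fin n → ℂ) :
    star (P *ᵥ w) ⬝ᵥ ((P * A * Pᴴ)⁻¹ *ᵥ (P *ᵥ v)) = star w ⬝ᵥ (A⁻¹ *ᵥ v) := by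
  have hP' : IsUnit (Pᴴ).det := by rw [det_conjTranspose]; exact hP.star
  rw [star_mulVec, Matrix.mul_inv_rev, Matrix.mul_inv_rev, ← dotProduct_mulVec, mulVec_mulVec,
    mulVec_mulVec, Matrix.mul_assoc, Matrix.mul_assoc, Matrix.mul_assoc, nonsing_inv_mul _ hP,
    Matrix.mul_one,
    ← Matrix.mul_assoc, mul_nonsing_inv _ hP', Matrix.one_mul]

section Invariance

variable [IsManifold 𝓘(ℂ, Cn n) ω M]

lemma trE_transform (he : e ∈ atlas (Cn n) M) (he' : e' ∈ atlas (Cn n) M)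
    (hz : z ∈ e.target) (hz' : e.symm z ∈ e'.source) :
    trE g h e z = trE g h e' (e' (e.symm z)) := by
  rw [trE, trE, coeff_transform he he' hz hz', coeff_transform (g := h) he he' hz hz',
    trace_congr (isUnit_jac_det g he he' hz hz')]

lemma lapE_transform (hf : Sm (n := n) f) (he : e ∈ atlas (Cn n) M) (he' : e' ∈ atlas (Cn n) M)
    (hz : z ∈ e.target) (hz' : e.symm z ∈ e'.source) :
    lapE g e f z = lapE g e' f (e' (e.symm z)) := by
  rw [lapE, lapE, coeff_transform he he' hz hz', hess_transform hf he he' hz hz',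
    trace_congr (isUnit_jac_det g he he' hz hz')]

lemma pairE_transform (hf : Sm (n := n) f) (hψ : Sm (n := n) ψ) (he : e ∈ atlas (Cn n) M)
    (he' : e' ∈ atlas (Cn n) M) (hz : z ∈ e.target) (hz' : e.symm z ∈ e'.source) :
    pairE g e f ψ z = pairE g e' f ψ (e' (e.symm z)) := by
  rw [pairE, pairE, coeff_transform he he' hz hz', grad_transform hf he he' hz hz',
    grad_transform hψ he he' hz hz', pair_congr (isUnit_jac_det g he he' hz hz')]

lemma KahlerMetric.laplacian_eq_lapE (g : KahlerMetric n M) (f : M → ℝ) (x : M) :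
    g.laplacian f x = lapE g (chartAt (Cn n) x) f (chartAt (Cn n) x x) := by
  rw [KahlerMetric.laplacian, lapE, trace, Finset.sum_comm]
  congr 1

lemma KahlerMetric.gradNorm_eq (g : KahlerMetric n M) (f : M → ℝ) (x : M) :
    g.gradNorm f x = Real.sqrt (g.pairM f f x) := by
  rw [KahlerMetric.gradNorm, KahlerMetric.pairM, pairE, dotProduct]
  congr 2
  rw [Finset.sum_comm]
  refine Finset.sum_congr rfl fun j _ => ?_
  rw [mulVec, dotProduct, Finset.mul_sum]
  refine Finset.sum_congr rfl fun i _ => ?_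
  rw [wirtinger_eq, wirtingerBar_eq, grad_conj, Pi.star_apply, Complex.star_def]
  simp only [KahlerMetric.matrixAt, grad]
  ring

/-- Together with `laplacian_eq` and `pairM_eq` this permits every computation in whichever chart of
the atlas is convenient. -/
lemma trM_eq (he : e ∈ atlas (Cn n) M) (hz : z ∈ e.target) :
    g.trM h (e.symm z) = trE g h e z := by
  rw [KahlerMetric.trM, ← trE_transform he (chart_mem_atlas _ _) hz (mem_chart_source _ _)]

lemma laplacian_eq (hf : Sm (n := n) f) (he : e ∈ atlas (Cn n) M) (hz : z ∈ e.target) :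
    g.laplacian f (e.symm z) = lapE g e f z := by
  rw [KahlerMetric.laplacian_eq_lapE,
    ← lapE_transform hf he (chart_mem_atlas _ _) hz (mem_chart_source _ _)]

lemma pairM_eq (hf : Sm (n := n) f) (hψ : Sm (n := n) ψ) (he : e ∈ atlas (Cn n) M)
    (hz : z ∈ e.target) : g.pairM f ψ (e.symm z) = pairE g e f ψ z := by
  rw [KahlerMetric.pairM,
    ← pairE_transform hf hψ he (chart_mem_atlas _ _) hz (mem_chart_source _ _)]

end Invariance

lemma coeff_contDiffAt (he : e ∈ atlas (Cn n) M) (hz : z ∈ e.target) (i j : Fin n) :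
    ContDiffAt ℝ ∞ (fun w => g.coeff e w i j) z :=
  (g.smooth e he i j).contDiffAt (e.open_target.mem_nhds hz)

lemma coeff_inv_contDiffAt (he : e ∈ atlas (Cn n) M) (hz : z ∈ e.target) (i j : Fin n) :
    ContDiffAt ℝ ∞ (fun w => (g.coeff e w)⁻¹ i j) z :=
  contDiffAt_inv (coeff_contDiffAt he hz) (isUnit_det he hz).ne_zero i j

lemma continuousOn_trace_re {m : Type*} [Fintype m] {A B : Cn n → Matrix m m ℂ} {T : Set (Cn n)}
    (hA : ∀ i j, ContinuousOn (fun z => A z i j) T)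
    (hB : ∀ i j, ContinuousOn (fun z => B z i j) T) :
    ContinuousOn (fun z => (A z * B z).trace.re) T := by
  refine Complex.continuous_re.comp_continuousOn ?_
  simp only [trace, diag_apply, mul_apply]
  exact continuousOn_finsetSum _ fun i _ => continuousOn_finsetSum _ fun j _ =>
    (hA i j).mul (hB j i)

lemma coeff_continuousOn (he : e ∈ atlas (Cn n) M) (i j : Fin n) :
    ContinuousOn (fun w => g.coeff e w i j) e.target := (g.smooth e he i j).continuousOn

lemma coeff_inv_continuousOn (he : e ∈ atlas (Cn n) M) (i j : Fin n) :
    ContinuousOn (fun w => (g.coeff e w)⁻¹ i j) e.target := fun _ hz =>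
  (coeff_inv_contDiffAt he hz i j).continuousAt.continuousWithinAt

section Continuity

variable [IsManifold 𝓘(ℂ, Cn n) ω M]

lemma continuous_laplacian (hf : Sm (n := n) f) : Continuous (g.laplacian f) :=
  continuous_of_charts (n := n) fun _ he =>
    (continuousOn_trace_re (coeff_inv_continuousOn (g := g) he)
      fun i j => (hf.hess_contDiffOn he i j).continuousOn).congr fun _ hz => laplacian_eq hf he hz

lemma continuous_pairM (hf : Sm (n := n) f) (hψ : Sm (n := n) ψ) : Continuous (g.pairM f ψ) := by
  refine continuous_of_charts (n := n) fun e he => ContinuousOn.congr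
    (f := fun z => pairE g e f ψ z) ?_ fun _ hz => pairM_eq hf hψ he hz
  refine Complex.continuous_re.comp_continuousOn ?_
  simp only [dotProduct, mulVec, Pi.star_apply]
  refine continuousOn_finsetSum _ fun i _ => ContinuousOn.mul ?_ ?_
  · exact continuous_star.comp_continuousOn (hψ.grad_contDiffOn he i).continuousOn
  · exact continuousOn_finsetSum _ fun j _ => (coeff_inv_continuousOn he i j).mul
      (hf.grad_contDiffOn he j).continuousOn

end Continuity

lemma pairM_self_nonneg (f : M → ℝ) (x : M) : 0 ≤ g.pairM f f x :=
  qform_inv_nonneg (g.posDef _ (chart_mem_atlas _ x) _ (mem_chart_target _ x)) _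

section Deformation

variable [IsManifold 𝓘(ℂ, Cn n) ω M]

lemma hess_isHermitian (hf : Sm (n := n) f) (he : e ∈ atlas (Cn n) M) (hz : z ∈ e.target) :
    (hess e f z).IsHermitian := by
  ext i j
  have h2 : ContDiffAt ℝ 2 (inChart e f) z := (hf.inChart_contDiffAt he hz).of_le (by norm_cast)
  rw [conjTranspose_apply, hess_apply, hess_apply, cderiv_comm h2, Complex.star_def]
  have : cderiv Complex.I i (inChart e f) = fun w => (starRingEnd ℂ) (grad e f w i) :=
    funext fun w => grad_conj e f w i
  rw [cderiv_comm h2, this, cderiv_conj, map_neg, Complex.conj_I, neg_neg, Complex.conj_conj]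
  exact cderiv_comm h2

/-- The Kähler metric `g_{i j̄} + φ_{i j̄}`. -/
def KahlerMetric.addHess (g : KahlerMetric n M) (φ : M → ℝ) (hφ : Sm (n := n) φ)
    (hpos : ∀ e ∈ atlas (Cn n) M, ∀ z ∈ e.target, (g.coeff e z + hess e φ z).PosDef) :
    KahlerMetric n M where
  coeff e z := g.coeff e z + hess e φ z
  smooth e he i j := (g.smooth e he i j).add (hφ.hess_contDiffOn he i j)
  posDef := hpos
  transform e he e' he' z hz hz' i j := by
    have h1 : g.coeff e z + hess e φ z = jac e e' z *
        (g.coeff e' (e' (e.symm z)) + hess e' φ (e' (e.symm z))) * (jac e e' z)ᴴ := by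
      rw [Matrix.mul_add, Matrix.add_mul, ← coeff_transform he he' hz hz',
        ← hess_transform hφ he he' hz hz']
    rw [h1]
    simp only [mul_apply, conjTranspose_apply, Finset.sum_mul]
    rw [Finset.sum_comm]
    refine Finset.sum_congr rfl fun l _ => Finset.sum_congr rfl fun k _ => ?_
    simp only [jac, of_apply, Complex.star_def]
    ring
  closed e he z hz i j k := by
    have hd : ∀ i j, DifferentiableAt ℝ (fun w => hess e φ w i j) z := fun i j =>
      ((hφ.hess_contDiffOn he i j).contDiffAt (e.open_target.mem_nhds hz)).differentiableAt
        (by simp)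
    have hg : ∀ i j, DifferentiableAt ℝ (fun w => g.coeff e w i j) z := fun i j =>
      (coeff_contDiffAt he hz i j).differentiableAt (by simp)
    have h1 := g.closed e he z hz i j k
    rw [wirtinger_eq, wirtinger_eq] at h1 ⊢
    simp only [Matrix.add_apply]
    rw [cderiv_add (hg i j) (hd i j), cderiv_add (hg k j) (hd k j), h1]
    congr 1
    -- For the Hessian part closedness is the commutation of ∂_i and ∂_k applied to ∂_j̄ φ.
    simp only [hess_apply]
    exact cderiv_comm (contDiffAt_cderiv (m := 2)
      ((hφ.inChart_contDiffAt he hz).of_le (by norm_cast)))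

end Deformation

end Metric

/-! ### Second derivatives at a local minimum -/

section LocalMin

open Matrix

variable {n : ℕ}

/-- A negative second derivative at this critical point would make it a local maximum as well, so
the function would be locally constant and the second derivative zero. -/
lemma second_deriv_nonneg {p : ℝ → ℝ} (hp : ContDiffAt ℝ 2 p 0) (hmin : IsLocalMin p 0) :
    0 ≤ deriv (deriv p) 0 := by
  by_contra! hneg
  have hmax := isLocalMax_of_deriv_deriv_neg hneg hmin.deriv_eq_zero hp.continuousAt
  have hconst : p =ᶠ[nhds 0] fun _ => p 0 := by
    filter_upwards [hmin, hmax] with t h1 h2 using le_antisymm h2 h1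
  have h1 : deriv p =ᶠ[nhds 0] fun _ => 0 := by
    filter_upwards [hconst.eventuallyEq_nhds] with t ht
    rw [ht.deriv_eq]; simp
  rw [h1.deriv_eq] at hneg
  simp at hneg

lemma second_fderiv_nonneg {u : Cn n → ℝ} {z : Cn n} (hu : ContDiffAt ℝ 2 u z)
    (hmin : IsLocalMin u z) (a : Cn n) : 0 ≤ fderiv ℝ (fun w => fderiv ℝ u w a) z a := by
  set γ : ℝ → Cn n := fun t => z + t • a with hγ
  have hγd : ∀ t, HasDerivAt γ a t := fun t => by
    have := ((hasDerivAt_id t).smul_const a).const_add z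
    rw [one_smul] at this
    exact this
  have hγ0 : γ 0 = z := by simp [hγ]
  have hγc : ContDiff ℝ 2 γ := contDiff_const.add (contDiff_id.smul contDiff_const)
  have htend : Filter.Tendsto γ (nhds 0) (nhds z) := by
    have := hγc.continuous.tendsto 0
    rwa [hγ0] at this
  have hu' : ContDiffAt ℝ 2 u (γ 0) := by rwa [hγ0]
  have h1 : ContDiffAt ℝ 2 (u ∘ γ) 0 := hu'.comp 0 hγc.contDiffAt
  have h2 : IsLocalMin (u ∘ γ) 0 := by
    have : ∀ᶠ t in nhds (0 : ℝ), u z ≤ u (γ t) := htend.eventually hmin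
    simpa [IsLocalMin, IsMinFilter, hγ0] using this
  have h3 : deriv (u ∘ γ) =ᶠ[nhds 0] fun t => fderiv ℝ u (γ t) a := by
    have hev : ∀ᶠ w in nhds z, ContDiffAt ℝ 2 u w := hu.eventually (by simp)
    filter_upwards [htend.eventually hev] with t ht
    exact ((ht.differentiableAt (by simp)).hasFDerivAt.comp_hasDerivAt t (hγd t)).deriv
  have h4 := second_deriv_nonneg h1 h2
  have h5 : DifferentiableAt ℝ (fun w => fderiv ℝ u w a) (γ 0) := by
    rw [hγ0]
    exact ((hu.fderiv_right (m := 1) (by norm_num)).clm_apply contDiffAt_const).differentiableAt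
      (by simp)
  have h6 : HasDerivAt (fun t => fderiv ℝ u (γ t) a) _ 0 :=
    h5.hasFDerivAt.comp_hasDerivAt 0 (hγd 0)
  rw [h3.deriv_eq, h6.deriv, hγ0] at h4
  exact h4

lemma fderiv_eq_sum (f : Cn n → ℂ) (w a : Cn n) : fderiv ℝ f w a =
    ∑ k, (a k * cderiv (-Complex.I) k f w + (starRingEnd ℂ) (a k) * cderiv Complex.I k f w) :=
  realLinear_eq_sum _ _

/-- Adding the real second derivatives in the directions a and √-1 a cancels the ∂∂ and ∂̄∂̄ terms
and leaves four times the complex Hessian form. -/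
lemma complexHessian_nonneg {u : Cn n → ℝ} {z : Cn n} (hu : ContDiffAt ℝ 2 u z)
    (hmin : IsLocalMin u z) (a : Cn n) : 0 ≤ (∑ k, ∑ l, a k * (starRingEnd ℂ) (a l) *
      cderiv (-Complex.I) k (cderiv Complex.I l fun w => (u w : ℂ)) z).re := by
  set f : Cn n → ℂ := fun w => (u w : ℂ) with hf
  have hfc : ContDiffAt ℝ 2 f z := Complex.ofRealCLM.contDiff.contDiffAt.comp z hu
  have hd : ∀ c k, DifferentiableAt ℝ (cderiv c k f) z := fun c k =>
    (contDiffAt_cderiv (m := 1) (hfc.of_le (by norm_num))).differentiableAt (by simp)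
  have key : ∀ a : Cn n, ((fderiv ℝ (fun w => fderiv ℝ u w a) z a : ℝ) : ℂ) =
      ∑ k, (a k * fderiv ℝ (cderiv (-Complex.I) k f) z a +
        (starRingEnd ℂ) (a k) * fderiv ℝ (cderiv Complex.I k f) z a) := by
    intro a
    have h1 : DifferentiableAt ℝ (fun w => fderiv ℝ u w a) z :=
      ((hu.fderiv_right (m := 1) (by norm_num)).clm_apply contDiffAt_const).differentiableAt
        (by simp)
    rw [← fderiv_ofReal h1]
    have h2 : (fun w => ((fderiv ℝ u w a : ℝ) : ℂ)) =ᶠ[nhds z] fun w =>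
        ∑ k, (a k * cderiv (-Complex.I) k f w + (starRingEnd ℂ) (a k) * cderiv Complex.I k f w) := by
      filter_upwards [hu.eventually (by simp)] with w hw
      rw [← fderiv_eq_sum, hf, fderiv_ofReal (hw.differentiableAt (by simp))]
    have h3 : HasFDerivAt (fun w => ∑ k, (a k * cderiv (-Complex.I) k f w +
        (starRingEnd ℂ) (a k) * cderiv Complex.I k f w)) _ z :=
      HasFDerivAt.fun_sum fun k _ => ((hd _ k).hasFDerivAt.const_mul (a k)).add
        ((hd _ k).hasFDerivAt.const_mul ((starRingEnd ℂ) (a k)))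
    rw [h2.fderiv_eq, h3.fderiv, _root_.sum_apply]
    rfl
  have h1 := second_fderiv_nonneg hu hmin a
  have h2 := second_fderiv_nonneg hu hmin (Complex.I • a)
  have h3 : ((fderiv ℝ (fun w => fderiv ℝ u w a) z a +
      fderiv ℝ (fun w => fderiv ℝ u w (Complex.I • a)) z (Complex.I • a) : ℝ) : ℂ) =
      4 * ∑ k, ∑ l, a k * (starRingEnd ℂ) (a l) *
        cderiv (-Complex.I) k (cderiv Complex.I l f) z := by
    rw [Complex.ofReal_add, key, key]
    simp only [fderiv_eq_sum (cderiv _ _ f), Finset.mul_sum, ← Finset.sum_add_distrib]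
    have hsw : ∑ k, ∑ l, 4 * (a k * (starRingEnd ℂ) (a l) *
          cderiv (-Complex.I) k (cderiv Complex.I l f) z) =
        ∑ k, ∑ l, (2 * (a k * (starRingEnd ℂ) (a l) *
          cderiv (-Complex.I) k (cderiv Complex.I l f) z) +
          2 * (a l * (starRingEnd ℂ) (a k) *
          cderiv (-Complex.I) l (cderiv Complex.I k f) z)) := by
      simp only [Finset.sum_add_distrib]
      rw [Finset.sum_comm (f := fun k l => 2 * (a l * (starRingEnd ℂ) (a k) *
          cderiv (-Complex.I) l (cderiv Complex.I k f) z))]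
      simp only [← Finset.sum_add_distrib]
      exact Finset.sum_congr rfl fun k _ => Finset.sum_congr rfl fun l _ => by ring
    rw [hsw]
    refine Finset.sum_congr rfl fun k _ => Finset.sum_congr rfl fun l _ => ?_
    rw [cderiv_comm hfc (c := Complex.I) (d := -Complex.I)]
    simp only [Pi.smul_apply, smul_eq_mul, map_mul, Complex.conj_I]
    linear_combination (a k * a l * cderiv (-Complex.I) l (cderiv (-Complex.I) k f) z +
      (starRingEnd ℂ) (a k) * (starRingEnd ℂ) (a l) * cderiv Complex.I l (cderiv Complex.I k f) z
      - a k * (starRingEnd ℂ) (a l) * cderiv (-Complex.I) k (cderiv Complex.I l f) z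
      - (starRingEnd ℂ) (a k) * a l * cderiv (-Complex.I) l (cderiv Complex.I k f) z)
      * Complex.I_mul_I
  have h4 := congrArg Complex.re h3
  simp only [Complex.ofReal_re, Complex.mul_re, Complex.re_ofNat, Complex.im_ofNat, zero_mul,
    sub_zero] at h4
  linarith

end LocalMin

/-! ### Positivity of g + ∂∂̄φ -/

section Positivity

open Matrix

variable {n : ℕ} {M : Type*} [TopologicalSpace M] [ChartedSpace (Cn n) M]
  {e e' : OpenPartialHomeomorph M (Cn n)} {z : Cn n} {f : M → ℝ}

lemma norm_dotProduct_mulVec_le {m : Type*} [Fintype m] (A : Matrix m m ℂ) (ξ : m → ℂ) :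
    ‖star ξ ⬝ᵥ (A *ᵥ ξ)‖ ≤ (∑ i, ∑ j, ‖A i j‖) * nsq ξ := by
  have hle : ∀ i, ‖ξ i‖ ^ 2 ≤ nsq ξ := fun i =>
    Finset.single_le_sum (f := fun i => ‖ξ i‖ ^ 2) (fun _ _ => sq_nonneg _) (Finset.mem_univ i)
  rw [dotProduct, Finset.sum_mul]
  refine (norm_sum_le _ _).trans (Finset.sum_le_sum fun i _ => ?_)
  rw [mulVec, dotProduct, Finset.mul_sum, Finset.sum_mul]
  refine (norm_sum_le _ _).trans (Finset.sum_le_sum fun j _ => ?_)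
  simp only [Pi.star_apply, norm_mul, norm_star]
  nlinarith [mul_nonneg (norm_nonneg (A i j)) (sq_nonneg (‖ξ i‖ - ‖ξ j‖)),
    mul_le_mul_of_nonneg_left (hle i) (norm_nonneg (A i j)),
    mul_le_mul_of_nonneg_left (hle j) (norm_nonneg (A i j))]

lemma nsq_pos {m : Type*} [Fintype m] {ξ : m → ℂ} (h : ξ ≠ 0) : 0 < nsq ξ := by
  obtain ⟨i, hi⟩ := Function.ne_iff.mp h
  exact Finset.sum_pos' (fun _ _ => sq_nonneg _) ⟨i, Finset.mem_univ i, by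
    have : 0 < ‖ξ i‖ := norm_pos_iff.mpr hi
    positivity⟩

lemma IsHermitian.qform_coe {m : Type*} [Fintype m] {A : Matrix m m ℂ} (hA : A.IsHermitian)
    (ξ : m → ℂ) : ((qform A ξ : ℝ) : ℂ) = star ξ ⬝ᵥ (A *ᵥ ξ) := by
  refine Complex.conj_eq_iff_re.mp ?_
  rw [starRingEnd_apply, ← star_dotProduct, star_mulVec, hA.eq, ← dotProduct_mulVec]

lemma IsHermitian.posDef_of_qform {m : Type*} [Fintype m] {A : Matrix m m ℂ} (hA : A.IsHermitian)
    (h : ∀ ξ, ξ ≠ 0 → 0 < qform A ξ) : A.PosDef :=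
  PosDef.of_dotProduct_mulVec_pos hA fun ξ hξ => by
    rw [← IsHermitian.qform_coe hA]; exact_mod_cast h ξ hξ

lemma IsHermitian.posSemidef_of_qform {m : Type*} [Fintype m] {A : Matrix m m ℂ}
    (hA : A.IsHermitian) (h : ∀ ξ, 0 ≤ qform A ξ) : A.PosSemidef :=
  PosSemidef.of_dotProduct_mulVec_nonneg hA fun ξ => by
    rw [← IsHermitian.qform_coe hA]; exact_mod_cast h ξ

/-- The form of `A x` dominates nsq/c, and the difference of the two forms is at most the sum of the
entries of `A y - A x` in modulus times nsq. -/
lemma eventually_posDef {X m : Type*} [TopologicalSpace X] [Fintype m] [DecidableEq m]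
    {A : X → Matrix m m ℂ}
    {x : X} (hA : ∀ i j, ContinuousAt (fun y => A y i j) x) (h0 : (A x).PosDef)
    (hH : ∀ᶠ y in nhds x, (A y).IsHermitian) : ∀ᶠ y in nhds x, (A y).PosDef := by
  set c := (A x)⁻¹.trace.re with hc
  have hcont : ContinuousAt (fun y => c * ∑ i, ∑ j, ‖(A y - A x) i j‖) x :=
    continuousAt_const.mul (tendsto_finsetSum _ fun i _ => tendsto_finsetSum _ fun j _ =>
      ((hA i j).sub continuousAt_const).norm)
  have hlt : ∀ᶠ y in nhds x, c * ∑ i, ∑ j, ‖(A y - A x) i j‖ < 1 :=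
    hcont.eventually_lt continuousAt_const (by simp)
  filter_upwards [hlt, hH] with y hy hHy
  refine IsHermitian.posDef_of_qform hHy fun ξ hξ => ?_
  have h1 : nsq ξ ≤ c * qform (A x) ξ := by
    have := nsq_le_qform_inv h0.inv ξ
    rwa [nonsing_inv_nonsing_inv _ (isUnit_iff_ne_zero.mpr h0.det_pos.ne')] at this
  have h2 : qform (A y) ξ = qform (A x) ξ + (star ξ ⬝ᵥ ((A y - A x) *ᵥ ξ)).re := by
    rw [qform, qform, sub_mulVec, dotProduct_sub, Complex.sub_re]; ring
  have h3 := (abs_le.mp (Complex.abs_re_le_norm (star ξ ⬝ᵥ ((A y - A x) *ᵥ ξ)))).1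
  have h4 := norm_dotProduct_mulVec_le (A y - A x) ξ
  have h5 := nsq_pos hξ
  have hc0 : 0 ≤ c := by
    have h := h0.inv.posSemidef.trace_nonneg
    exact (Complex.le_def.mp h).1
  have h6 : c * qform (A y) ξ ≥ nsq ξ - (c * ∑ i, ∑ j, ‖(A y - A x) i j‖) * nsq ξ := by
    rw [h2]
    nlinarith [mul_le_mul_of_nonneg_left (h3.trans' (neg_le_neg h4)) hc0]
  have h7 : 0 < c * qform (A y) ξ := by nlinarith
  exact pos_of_mul_pos_right h7 hc0

variable [IsManifold 𝓘(ℂ, Cn n) ω M]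

lemma coeff_add_hess_transform {g : KahlerMetric n M} (hf : Sm (n := n) f)
    (he : e ∈ atlas (Cn n) M) (he' : e' ∈ atlas (Cn n) M)
    (hz : z ∈ e.target) (hz' : e.symm z ∈ e'.source) :
    g.coeff e z + hess e f z = jac e e' z *
        (g.coeff e' (e' (e.symm z)) + hess e' f (e' (e.symm z))) * (jac e e' z)ᴴ := by
  rw [Matrix.mul_add, Matrix.add_mul, ← coeff_transform he he' hz hz',
        ← hess_transform hf he he' hz hz']

lemma posDef_transfer {g : KahlerMetric n M} (hf : Sm (n := n) f)
    (he : e ∈ atlas (Cn n) M) (he' : e' ∈ atlas (Cn n) M)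
    (hz : z ∈ e.target) (hz' : e.symm z ∈ e'.source)
    (h : (g.coeff e' (e' (e.symm z)) + hess e' f (e' (e.symm z))).PosDef) :
    (g.coeff e z + hess e f z).PosDef := by
  rw [coeff_add_hess_transform hf he he' hz hz']
  refine h.mul_mul_conjTranspose_same ?_
  have hu := isUnit_jac_det g he he' hz hz'
  exact Matrix.vecMul_injective_of_isUnit ((Matrix.isUnit_iff_isUnit_det _).mpr hu)

lemma hess_posSemidef_of_isLocalMin (hf : Sm (n := n) f) (he : e ∈ atlas (Cn n) M)
    (hz : z ∈ e.target) (hmin : IsLocalMin f (e.symm z)) : (hess e f z).PosSemidef := by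
  refine IsHermitian.posSemidef_of_qform (hess_isHermitian hf he hz) fun ξ => ?_
  have hmin' : IsLocalMin (fun w => f (e.symm w)) z :=
    (e.continuousAt_symm hz).eventually hmin
  have h := complexHessian_nonneg ((hf.contDiffAt he hz).of_le (by norm_cast)) hmin' (star ξ)
  rw [qform]
  convert h using 2
  rw [dotProduct]
  refine Finset.sum_congr rfl fun k _ => ?_
  rw [mulVec, dotProduct, Finset.mul_sum]
  refine Finset.sum_congr rfl fun l _ => ?_
  rw [hess_apply]
  simp only [Pi.star_apply, Complex.star_def, Complex.conj_conj]
  rw [show inChart e f = fun w => ((f (e.symm w) : ℝ) : ℂ) from rfl]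
  ring

/-- If `det (g_{i j̄} + φ_{i j̄})` vanishes nowhere on a compact manifold, then `g_{i j̄} + φ_{i j̄}`
is positive definite. -/
theorem coeff_add_hess_posDef [CompactSpace M] (g : KahlerMetric n M) {φ : M → ℝ}
    (hφ : Sm (n := n) φ) (hdet : ∀ x, (g.matrixAt x + hessianAt (n := n) φ x).det ≠ 0)
    (he : e ∈ atlas (Cn n) M) (hz : z ∈ e.target) : (g.coeff e z + hess e φ z).PosDef := by
  set N : M → Matrix (Fin n) (Fin n) ℂ := fun x => g.matrixAt x + hessianAt (n := n) φ x with hN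
  have hNe : ∀ x, N x = g.coeff (chartAt (Cn n) x) (chartAt (Cn n) x x) +
      hess (chartAt (Cn n) x) φ (chartAt (Cn n) x x) := fun x => rfl
  have hherm : ∀ e ∈ atlas (Cn n) M, ∀ z ∈ e.target, (g.coeff e z + hess e φ z).IsHermitian :=
    fun e he z hz => (g.posDef e he z hz).1.add (hess_isHermitian hφ he hz)
  have hcont : ∀ x : M, ∀ i j, ContinuousAt (fun y => (g.coeff (chartAt (Cn n) x)
      (chartAt (Cn n) x y) + hess (chartAt (Cn n) x) φ (chartAt (Cn n) x y)) i j) x := by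
    intro x i j
    have hx := mem_chart_target (Cn n) x
    have h1 : ContinuousAt (fun w => (g.coeff (chartAt (Cn n) x) w +
        hess (chartAt (Cn n) x) φ w) i j) (chartAt (Cn n) x x) :=
      (coeff_contDiffAt (chart_mem_atlas _ x) hx i j).continuousAt.add
        ((hφ.hess_contDiffOn (chart_mem_atlas _ x) i j).continuousOn.continuousAt
          ((chartAt (Cn n) x).open_target.mem_nhds hx))
    exact ContinuousAt.comp (f := chartAt (Cn n) x) h1
      ((chartAt (Cn n) x).continuousAt (mem_chart_source _ x))
  -- Near x positivity may be tested in the fixed chart at x, where the coefficients are continuous.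
  have hiff : ∀ x y : M, y ∈ (chartAt (Cn n) x).source → ((N y).PosDef ↔
      (g.coeff (chartAt (Cn n) x) (chartAt (Cn n) x y) +
        hess (chartAt (Cn n) x) φ (chartAt (Cn n) x y)).PosDef) := by
    intro x y hy
    constructor
    · intro h
      refine posDef_transfer hφ (chart_mem_atlas _ x) (chart_mem_atlas _ y)
        ((chartAt (Cn n) x).map_source hy) ?_ ?_
      · rw [(chartAt (Cn n) x).left_inv hy]; exact mem_chart_source _ y
      · rw [(chartAt (Cn n) x).left_inv hy]; exact h
    · intro h
      refine posDef_transfer hφ (chart_mem_atlas _ y) (chart_mem_atlas _ x)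
        (mem_chart_target _ y) ?_ ?_
      · rw [(chartAt (Cn n) y).left_inv (mem_chart_source _ y)]; exact hy
      · rw [(chartAt (Cn n) y).left_inv (mem_chart_source _ y)]; exact h
  have hopen : IsOpen {x | (N x).PosDef} := by
    rw [isOpen_iff_eventually]
    intro x hx
    have hs := (chartAt (Cn n) x).open_source.mem_nhds (mem_chart_source _ x)
    have := eventually_posDef (hcont x) ((hiff x x (mem_chart_source _ x)).mp hx) (by
      filter_upwards [hs] with y hy
      exact hherm _ (chart_mem_atlas _ x) _ ((chartAt (Cn n) x).map_source hy))
    filter_upwards [this, hs] with y hy hys using (hiff x y hys).mpr hy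
  have hclosed : IsClosed {x | (N x).PosDef} := by
    refine isClosed_of_closure_subset fun x hx => ?_
    have hs := (chartAt (Cn n) x).open_source.mem_nhds (mem_chart_source _ x)
    rw [mem_closure_iff_frequently] at hx
    -- A limit of positive definite forms is semidefinite, and a nonzero determinant makes it
    -- definite.
    have hps : (N x).PosSemidef := by
      refine IsHermitian.posSemidef_of_qform
        (hherm _ (chart_mem_atlas _ x) _ (mem_chart_target _ x)) fun ξ => ?_
      have ht : ContinuousAt (fun y => qform (g.coeff (chartAt (Cn n) x)
          (chartAt (Cn n) x y) + hess (chartAt (Cn n) x) φ (chartAt (Cn n) x y)) ξ) x := by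
        refine Complex.continuous_re.continuousAt.comp ?_
        simp only [dotProduct, mulVec]
        exact tendsto_finsetSum _ fun i _ => continuousAt_const.mul
          (tendsto_finsetSum _ fun j _ => (hcont x i j).mul continuousAt_const)
      refine ge_of_tendsto_of_frequently ht ((hx.and_eventually hs).mono ?_)
      rintro y ⟨hy, hys⟩
      exact ((hiff x y hys).mp hy).posSemidef.re_dotProduct_nonneg ξ
    exact hps.posDef_iff_det_ne_zero.mpr (hdet x)
  have hall : ∀ x, (N x).PosDef := by
    by_contra! hne
    obtain ⟨x, hx⟩ := hne
    -- The bad set is open and compact, so a minimum of φ over it is a local minimum on M. Choosing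
    -- the minimum over this set makes connectedness of M unnecessary.
    obtain ⟨x₀, hx₀, hmin⟩ := (hopen.isClosed_compl.isCompact).exists_isMinOn ⟨x, hx⟩
      hφ.continuous.continuousOn
    have hloc : IsLocalMin φ x₀ := hmin.isLocalMin (hclosed.isOpen_compl.mem_nhds hx₀)
    refine hx₀ ?_
    have h1 := hess_posSemidef_of_isLocalMin hφ (chart_mem_atlas (Cn n) x₀)
      (mem_chart_target (Cn n) x₀)
      (by rwa [(chartAt (Cn n) x₀).left_inv (mem_chart_source _ x₀)])
    exact (g.posDef _ (chart_mem_atlas (Cn n) x₀) _ (mem_chart_target (Cn n) x₀)).add_posSemidef h1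
  exact posDef_transfer hφ he (chart_mem_atlas _ (e.symm z)) hz (mem_chart_source _ _)
    (hall (e.symm z))

end Positivity

/-! ### Integrals of compactly supported functions in a chart -/

section ChartIntegrals

variable {n : ℕ} {T K : Set (Cn n)} {c : ℂ} {i : Fin n}

lemma contDiff_indicator {F : Type*} [NormedAddCommGroup F] [NormedSpace ℝ F] {X : Cn n → F}
    {r : WithTop ℕ∞} (hT : IsOpen T)
    (hK : IsCompact K) (hKT : K ⊆ T) (hX : ContDiffOn ℝ r X T) (h0 : ∀ z ∈ T, z ∉ K → X z = 0) :
    ContDiff ℝ r (T.indicator X) := by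
  rw [contDiff_iff_contDiffAt]
  intro z
  by_cases hz : z ∈ K
  · refine (hX.contDiffAt (hT.mem_nhds (hKT hz))).congr_of_eventuallyEq ?_
    filter_upwards [hT.mem_nhds (hKT hz)] with w hw using Set.indicator_of_mem hw _
  · refine (contDiffAt_const (c := (0 : F))).congr_of_eventuallyEq ?_
    filter_upwards [hK.isClosed.isOpen_compl.mem_nhds hz] with w hw
    by_cases hwT : w ∈ T
    · rw [Set.indicator_of_mem hwT, h0 w hwT hw]
    · rw [Set.indicator_of_notMem hwT]

lemma hasCompactSupport_indicator {F : Type*} [Zero F] {X : Cn n → F}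
    (hK : IsCompact K) (h0 : ∀ z ∈ T, z ∉ K → X z = 0) : HasCompactSupport (T.indicator X) :=
  HasCompactSupport.intro hK fun z hz => by
    by_cases hzT : z ∈ T
    · rw [Set.indicator_of_mem hzT, h0 z hzT hz]
    · rw [Set.indicator_of_notMem hzT]

lemma integrableOn_of_vanishing {F : Type*} [NormedAddCommGroup F]
    {X : Cn n → F} (hT : IsOpen T) (hK : IsCompact K) (hKT : K ⊆ T)
    (hX : ContinuousOn X T) (h0 : ∀ z ∈ T, z ∉ K → X z = 0) : IntegrableOn X T := by
  have h1 : IntegrableOn X K := (hX.mono hKT).integrableOn_compact hK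
  exact h1.of_forall_sdiff_eq_zero hT.measurableSet fun z hz => h0 z hz.1 hz.2

/-- Integration by parts against the constant function 1. -/
lemma integral_fderiv_eq_zero {X : Cn n → ℂ} (hX : ContDiff ℝ 1 X) (hc : HasCompactSupport X)
    (v : Cn n) : ∫ z, fderiv ℝ X z v = 0 := by
  have hXd : Differentiable ℝ X := hX.differentiable (by simp)
  have h1 : Integrable (fun z => fderiv ℝ X z v) :=
    ((hX.continuous_fderiv (by simp)).clm_apply continuous_const).integrable_of_hasCompactSupport
      (hc.fderiv_apply ℝ v)
  have h2 : Integrable X := hX.continuous.integrable_of_hasCompactSupport hc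
  have := integral_smul_fderiv_eq_neg_fderiv_smul_of_integrable (μ := volume)
    (f := fun _ : Cn n => (1 : ℝ)) (g := X) (v := v) (𝕜 := ℝ) (by simp) (by simpa using h1)
    (by simpa using h2) (fun _ _ => differentiableAt_const _) (fun x _ => hXd x)
  simpa using this

lemma integral_cderiv_eq_zero {X : Cn n → ℂ} (hT : IsOpen T) (hK : IsCompact K) (hKT : K ⊆ T)
    (hX : ContDiffOn ℝ 1 X T) (h0 : ∀ z ∈ T, z ∉ K → X z = 0) :
    ∫ z in T, cderiv c i X z = 0 := by
  set Y := T.indicator X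
  have hY : ContDiff ℝ 1 Y := contDiff_indicator hT hK hKT hX h0
  have hYc : HasCompactSupport Y := hasCompactSupport_indicator hK h0
  have h1 : ∫ z in T, cderiv c i X z = ∫ z in T, cderiv c i Y z := by
    refine setIntegral_congr_fun hT.measurableSet fun z hz => cderiv_congr ?_
    filter_upwards [hT.mem_nhds hz] with w hw
    exact (Set.indicator_of_mem hw _).symm
  have h2 : ∫ z in T, cderiv c i Y z = ∫ z, cderiv c i Y z := by
    refine setIntegral_eq_integral_of_forall_compl_eq_zero fun z hz => ?_
    have : Y =ᶠ[nhds z] fun _ => 0 := by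
      filter_upwards [hK.isClosed.isOpen_compl.mem_nhds fun h => hz (hKT h)] with w hw
      by_cases hwT : w ∈ T
      · exact (Set.indicator_of_mem hwT _).trans (h0 w hwT hw)
      · exact Set.indicator_of_notMem hwT _
    rw [cderiv_congr this, cderiv_const]
  have hi : ∀ v : Cn n, Integrable (fun z => fderiv ℝ Y z v) := fun v =>
    ((hY.continuous_fderiv (by simp)).clm_apply continuous_const).integrable_of_hasCompactSupport
      (hYc.fderiv_apply ℝ v)
  rw [h1, h2]
  simp only [cderiv]
  rw [integral_div, integral_add (hi _) ((hi _).const_mul c), integral_const_mul,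
    integral_fderiv_eq_zero hY hYc, integral_fderiv_eq_zero hY hYc]
  simp

end ChartIntegrals

/-! ### Partition of unity and the volume measure -/

section Cover

open Matrix

variable {n : ℕ} {M : Type*} [TopologicalSpace M] [ChartedSpace (Cn n) M]

/-- A finite family of charts with a subordinate smooth partition of unity. -/
structure Cover (n : ℕ) (M : Type*) [TopologicalSpace M] [ChartedSpace (Cn n) M] (ι : Type*)
    [Fintype ι] where
  /-- The charts. -/
  e : ι → OpenPartialHomeomorph M (Cn n)
  mem : ∀ a, e a ∈ atlas (Cn n) M
  /-- The partition of unity. -/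
  η : ι → M → ℝ
  smooth : ∀ a, Sm (n := n) (η a)
  nonneg : ∀ a x, 0 ≤ η a x
  tsupport_subset : ∀ a, tsupport (η a) ⊆ (e a).source
  sum_eq_one : ∀ x, ∑ a, η a x = 1

lemma exists_cover [T2Space M] [CompactSpace M] [IsManifold 𝓘(ℂ, Cn n) ω M] :
    ∃ t : Finset M, Nonempty (Cover n M t) := by
  have : IsManifold 𝓘(ℝ, Cn n) ∞ M := isManifold_real
  obtain ⟨t, ht⟩ := isCompact_univ.elim_nhds_subcover (fun x : M => (chartAt (Cn n) x).source)
    fun x _ => (chartAt (Cn n) x).open_source.mem_nhds (mem_chart_source _ x)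
  obtain ⟨p, hp⟩ := SmoothPartitionOfUnity.exists_isSubordinate 𝓘(ℝ, Cn n) (s := Set.univ)
    isClosed_univ (fun x : t => (chartAt (Cn n) (x : M)).source)
    (fun x => (chartAt (Cn n) (x : M)).open_source) (fun x hx => by
      obtain ⟨y, hy, hxy⟩ := Set.mem_iUnion₂.mp (ht.2 hx)
      exact Set.mem_iUnion.mpr ⟨⟨y, hy⟩, hxy⟩)
  refine ⟨t, ⟨⟨fun x => chartAt (Cn n) (x : M), fun x => chart_mem_atlas _ _, fun a => p a,
    fun a => sm_of_contMDiff (p a).contMDiff, fun a x => p.nonneg a x, hp, fun x => ?_⟩⟩⟩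
  rw [← finsum_eq_sum_of_fintype]
  exact p.sum_eq_one (Set.mem_univ x)

/-- The compact image in a chart of a compact subset of its domain. -/
lemma isCompact_chart_image {e : OpenPartialHomeomorph M (Cn n)} {S : Set M} (hS : IsCompact S)
    (hSe : S ⊆ e.source) : IsCompact (e '' S) ∧ e '' S ⊆ e.target :=
  ⟨hS.image_of_continuousOn (e.continuousOn.mono hSe), by
    rintro _ ⟨x, hx, rfl⟩; exact e.map_source (hSe hx)⟩

lemma vanishing_chart {F : Type*} [Zero F] {e : OpenPartialHomeomorph M (Cn n)} {S : Set M}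
    {G : M → F} (hG : ∀ x, x ∉ S → G x = 0) {z : Cn n} (hz : z ∈ e.target) (hzK : z ∉ e '' S) :
    G (e.symm z) = 0 := by
  refine hG _ fun h => hzK ⟨e.symm z, h, e.right_inv hz⟩

lemma Cover.isCompact_tsupport [CompactSpace M] {ι : Type*} [Fintype ι] (cv : Cover n M ι) (a : ι) :
    IsCompact (tsupport (cv.η a)) :=
  (isClosed_tsupport _).isCompact

lemma Cover.eq_zero_of_notMem {ι : Type*} [Fintype ι] (cv : Cover n M ι) (a : ι) {x : M}
    (hx : x ∉ tsupport (cv.η a)) :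
    cv.η a x = 0 := image_eq_zero_of_notMem_tsupport hx

lemma integrableOn_chart {e : OpenPartialHomeomorph M (Cn n)} {S : Set M} (hS : IsCompact S)
    (hSe : S ⊆ e.source) {X : Cn n → ℝ}
    (hX : ContinuousOn X e.target) (h0 : ∀ z ∈ e.target, e.symm z ∉ S → X z = 0) :
    IntegrableOn X e.target :=
  integrableOn_of_vanishing e.open_target (isCompact_chart_image hS hSe).1
    (isCompact_chart_image hS hSe).2 hX fun z hz hzK =>
      h0 z hz fun h => hzK ⟨e.symm z, h, e.right_inv hz⟩

/-- The real determinant of a complex linear map is the norm of its complex determinant. The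
Lebesgue density thus changes by the same factor as det g. -/
lemma det_restrictScalars_eq (L : Cn n →L[ℂ] Cn n) :
    (L.restrictScalars ℝ).det = ‖(of fun i k => L (Pi.single i 1) k : Matrix _ _ ℂ).det‖ ^ 2 := by
  have h1 : (L.restrictScalars ℝ).det = Algebra.norm ℝ (LinearMap.det (L : Cn n →ₗ[ℂ] Cn n)) := by
    rw [← LinearMap.det_restrictScalars]; rfl
  have h2 : LinearMap.det (L : Cn n →ₗ[ℂ] Cn n) =
      (of fun i k => L (Pi.single i 1) k : Matrix _ _ ℂ).det := by
    rw [← LinearMap.det_toMatrix', ← det_transpose]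
    congr 1
  rw [h1, h2, Algebra.norm_complex_apply, Complex.normSq_eq_norm_sq]

variable [IsManifold 𝓘(ℂ, Cn n) ω M] {g : KahlerMetric n M} {e e' : OpenPartialHomeomorph M (Cn n)}

lemma det_re_pos (he : e ∈ atlas (Cn n) M) {z : Cn n} (hz : z ∈ e.target) :
    0 < (g.coeff e z).det.re :=
  (Complex.lt_def.mp (g.posDef e he z hz).det_pos).1

lemma det_coe (he : e ∈ atlas (Cn n) M) {z : Cn n} (hz : z ∈ e.target) :
    (((g.coeff e z).det.re : ℝ) : ℂ) = (g.coeff e z).det := by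
  have := (Complex.lt_def.mp (g.posDef e he z hz).det_pos).2
  exact Complex.ext rfl (by simpa using this)

lemma det_re_continuousOn (he : e ∈ atlas (Cn n) M) :
    ContinuousOn (fun z => (g.coeff e z).det.re) e.target := fun _ hz =>
  (Complex.continuous_re.continuousAt.comp
    (contDiffAt_det (coeff_contDiffAt (g := g) he hz)).continuousAt).continuousWithinAt

lemma det_transform (he : e ∈ atlas (Cn n) M) (he' : e' ∈ atlas (Cn n) M) {z : Cn n}
    (hz : z ∈ e.target) (hz' : e.symm z ∈ e'.source) :
    (g.coeff e z).det.re = ‖(jac e e' z).det‖ ^ 2 * (g.coeff e' (e' (e.symm z))).det.re := by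
  have h : (g.coeff e z).det =
      ((‖(jac e e' z).det‖ ^ 2 : ℝ) : ℂ) * (g.coeff e' (e' (e.symm z))).det := by
    rw [coeff_transform he he' hz hz', det_mul, det_mul, det_conjTranspose,
      ← Complex.normSq_eq_norm_sq, ← Complex.mul_conj, Complex.star_def]
    ring
  rw [h, Complex.re_ofReal_mul]

/-- The local volume measures of two charts agree on the overlap. -/
lemma integral_chart_eq (he : e ∈ atlas (Cn n) M) (he' : e' ∈ atlas (Cn n) M) {G : M → ℝ}
    (hG : ∀ x, G x ≠ 0 → x ∈ e.source ∧ x ∈ e'.source) :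
    ∫ z in e.target, (g.coeff e z).det.re * G (e.symm z) =
      ∫ z in e'.target, (g.coeff e' z).det.re * G (e'.symm z) := by
  set s := (e.symm ≫ₕ e').source with hs
  have hs' : ∀ z, z ∈ s ↔ z ∈ e.target ∧ e.symm z ∈ e'.source := fun z => by
    simp [hs]
  have hsm : MeasurableSet s := (e.symm ≫ₕ e').open_source.measurableSet
  have himg : (e' ∘ e.symm) '' s = (e.symm ≫ₕ e').target :=
    (e.symm ≫ₕ e').image_source_eq_target
  have ht' : ∀ z, z ∈ (e.symm ≫ₕ e').target ↔ z ∈ e'.target ∧ e'.symm z ∈ e.source := fun z => by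
    simp
  have h1 : ∫ z in e.target, (g.coeff e z).det.re * G (e.symm z) =
      ∫ z in s, (g.coeff e z).det.re * G (e.symm z) := by
    refine (setIntegral_eq_of_subset_of_forall_sdiff_eq_zero e.open_target.measurableSet
      (fun z hz => ((hs' z).mp hz).1) fun z hz => ?_)
    by_contra hne
    exact hz.2 ((hs' z).mpr ⟨hz.1, (hG _ (right_ne_zero_of_mul hne)).2⟩)
  have h2 : ∫ z in e'.target, (g.coeff e' z).det.re * G (e'.symm z) =
      ∫ z in (e' ∘ e.symm) '' s, (g.coeff e' z).det.re * G (e'.symm z) := by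
    rw [himg]
    refine (setIntegral_eq_of_subset_of_forall_sdiff_eq_zero e'.open_target.measurableSet
      (fun z hz => ((ht' z).mp hz).1) fun z hz => ?_)
    by_contra hne
    exact hz.2 ((ht' z).mpr ⟨hz.1, (hG _ (right_ne_zero_of_mul hne)).1⟩)
  rw [h1, h2, integral_image_eq_integral_abs_det_fderiv_smul volume hsm
    (f' := fun z => (fderiv ℂ (e' ∘ e.symm) z).restrictScalars ℝ)
    (fun z hz => ((hasFDerivAt_transition he he' ((hs' z).mp hz).1
      ((hs' z).mp hz).2).restrictScalars ℝ).hasFDerivWithinAt) (e.symm ≫ₕ e').injOn]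
  refine setIntegral_congr_fun hsm fun z hz => ?_
  obtain ⟨hz1, hz2⟩ := (hs' z).mp hz
  simp only [smul_eq_mul, Function.comp_apply, e'.left_inv hz2]
  rw [det_transform he he' hz1 hz2, det_restrictScalars_eq, abs_of_nonneg (sq_nonneg _), mul_assoc]
  rfl

variable [MeasurableSpace M] [BorelSpace M] {ι : Type*} [Fintype ι] (g) (cv : Cover n M ι)

/-- One summand of the volume measure, cut off by a function of the partition of unity. -/
def cutVol (a : ι) : Measure M :=
  Measure.map (cv.e a).symm ((volume.restrict (cv.e a).target).withDensity fun z =>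
    ENNReal.ofReal ((g.coeff (cv.e a) z).det.re * cv.η a ((cv.e a).symm z)))

/-- The volume measure `det (g_{i j̄}) dx¹ dy¹ ⋯ dxⁿ dyⁿ` on `M`. -/
def vol : Measure M := ∑ a, cutVol g cv a

variable {g cv}

lemma aemeasurable_chart_symm (e : OpenPartialHomeomorph M (Cn n)) :
    AEMeasurable e.symm (volume.restrict e.target) :=
  e.continuousOn_symm.aemeasurable e.open_target.measurableSet

lemma cutVol_density_aemeasurable (a : ι) :
    AEMeasurable (fun z => (g.coeff (cv.e a) z).det.re * cv.η a ((cv.e a).symm z))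
      (volume.restrict (cv.e a).target) :=
  ((det_re_continuousOn (cv.mem a)).mul
    ((cv.smooth a) _ (cv.mem a)).continuousOn).aemeasurable (cv.e a).open_target.measurableSet

lemma aemeasurable_symm_withDensity (a : ι) (d : Cn n → ENNReal) :
    AEMeasurable (cv.e a).symm ((volume.restrict (cv.e a).target).withDensity d) :=
  (aemeasurable_chart_symm _).mono_ac (withDensity_absolutelyContinuous _ _)

lemma integral_cutVol (a : ι) {G : M → ℝ} (hG : Continuous G) :
    ∫ x, G x ∂(cutVol g cv a) = ∫ z in (cv.e a).target,
      (g.coeff (cv.e a) z).det.re * (cv.η a ((cv.e a).symm z) * G ((cv.e a).symm z)) := by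
  rw [cutVol, integral_map (aemeasurable_symm_withDensity a _) hG.aestronglyMeasurable,
    integral_withDensity_eq_integral_toReal_smul₀
      (cutVol_density_aemeasurable a).ennreal_ofReal (by simp)]
  refine setIntegral_congr_fun (cv.e a).open_target.measurableSet fun z hz => ?_
  simp only [smul_eq_mul]
  rw [ENNReal.toReal_ofReal (mul_nonneg (det_re_pos (cv.mem a) hz).le (cv.nonneg a _)), mul_assoc]

variable [CompactSpace M]

instance (a : ι) : IsFiniteMeasure (cutVol g cv a) := by
  have : IsFiniteMeasure ((volume.restrict (cv.e a).target).withDensity fun z =>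
      ENNReal.ofReal ((g.coeff (cv.e a) z).det.re * cv.η a ((cv.e a).symm z))) := by
    refine isFiniteMeasure_withDensity_ofReal ?_
    refine (integrableOn_chart (cv.isCompact_tsupport a) (cv.tsupport_subset a)
      ((det_re_continuousOn (cv.mem a)).mul ((cv.smooth a) _ (cv.mem a)).continuousOn) ?_).2
    intro z _ h
    simp only [Pi.mul_apply, cv.eq_zero_of_notMem a h, mul_zero]
  unfold cutVol
  infer_instance

instance : IsFiniteMeasure (vol g cv) := by
  unfold vol; infer_instance

lemma integrable_vol {G : M → ℝ} (hG : Continuous G) {μ : Measure M} [IsFiniteMeasure μ] :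
    Integrable G μ :=
  hG.integrable_of_hasCompactSupport (HasCompactSupport.of_compactSpace G)

lemma integral_vol {G : M → ℝ} (hG : Continuous G) :
    ∫ x, G x ∂(vol g cv) = ∑ a, ∫ z in (cv.e a).target,
      (g.coeff (cv.e a) z).det.re * (cv.η a ((cv.e a).symm z) * G ((cv.e a).symm z)) := by
  rw [vol, integral_finsetSum_measure fun a _ => integrable_vol hG]
  exact Finset.sum_congr rfl fun a _ => integral_cutVol a hG

/-- The integral of a function supported in the domain of a chart. -/
lemma integral_vol_chart (he : e ∈ atlas (Cn n) M) {G : M → ℝ} (hG : Continuous G) {S : Set M}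
    (hS : IsCompact S) (hSe : S ⊆ e.source) (h0 : ∀ x, x ∉ S → G x = 0) :
    ∫ x, G x ∂(vol g cv) = ∫ z in e.target, (g.coeff e z).det.re * G (e.symm z) := by
  rw [integral_vol hG]
  -- Each summand is supported in the overlap with `e` and can be moved there; in the single chart
  -- `e` the functions η add up to 1.
  have h1 : ∀ a, ∫ z in (cv.e a).target,
      (g.coeff (cv.e a) z).det.re * (cv.η a ((cv.e a).symm z) * G ((cv.e a).symm z)) =
      ∫ z in e.target, (g.coeff e z).det.re * (cv.η a (e.symm z) * G (e.symm z)) := fun a => by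
    refine integral_chart_eq (G := fun x => cv.η a x * G x) (cv.mem a) he fun x hx => ⟨?_, ?_⟩
    · refine cv.tsupport_subset a (subset_tsupport _ (left_ne_zero_of_mul hx))
    · by_contra hxe
      exact hx (by rw [h0 x fun h => hxe (hSe h), mul_zero])
  have hGc : ContinuousOn (fun z => G (e.symm z)) e.target :=
    hG.comp_continuousOn e.continuousOn_symm
  simp_rw [h1]
  rw [← integral_finsetSum]
  · refine setIntegral_congr_fun e.open_target.measurableSet fun z _ => ?_
    rw [← Finset.mul_sum, ← Finset.sum_mul, cv.sum_eq_one, one_mul]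
  · intro a _
    refine integrableOn_chart hS hSe ((det_re_continuousOn he).mul
      (((cv.smooth a) _ he).continuousOn.mul hGc)) fun z _ h => ?_
    rw [h0 _ h, mul_zero, mul_zero]

end Cover

/-! ### Integration by parts for the flat operators ∂_i ∂_ī -/

section FlatParts

variable {n : ℕ} {T K : Set (Cn n)} {i : Fin n}

lemma cderiv_eq_zero_of_vanishing {c : ℂ} {X : Cn n → ℂ} (hT : IsOpen T) (hK : IsCompact K)
    (h0 : ∀ z ∈ T, z ∉ K → X z = 0) {z : Cn n} (hz : z ∈ T) (hzK : z ∉ K) :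
    cderiv c i X z = 0 := by
  have : X =ᶠ[nhds z] fun _ => 0 := by
    filter_upwards [hT.mem_nhds hz, hK.isClosed.isOpen_compl.mem_nhds hzK] with w hw hw'
    exact h0 w hw hw'
  rw [cderiv_congr this, cderiv_const]

lemma contDiffOn_ofReal {u : Cn n → ℝ} {r : WithTop ℕ∞} (hu : ContDiffOn ℝ r u T) :
    ContDiffOn ℝ r (fun z => (u z : ℂ)) T :=
  Complex.ofRealCLM.contDiff.comp_contDiffOn hu

/-- Integration by parts for the flat operator `∂²/∂zⁱ∂z̄ⁱ`. -/
lemma integral_mul_flat {Q u : Cn n → ℝ} (hT : IsOpen T) (hK : IsCompact K) (hKT : K ⊆ T)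
    (hQ : ContDiffOn ℝ ∞ Q T) (hu : ContDiffOn ℝ ∞ u T)
    (h0 : (∀ z ∈ T, z ∉ K → Q z = 0) ∨ (∀ z ∈ T, z ∉ K → u z = 0)) :
    ∫ z in T, Q z * (cderiv (-Complex.I) i (cderiv Complex.I i fun w => (u w : ℂ)) z).re =
      -∫ z in T, (cderiv (-Complex.I) i (fun w => (Q w : ℂ)) z *
        cderiv Complex.I i (fun w => (u w : ℂ)) z).re := by
  have hQ' := contDiffOn_ofReal hQ
  have hu' := contDiffOn_ofReal hu
  have hu1 := contDiffOn_cderiv (c := Complex.I) (i := i) hT hu'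
  have hu2 := contDiffOn_cderiv (c := -Complex.I) (i := i) hT hu1
  have hQ1 := contDiffOn_cderiv (c := -Complex.I) (i := i) hT hQ'
  have hv : ∀ z ∈ T, z ∉ K →
      ((Q z : ℂ) = 0 ∧ cderiv (-Complex.I) i (fun w => (Q w : ℂ)) z = 0) ∨
      (cderiv Complex.I i (fun w => (u w : ℂ)) z = 0 ∧
        cderiv (-Complex.I) i (cderiv Complex.I i fun w => (u w : ℂ)) z = 0) := by
    intro z hz hzK
    rcases h0 with h0 | h0
    · left
      have h0' : ∀ z ∈ T, z ∉ K → (Q z : ℂ) = 0 := fun z hz hzK => by rw [h0 z hz hzK]; rfl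
      exact ⟨h0' z hz hzK, cderiv_eq_zero_of_vanishing hT hK h0' hz hzK⟩
    · right
      have h0' : ∀ z ∈ T, z ∉ K → (u z : ℂ) = 0 := fun z hz hzK => by rw [h0 z hz hzK]; rfl
      have h1 : ∀ z ∈ T, z ∉ K → cderiv Complex.I i (fun w => (u w : ℂ)) z = 0 :=
        fun z hz hzK => cderiv_eq_zero_of_vanishing hT hK h0' hz hzK
      exact ⟨h1 z hz hzK, cderiv_eq_zero_of_vanishing hT hK h1 hz hzK⟩
  have hI := integral_cderiv_eq_zero (c := -Complex.I) (i := i) hT hK hKT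
    ((hQ'.mul hu1).of_le (by norm_cast)) fun z hz hzK => by
      rcases hv z hz hzK with h | h
      · simp only [h.1, zero_mul]
      · simp only [h.1, mul_zero]
  have hpt : ∀ z ∈ T, cderiv (-Complex.I) i (fun x => (Q x : ℂ) *
      cderiv Complex.I i (fun w => (u w : ℂ)) x) z =
      cderiv (-Complex.I) i (fun w => (Q w : ℂ)) z * cderiv Complex.I i (fun w => (u w : ℂ)) z +
      Q z * cderiv (-Complex.I) i (cderiv Complex.I i fun w => (u w : ℂ)) z := fun z hz =>
    cderiv_mul ((hQ'.contDiffAt (hT.mem_nhds hz)).differentiableAt (by simp))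
      ((hu1.contDiffAt (hT.mem_nhds hz)).differentiableAt (by simp))
  have hi1 : IntegrableOn (fun z => cderiv (-Complex.I) i (fun w => (Q w : ℂ)) z *
      cderiv Complex.I i (fun w => (u w : ℂ)) z) T :=
    integrableOn_of_vanishing hT hK hKT (hQ1.continuousOn.mul hu1.continuousOn)
      fun z hz hzK => by
        rcases hv z hz hzK with h | h
        · rw [h.2, zero_mul]
        · rw [h.1, mul_zero]
  have hi2 : IntegrableOn (fun z => (Q z : ℂ) *
      cderiv (-Complex.I) i (cderiv Complex.I i fun w => (u w : ℂ)) z) T :=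
    integrableOn_of_vanishing hT hK hKT (hQ'.continuousOn.mul hu2.continuousOn)
      fun z hz hzK => by
        rcases hv z hz hzK with h | h
        · rw [h.1, zero_mul]
        · rw [h.2, mul_zero]
  rw [setIntegral_congr_fun hT.measurableSet hpt, integral_add hi1 hi2] at hI
  have hre := congrArg Complex.re hI
  have e1 := integral_re hi1
  have e2 := integral_re hi2
  simp only [RCLike.re_eq_complex_re, Complex.re_ofReal_mul] at e1 e2
  rw [Complex.add_re, ← e1, ← e2, Complex.zero_re] at hre
  linarith

/-- Moving both derivatives of `∂²/∂zⁱ∂z̄ⁱ` onto a compactly supported function. -/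
lemma integral_mul_flat_symm {Q u : Cn n → ℝ} (hT : IsOpen T) (hK : IsCompact K) (hKT : K ⊆ T)
    (hQ : ContDiffOn ℝ ∞ Q T) (hu : ContDiffOn ℝ ∞ u T) (h0 : ∀ z ∈ T, z ∉ K → Q z = 0) :
    ∫ z in T, Q z * (cderiv (-Complex.I) i (cderiv Complex.I i fun w => (u w : ℂ)) z).re =
      ∫ z in T, u z * (cderiv (-Complex.I) i (cderiv Complex.I i fun w => (Q w : ℂ)) z).re := by
  rw [integral_mul_flat hT hK hKT hQ hu (Or.inl h0), integral_mul_flat hT hK hKT hu hQ (Or.inr h0)]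
  congr 2
  funext z
  rw [cderiv_ofReal_conj (-Complex.I) i Q, cderiv_ofReal_conj Complex.I i u, ← map_mul,
    Complex.conj_re]
  simp [mul_comm]

end FlatParts

/-! ### Green's formula -/

section GreenFormula

open Matrix

variable {n : ℕ} {M : Type*} [TopologicalSpace M] [ChartedSpace (Cn n) M]
  {e : OpenPartialHomeomorph M (Cn n)} {z : Cn n} {f ψ : M → ℝ} {g : KahlerMetric n M}

lemma closed_eq (he : e ∈ atlas (Cn n) M) (hz : z ∈ e.target) (i k l : Fin n) :
    cderiv (-Complex.I) i (fun w => g.coeff e w k l) z =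
      cderiv (-Complex.I) k (fun w => g.coeff e w i l) z := by
  have h := g.closed e he z hz k l i
  rwa [wirtinger_eq, wirtinger_eq] at h

/-- The rows of `det (g) g^{-1}` are divergence free for a Kähler metric. -/
lemma sum_cderiv_det_mul_inv (he : e ∈ atlas (Cn n) M) (hz : z ∈ e.target) (j : Fin n) :
    ∑ i, cderiv (-Complex.I) i (fun w => (g.coeff e w).det * (g.coeff e w)⁻¹ j i) z = 0 := by
  have hA : ∀ k l, ContDiffAt ℝ 1 (fun w => g.coeff e w k l) z := fun k l =>
    (coeff_contDiffAt he hz k l).of_le (by norm_cast)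
  have hAd : ∀ k l, DifferentiableAt ℝ (fun w => g.coeff e w k l) z := fun k l =>
    (hA k l).differentiableAt (by simp)
  have h0 := (isUnit_det (g := g) he hz).ne_zero
  set B : Fin n → Matrix (Fin n) (Fin n) ℂ := fun i =>
    of fun k l => cderiv (-Complex.I) i (fun w => g.coeff e w k l) z with hB
  have hdet := fun i : Fin n => cderiv_det (c := -Complex.I) (i := i) hAd h0
  have hinv : ∀ i l, cderiv (-Complex.I) i (fun w => (g.coeff e w)⁻¹ j l) z =
      -((g.coeff e z)⁻¹ * B i * (g.coeff e z)⁻¹) j l := fun i l => by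
    have := congrFun (congrFun (cderiv_inv (c := -Complex.I) (i := i) hA h0) j) l
    simpa using this
  have hterm : ∀ i, cderiv (-Complex.I) i
      (fun w => (g.coeff e w).det * (g.coeff e w)⁻¹ j i) z =
      (g.coeff e z).det * (((g.coeff e z)⁻¹ * B i).trace * (g.coeff e z)⁻¹ j i -
        ((g.coeff e z)⁻¹ * B i * (g.coeff e z)⁻¹) j i) := fun i => by
    rw [cderiv_mul ((contDiffAt_det hA).differentiableAt (by simp))
      ((contDiffAt_inv hA h0 j i).differentiableAt (by simp)), hdet, hinv]
    ring
  simp_rw [hterm]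
  rw [← Finset.mul_sum, Finset.sum_sub_distrib, mul_eq_zero]
  right
  rw [sub_eq_zero]
  simp only [trace, diag_apply, mul_apply, Finset.sum_mul]
  -- Jacobi's formula and the derivative of the inverse leave two triple sums; closedness exchanges
  -- the differentiation index with the row index, which identifies them.
  have hsym : ∀ i k l, B i k l = B k i l := fun i k l => closed_eq he hz i k l
  calc ∑ i, ∑ k, ∑ l, (g.coeff e z)⁻¹ k l * B i l k * (g.coeff e z)⁻¹ j i
      = ∑ i, ∑ k, ∑ l, (g.coeff e z)⁻¹ j i * B l i k * (g.coeff e z)⁻¹ k l := by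
        refine Finset.sum_congr rfl fun i _ => Finset.sum_congr rfl fun k _ =>
          Finset.sum_congr rfl fun l _ => ?_
        rw [hsym l i k]; ring
    _ = ∑ l, ∑ k, ∑ i, (g.coeff e z)⁻¹ j i * B l i k * (g.coeff e z)⁻¹ k l := by
        rw [Finset.sum_comm]
        rw [Finset.sum_congr rfl fun k _ => Finset.sum_comm]
        rw [Finset.sum_comm]

lemma pairE_comm (he : e ∈ atlas (Cn n) M) (hz : z ∈ e.target) (f ψ : M → ℝ) :
    pairE g e f ψ z = pairE g e ψ f z := by
  have hH : ((g.coeff e z)⁻¹)ᴴ = (g.coeff e z)⁻¹ := (g.posDef e he z hz).1.inv.eq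
  rw [pairE, pairE, ← Complex.conj_re, starRingEnd_apply, ← star_dotProduct, star_mulVec, hH,
    ← dotProduct_mulVec]

lemma grad_add {f ψ : M → ℝ} (hf : DifferentiableAt ℝ (inChart e f) z)
    (hψ : DifferentiableAt ℝ (inChart e ψ) z) :
    grad e (fun x => f x + ψ x) z = grad e f z + grad e ψ z := by
  funext i
  rw [Pi.add_apply, grad, grad, grad, ← cderiv_add hf hψ]
  congr 1
  funext w; simp [inChart]

lemma grad_mul {f ψ : M → ℝ} (hf : DifferentiableAt ℝ (inChart e f) z)
    (hψ : DifferentiableAt ℝ (inChart e ψ) z) :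
    grad e (fun x => f x * ψ x) z =
      (ψ (e.symm z) : ℂ) • grad e f z + (f (e.symm z) : ℂ) • grad e ψ z := by
  funext i
  rw [Pi.add_apply, Pi.smul_apply, Pi.smul_apply, smul_eq_mul, smul_eq_mul, grad, grad, grad,
    show inChart e (fun x => f x * ψ x) = fun w => inChart e f w * inChart e ψ w by
      funext w; simp [inChart], cderiv_mul hf hψ]
  simp only [inChart]
  ring

lemma grad_comp {f : M → ℝ} {θ : ℝ → ℝ} {θ' : ℝ}
    (hf : DifferentiableAt ℝ (fun w => f (e.symm w)) z)
    (hθ : HasDerivAt θ θ' (f (e.symm z))) :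
    grad e (fun x => θ (f x)) z = (θ' : ℂ) • grad e f z := by
  funext i
  exact cderiv_comp_real hf hθ

lemma grad_sum {ι : Type*} (t : Finset ι) {ψ : ι → M → ℝ}
    (hψ : ∀ a ∈ t, DifferentiableAt ℝ (inChart e (ψ a)) z) :
    grad e (fun x => ∑ a ∈ t, ψ a x) z = ∑ a ∈ t, grad e (ψ a) z := by
  funext i
  rw [Finset.sum_apply, grad]
  simp only [grad]
  rw [← cderiv_sum t hψ]
  congr 1
  funext w; simp [inChart]

lemma pairE_smul_right {a : ℝ} {ψ' : M → ℝ} (h : grad e ψ z = (a : ℂ) • grad e ψ' z) :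
    pairE g e f ψ z = a * pairE g e f ψ' z := by
  rw [pairE, pairE, h, star_smul, smul_dotProduct, smul_eq_mul, Complex.star_def,
    Complex.conj_ofReal, Complex.re_ofReal_mul]

lemma grad_eq_zero {S : Set M} (hS : IsClosed S) (h0 : ∀ x, x ∉ S → f x = 0)
    (hz : z ∈ e.target) (hzS : e.symm z ∉ S) : grad e f z = 0 := by
  have : inChart e f =ᶠ[nhds z] fun _ => 0 := by
    filter_upwards [(e.continuousAt_symm hz).eventually (hS.isOpen_compl.mem_nhds hzS)] with w hw
    simp [inChart, h0 _ hw]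
  funext i
  rw [grad, cderiv_congr this, cderiv_const]; rfl

lemma lapE_eq_sum (e : OpenPartialHomeomorph M (Cn n)) (f : M → ℝ) (z : Cn n) :
    lapE g e f z = (∑ i, ∑ j, (g.coeff e z)⁻¹ j i *
      cderiv (-Complex.I) i (cderiv Complex.I j (inChart e f)) z).re := by
  rw [lapE, trace, Finset.sum_comm]
  congr 1
  refine Finset.sum_congr rfl fun j _ => ?_
  rw [diag_apply, mul_apply]
  exact Finset.sum_congr rfl fun i _ => by rw [hess_apply]

variable [IsManifold 𝓘(ℂ, Cn n) ω M]

/-- Green's formula for a function supported in the domain of a chart. -/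
lemma integral_lapE [CompactSpace M] (he : e ∈ atlas (Cn n) M) (hf : Sm (n := n) f)
    (hψ : Sm (n := n) ψ) (hsupp : tsupport ψ ⊆ e.source) :
    ∫ z in e.target, (g.coeff e z).det.re * (ψ (e.symm z) * lapE g e f z) =
      -∫ z in e.target, (g.coeff e z).det.re * pairE g e f ψ z := by
  obtain ⟨hK, hKT⟩ := isCompact_chart_image (isClosed_tsupport ψ).isCompact hsupp
  set K := e '' tsupport ψ
  have hT := e.open_target
  have hP0 : ∀ z ∈ e.target, z ∉ K → inChart e ψ z = 0 := fun z hz hzK => by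
    have := vanishing_chart (G := ψ) (fun x hx => image_eq_zero_of_notMem_tsupport hx) hz hzK
    simp [inChart, this]
  have hF := hf.inChart_contDiffOn he
  have hP := hψ.inChart_contDiffOn he
  have hW : ∀ i j, ContDiffOn ℝ ∞ (fun w => (g.coeff e w).det * (g.coeff e w)⁻¹ j i) e.target :=
    fun i j w hw => ((contDiffAt_det (coeff_contDiffAt he hw)).mul
      (coeff_inv_contDiffAt he hw j i)).contDiffWithinAt
  have hFb : ∀ j, ContDiffOn ℝ ∞ (cderiv Complex.I j (inChart e f)) e.target := fun j =>
    contDiffOn_cderiv hT hF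
  have hV : ∀ j, ContDiffOn ℝ ∞ (fun w => cderiv Complex.I j (inChart e f) w * inChart e ψ w)
      e.target := fun j => (hFb j).mul hP
  -- The field with components det(g) g^{i j̄} f_{j̄} ψ. Its divergence contains no derivative of
  -- the metric, since the rows of det(g) g⁻¹ are divergence free, and integrates to zero.
  set X : Fin n → Cn n → ℂ := fun i w => ∑ j, ((g.coeff e w).det * (g.coeff e w)⁻¹ j i) *
    (cderiv Complex.I j (inChart e f) w * inChart e ψ w) with hX
  have hXc : ∀ i, ContDiffOn ℝ ∞ (X i) e.target := fun i =>
    ContDiffOn.sum fun j _ => (hW i j).mul (hV j)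
  have hX0 : ∀ i, ∀ z ∈ e.target, z ∉ K → X i z = 0 := fun i z hz hzK =>
    Finset.sum_eq_zero fun j _ => by simp only [hP0 z hz hzK, mul_zero]
  have hI : ∀ i, ∫ z in e.target, cderiv (-Complex.I) i (X i) z = 0 := fun i =>
    integral_cderiv_eq_zero hT hK hKT ((hXc i).of_le (by norm_cast)) (hX0 i)
  have hIi : ∀ i, IntegrableOn (cderiv (-Complex.I) i (X i)) e.target := fun i =>
    integrableOn_of_vanishing hT hK hKT (contDiffOn_cderiv hT (hXc i)).continuousOn
      fun z hz hzK => cderiv_eq_zero_of_vanishing hT hK (hX0 i) hz hzK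
  have hsum : ∫ z in e.target, (∑ i, cderiv (-Complex.I) i (X i) z) = 0 := by
    rw [integral_finsetSum _ fun i _ => hIi i]
    exact Finset.sum_eq_zero fun i _ => hI i
  have hd : ∀ {Y : Cn n → ℂ}, ContDiffOn ℝ ∞ Y e.target → ∀ z ∈ e.target,
      DifferentiableAt ℝ Y z := fun hY z hz =>
    (hY.contDiffAt (hT.mem_nhds hz)).differentiableAt (by simp)
  have hpt : ∀ z ∈ e.target, (∑ i, cderiv (-Complex.I) i (X i) z).re =
      (g.coeff e z).det.re * (ψ (e.symm z) * lapE g e f z) +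
      (g.coeff e z).det.re * pairE g e f ψ z := by
    intro z hz
    have h1 : ∀ i, cderiv (-Complex.I) i (X i) z =
        ∑ j, (cderiv (-Complex.I) i (fun w => (g.coeff e w).det * (g.coeff e w)⁻¹ j i) z *
          (cderiv Complex.I j (inChart e f) z * inChart e ψ z) +
          (g.coeff e z).det * (g.coeff e z)⁻¹ j i *
          (cderiv (-Complex.I) i (cderiv Complex.I j (inChart e f)) z * inChart e ψ z +
            cderiv Complex.I j (inChart e f) z * cderiv (-Complex.I) i (inChart e ψ) z)) := by
      intro i
      rw [hX]
      simp only
      rw [cderiv_sum_mul Finset.univ (fun j _ => hd (hW i j) z hz) (fun j _ => hd (hV j) z hz)]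
      refine Finset.sum_congr rfl fun j _ => ?_
      rw [cderiv_mul (hd (hFb j) z hz) (hd hP z hz)]
    have h2 : ∑ i, cderiv (-Complex.I) i (X i) z =
        (g.coeff e z).det * (inChart e ψ z * ∑ i, ∑ j, (g.coeff e z)⁻¹ j i *
          cderiv (-Complex.I) i (cderiv Complex.I j (inChart e f)) z) +
        (g.coeff e z).det * (star (grad e f z) ⬝ᵥ ((g.coeff e z)⁻¹ *ᵥ grad e ψ z)) := by
      simp_rw [h1, Finset.sum_add_distrib]
      have h3 : ∑ i, ∑ j, cderiv (-Complex.I) i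
          (fun w => (g.coeff e w).det * (g.coeff e w)⁻¹ j i) z *
          (cderiv Complex.I j (inChart e f) z * inChart e ψ z) = 0 := by
        rw [Finset.sum_comm]
        refine Finset.sum_eq_zero fun j _ => ?_
        rw [← Finset.sum_mul, sum_cderiv_det_mul_inv he hz, zero_mul]
      rw [h3, zero_add]
      simp only [mul_add, Finset.sum_add_distrib]
      congr 1
      · simp only [Finset.mul_sum]
        exact Finset.sum_congr rfl fun i _ => Finset.sum_congr rfl fun j _ => by ring
      · simp only [dotProduct, mulVec, Finset.mul_sum]
        rw [Finset.sum_comm]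
        refine Finset.sum_congr rfl fun j _ => Finset.sum_congr rfl fun i _ => ?_
        rw [grad_conj, Pi.star_apply, Complex.star_def]
        simp only [grad]
        ring
    rw [h2, ← det_coe (g := g) he hz, Complex.add_re, Complex.re_ofReal_mul, Complex.re_ofReal_mul,
      inChart, Complex.re_ofReal_mul, ← lapE_eq_sum, pairE_comm he hz]
    rfl
  have hψc : ContinuousOn (fun z => ψ (e.symm z)) e.target := (hψ e he).continuousOn
  have hi1 : IntegrableOn (fun z => (g.coeff e z).det.re * (ψ (e.symm z) * lapE g e f z))
      e.target := by
    refine integrableOn_of_vanishing hT hK hKT ((det_re_continuousOn he).mul (hψc.mul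
      (continuousOn_trace_re (coeff_inv_continuousOn (g := g) he)
      fun i j => (hf.hess_contDiffOn he i j).continuousOn))) fun z hz hzK => ?_
    have := vanishing_chart (G := ψ) (fun x hx => image_eq_zero_of_notMem_tsupport hx) hz hzK
    simp only [this, zero_mul, mul_zero]
  have hpc : ContinuousOn (fun z => pairE g e f ψ z) e.target :=
    ((continuous_pairM (g := g) hf hψ).comp_continuousOn e.continuousOn_symm).congr
      fun z hz => (pairM_eq hf hψ he hz).symm
  have hi2 : IntegrableOn (fun z => (g.coeff e z).det.re * pairE g e f ψ z) e.target := by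
    refine integrableOn_of_vanishing hT hK hKT ((det_re_continuousOn he).mul hpc)
      fun z hz hzK => ?_
    have : grad e ψ z = 0 := grad_eq_zero (isClosed_tsupport ψ)
      (fun x hx => image_eq_zero_of_notMem_tsupport hx) hz
      fun h => hzK ⟨e.symm z, h, e.right_inv hz⟩
    simp [pairE, this]
  have hre := integral_re (f := fun z => ∑ i, cderiv (-Complex.I) i (X i) z)
    (μ := volume.restrict e.target) (integrable_finsetSum _ fun i _ => hIi i)
  simp only [RCLike.re_eq_complex_re] at hre
  rw [hsum, setIntegral_congr_fun hT.measurableSet hpt, integral_add hi1 hi2,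
    Complex.zero_re] at hre
  linarith

variable [MeasurableSpace M] [BorelSpace M] [CompactSpace M] {ι : Type*} [Fintype ι]
  {cv : Cover n M ι}

/-- Green's formula on a compact Kähler manifold. -/
theorem integral_mul_laplacian (hf : Sm (n := n) f) (hψ : Sm (n := n) ψ) :
    ∫ x, ψ x * g.laplacian f x ∂(vol g cv) = -∫ x, g.pairM f ψ x ∂(vol g cv) := by
  have hψa : ∀ a, Sm (n := n) (fun x => cv.η a x * ψ x) := fun a => (cv.smooth a).mul hψ
  have hsub : ∀ a, tsupport (fun x => cv.η a x * ψ x) ⊆ tsupport (cv.η a) := fun a =>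
    tsupport_mul_subset_left
  have hcl := continuous_laplacian (g := g) hf
  have hprod : ∀ a, Continuous fun x => (cv.η a x * ψ x) * g.laplacian f x := fun a =>
    (hψa a).continuous.mul hcl
  have key : ∀ a, ∫ x, (cv.η a x * ψ x) * g.laplacian f x ∂(vol g cv) =
      -∫ x, g.pairM f (fun x => cv.η a x * ψ x) x ∂(vol g cv) := by
    intro a
    have hS := cv.isCompact_tsupport a
    rw [integral_vol_chart (cv.mem a) (hprod a) hS (cv.tsupport_subset a)
      (fun x hx => by rw [cv.eq_zero_of_notMem a hx, zero_mul, zero_mul]),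
      integral_vol_chart (cv.mem a) (continuous_pairM (g := g) hf (hψa a)) hS
        (cv.tsupport_subset a) fun x hx => ?_]
    · have h1 := integral_lapE (g := g) (cv.mem a) hf (hψa a)
        ((hsub a).trans (cv.tsupport_subset a))
      have hT := (cv.e a).open_target.measurableSet
      rw [setIntegral_congr_fun hT fun z hz => congrArg (fun t => (g.coeff (cv.e a) z).det.re *
          ((cv.η a ((cv.e a).symm z) * ψ ((cv.e a).symm z)) * t))
          (laplacian_eq hf (cv.mem a) hz).symm,
        setIntegral_congr_fun hT fun z hz => congrArg (fun t => (g.coeff (cv.e a) z).det.re * t)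
          (pairM_eq hf (hψa a) (cv.mem a) hz).symm] at h1
      exact h1
    · have : grad (chartAt (Cn n) x) (fun x => cv.η a x * ψ x) (chartAt (Cn n) x x) = 0 :=
        grad_eq_zero (isClosed_tsupport (cv.η a))
          (fun y hy => by rw [cv.eq_zero_of_notMem a hy, zero_mul]) (mem_chart_target _ x)
          (by rwa [(chartAt (Cn n) x).left_inv (mem_chart_source _ x)])
      simp [KahlerMetric.pairM, pairE, this]
  have h1 : ∀ x, ψ x * g.laplacian f x = ∑ a, (cv.η a x * ψ x) * g.laplacian f x := fun x => by
    rw [← Finset.sum_mul, ← Finset.sum_mul, cv.sum_eq_one, one_mul]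
  -- The pairing is additive in ψ = ∑ η ψ, so the derivatives of the cut-off functions need no
  -- separate treatment.
  have h2 : ∀ x, g.pairM f ψ x = ∑ a, g.pairM f (fun x => cv.η a x * ψ x) x := fun x => by
    have hsum : ψ = fun x => ∑ a, cv.η a x * ψ x := by
      funext x; rw [← Finset.sum_mul, cv.sum_eq_one, one_mul]
    conv_lhs => rw [hsum]
    simp only [KahlerMetric.pairM, pairE]
    rw [grad_sum _ fun a _ => (hψa a).inChart_differentiableAt (chart_mem_atlas _ x)
      (mem_chart_target _ x), star_sum, sum_dotProduct, Complex.re_sum]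
  simp_rw [h1, h2]
  rw [integral_finsetSum _ fun a _ => integrable_vol (hprod a),
    integral_finsetSum _ fun a _ => integrable_vol (continuous_pairM hf (hψa a)),
    ← Finset.sum_neg_distrib]
  exact Finset.sum_congr rfl fun a _ => key a

end GreenFormula

/-! ### Logarithmic Laplacian of a product with a squared cut-off -/

section FlatOperators

open Matrix

variable {n : ℕ} {A : Matrix (Fin n) (Fin n) ℂ} {z : Cn n} {u v : Cn n → ℝ}

/-- The complex gradient of a function on `ℂⁿ`. -/
def gradC (f : Cn n → ℂ) (z : Cn n) : Fin n → ℂ := fun i => cderiv (-Complex.I) i f z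

/-- The operator `a^{i j̄} ∂²/∂zⁱ∂z̄ʲ`, where `(a^{i j̄})` is inverse to `A`. -/
def lapC (A : Matrix (Fin n) (Fin n) ℂ) (f : Cn n → ℂ) (z : Cn n) : ℝ :=
  (∑ i, ∑ j, A⁻¹ j i * cderiv (-Complex.I) i (cderiv Complex.I j f) z).re

lemma lapC_congr {f f' : Cn n → ℂ} (h : f =ᶠ[nhds z] f') : lapC A f z = lapC A f' z := by
  simp only [lapC, fun i j => cderiv_congr (c := -Complex.I) (i := i)
    (cderiv_congr' (c := Complex.I) (i := j) h)]

lemma gradC_congr {f f' : Cn n → ℂ} (h : f =ᶠ[nhds z] f') : gradC f z = gradC f' z := by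
  funext i; exact cderiv_congr h

lemma cderiv_bar_ofReal (u : Cn n → ℝ) (z : Cn n) (j : Fin n) :
    cderiv Complex.I j (fun w => (u w : ℂ)) z =
      (starRingEnd ℂ) (gradC (fun w => (u w : ℂ)) z j) := by
  rw [cderiv_ofReal_conj, Complex.conj_I]; rfl

lemma contDiffAt_ofReal {r : WithTop ℕ∞} (hu : ContDiffAt ℝ r u z) :
    ContDiffAt ℝ r (fun w => (u w : ℂ)) z :=
  Complex.ofRealCLM.contDiff.contDiffAt.comp z hu

lemma gradC_mul (hu : DifferentiableAt ℝ u z) (hv : DifferentiableAt ℝ v z) :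
    gradC (fun w => ((u w * v w : ℝ) : ℂ)) z =
      (v z : ℂ) • gradC (fun w => (u w : ℂ)) z + (u z : ℂ) • gradC (fun w => (v w : ℂ)) z := by
  funext i
  simp only [gradC, Complex.ofReal_mul, Pi.add_apply, Pi.smul_apply, smul_eq_mul]
  rw [cderiv_mul (differentiableAt_ofReal hu) (differentiableAt_ofReal hv)]
  ring

lemma hermitian_pair_comm (hA : A.IsHermitian) (ξ ζ : Fin n → ℂ) :
    (star ξ ⬝ᵥ (A⁻¹ *ᵥ ζ)).re = (star ζ ⬝ᵥ (A⁻¹ *ᵥ ξ)).re := by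
  rw [← Complex.conj_re, starRingEnd_apply, ← star_dotProduct, star_mulVec, hA.inv.eq,
    ← dotProduct_mulVec]

lemma qform_add_smul (hA : A.IsHermitian) (a b : ℝ) (ξ ζ : Fin n → ℂ) :
    qform A⁻¹ ((a : ℂ) • ξ + (b : ℂ) • ζ) = a ^ 2 * qform A⁻¹ ξ +
      2 * (a * b) * (star ξ ⬝ᵥ (A⁻¹ *ᵥ ζ)).re + b ^ 2 * qform A⁻¹ ζ := by
  have h := hermitian_pair_comm hA ζ ξ
  simp only [qform, star_add, star_smul, mulVec_add, mulVec_smul, dotProduct_add, add_dotProduct,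
    smul_dotProduct, dotProduct_smul, smul_eq_mul, Complex.star_def, Complex.conj_ofReal,
    Complex.add_re, Complex.re_ofReal_mul, h]
  ring

lemma qform_smul (A : Matrix (Fin n) (Fin n) ℂ) (a : ℝ) (ξ : Fin n → ℂ) :
    qform A ((a : ℂ) • ξ) = a ^ 2 * qform A ξ := by
  simp only [qform, star_smul, mulVec_smul, smul_dotProduct, dotProduct_smul, smul_eq_mul,
    Complex.star_def, Complex.conj_ofReal, Complex.re_ofReal_mul]
  ring

lemma lapC_mul (hA : A.IsHermitian) (hu : ContDiffAt ℝ 2 u z) (hv : ContDiffAt ℝ 2 v z) :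
    lapC A (fun w => ((u w * v w : ℝ) : ℂ)) z =
      u z * lapC A (fun w => (v w : ℂ)) z + v z * lapC A (fun w => (u w : ℂ)) z +
      2 * (star (gradC (fun w => (u w : ℂ)) z) ⬝ᵥ
        (A⁻¹ *ᵥ gradC (fun w => (v w : ℂ)) z)).re := by
  have hu' := contDiffAt_ofReal hu
  have hv' := contDiffAt_ofReal hv
  have hu1 : ∀ j, DifferentiableAt ℝ (cderiv Complex.I j fun w => (u w : ℂ)) z := fun j =>
    (contDiffAt_cderiv (m := 1) (hu'.of_le (by norm_num))).differentiableAt (by simp)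
  have hv1 : ∀ j, DifferentiableAt ℝ (cderiv Complex.I j fun w => (v w : ℂ)) z := fun j =>
    (contDiffAt_cderiv (m := 1) (hv'.of_le (by norm_num))).differentiableAt (by simp)
  have hu0 := hu'.differentiableAt (by simp)
  have hv0 := hv'.differentiableAt (by simp)
  have h1 : ∀ i j, cderiv (-Complex.I) i (cderiv Complex.I j
      fun w => ((u w * v w : ℝ) : ℂ)) z =
      (u z : ℂ) * cderiv (-Complex.I) i (cderiv Complex.I j fun w => (v w : ℂ)) z +
      (v z : ℂ) * cderiv (-Complex.I) i (cderiv Complex.I j fun w => (u w : ℂ)) z +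
      (starRingEnd ℂ) (gradC (fun w => (u w : ℂ)) z j) * gradC (fun w => (v w : ℂ)) z i +
      (starRingEnd ℂ) (gradC (fun w => (v w : ℂ)) z j) * gradC (fun w => (u w : ℂ)) z i := by
    intro i j
    have hev : cderiv Complex.I j (fun w => ((u w * v w : ℝ) : ℂ)) =ᶠ[nhds z] fun w =>
        cderiv Complex.I j (fun w => (u w : ℂ)) w * (v w : ℂ) +
        (u w : ℂ) * cderiv Complex.I j (fun w => (v w : ℂ)) w := by
      filter_upwards [hu'.eventually (by simp), hv'.eventually (by simp)] with w hw1 hw2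
      simp only [Complex.ofReal_mul]
      exact cderiv_mul (hw1.differentiableAt (by simp)) (hw2.differentiableAt (by simp))
    rw [cderiv_congr hev, cderiv_add ((hu1 j).fun_mul hv0) (hu0.fun_mul (hv1 j)),
      cderiv_mul (hu1 j) hv0, cderiv_mul hu0 (hv1 j), cderiv_bar_ofReal, cderiv_bar_ofReal]
    simp only [gradC]
    ring
  have h2 : ∀ a b : Cn n → ℝ, (∑ i, ∑ j, A⁻¹ j i *
      ((starRingEnd ℂ) (gradC (fun w => (a w : ℂ)) z j) * gradC (fun w => (b w : ℂ)) z i)) =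
      star (gradC (fun w => (a w : ℂ)) z) ⬝ᵥ (A⁻¹ *ᵥ gradC (fun w => (b w : ℂ)) z) := by
    intro a b
    rw [Finset.sum_comm, dotProduct]
    refine Finset.sum_congr rfl fun j _ => ?_
    rw [mulVec, dotProduct, Finset.mul_sum]
    refine Finset.sum_congr rfl fun i _ => ?_
    rw [Pi.star_apply, Complex.star_def]; ring
  have h3 := hermitian_pair_comm hA (gradC (fun w => (u w : ℂ)) z) (gradC (fun w => (v w : ℂ)) z)
  simp only [lapC, h1, mul_add, Finset.sum_add_distrib, h2, Complex.add_re]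
  have h4 : ∀ (a : ℝ) (f : Fin n → Fin n → ℂ), (∑ i, ∑ j, A⁻¹ j i * ((a : ℂ) * f i j)).re =
      a * (∑ i, ∑ j, A⁻¹ j i * f i j).re := fun a f => by
    rw [← Complex.re_ofReal_mul, Finset.mul_sum]
    congr 1
    refine Finset.sum_congr rfl fun i _ => ?_
    rw [Finset.mul_sum]
    exact Finset.sum_congr rfl fun j _ => by ring
  rw [h4, h4, ← h3]
  ring

/-- The product `η² k` in a logarithmic Laplacian. -/
lemma lapC_sq_mul_sub {η k : Cn n → ℝ} (hA : A.PosDef) (hη : ContDiffAt ℝ 2 η z)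
    (hk : ContDiffAt ℝ 2 k z) (hk0 : 0 < k z) {Λ : ℝ}
    (hΛ : Λ ≤ lapC A (fun w => (k w : ℂ)) z - qform A⁻¹ (gradC (fun w => (k w : ℂ)) z) / k z) :
    η z ^ 2 * Λ + k z * (2 * η z * lapC A (fun w => (η w : ℂ)) z -
        2 * qform A⁻¹ (gradC (fun w => (η w : ℂ)) z)) ≤
      lapC A (fun w => ((η w * η w * k w : ℝ) : ℂ)) z -
        qform A⁻¹ (gradC (fun w => ((η w * η w * k w : ℝ) : ℂ)) z) / (η z * η z * k z) := by
  have hH := hA.1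
  have hηd := hη.differentiableAt (by simp)
  have hkd := hk.differentiableAt (by simp)
  have hg2 : gradC (fun w => ((η w * η w : ℝ) : ℂ)) z =
      ((2 * η z : ℝ) : ℂ) • gradC (fun w => (η w : ℂ)) z := by
    rw [gradC_mul hηd hηd, ← add_smul]; congr 1; push_cast; ring
  have hl2 := lapC_mul hH hη hη
  have hl := lapC_mul hH (u := fun w => η w * η w) (hη.mul hη) hk
  have hg := gradC_mul (u := fun w => η w * η w) (hηd.fun_mul hηd) hkd
  rw [hg2, star_smul, smul_dotProduct, smul_eq_mul, Complex.star_def, Complex.conj_ofReal,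
    Complex.re_ofReal_mul, hl2] at hl
  rw [hg2, smul_smul, ← Complex.ofReal_mul] at hg
  rw [hl, hg, qform_add_smul hH]
  rw [show (star (gradC (fun w => (η w : ℂ)) z) ⬝ᵥ (A⁻¹ *ᵥ gradC (fun w => (η w : ℂ)) z)).re =
    qform A⁻¹ (gradC (fun w => (η w : ℂ)) z) from rfl]
  have hq := qform_inv_nonneg hA (gradC (fun w => (η w : ℂ)) z)
  set qη := qform A⁻¹ (gradC (fun w => (η w : ℂ)) z)
  set qk := qform A⁻¹ (gradC (fun w => (k w : ℂ)) z)
  set c := (star (gradC (fun w => (η w : ℂ)) z) ⬝ᵥ (A⁻¹ *ᵥ gradC (fun w => (k w : ℂ)) z)).re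
  -- At a zero of η the quotient is zero by convention and the claim reads -2kq ≤ 2kq, where q ≥ 0
  -- is the square length of ∂η. Elsewhere the mixed terms in ∂η and ∂k cancel exactly; this is why
  -- η is squared, and no derivative of k enters the error.
  rcases eq_or_ne (η z) 0 with h0 | h0
  · simp only [h0]
    norm_num
    nlinarith
  · have h1 : ((k z * (2 * η z)) ^ 2 * qη + 2 * (k z * (2 * η z) * (η z * η z)) * c +
        (η z * η z) ^ 2 * qk) / (η z * η z * k z) =
        4 * k z * qη + 4 * η z * c + η z ^ 2 * (qk / k z) := by
      field_simp
      ring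
    rw [h1]
    nlinarith [mul_le_mul_of_nonneg_left hΛ (sq_nonneg (η z))]

lemma abs_lapC_le (hA : A.PosDef) (f : Cn n → ℂ) (z : Cn n) :
    |lapC A f z| ≤ A⁻¹.trace.re *
      ∑ i, ∑ j, ‖cderiv (-Complex.I) i (cderiv Complex.I j f) z‖ := by
  set B : Matrix (Fin n) (Fin n) ℂ :=
    of fun i j => cderiv (-Complex.I) i (cderiv Complex.I j f) z with hB
  have h : lapC A f z = (A⁻¹ * B).trace.re := by
    rw [lapC, Finset.sum_comm]; rfl
  rw [h]
  exact (Complex.abs_re_le_norm _).trans (norm_trace_mul_le hA.inv.posSemidef B)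

end FlatOperators

/-! ### Components of a Kähler metric and the Ricci form -/

section ComponentInequality

open Matrix

variable {n : ℕ} {M : Type*} [TopologicalSpace M] [ChartedSpace (Cn n) M]
  {e : OpenPartialHomeomorph M (Cn n)} {z : Cn n} {h : KahlerMetric n M} {i : Fin n}

/-- The logarithm of the volume density in a chart. -/
def logDet (h : KahlerMetric n M) (e : OpenPartialHomeomorph M (Cn n)) (z : Cn n) : ℝ :=
  Real.log (h.coeff e z).det.re

/-- The function `(∂²u/∂zⁱ∂z̄ⁱ)` for a real function `u`. -/
def flat (i : Fin n) (u : Cn n → ℝ) (z : Cn n) : ℝ :=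
  (cderiv (-Complex.I) i (cderiv Complex.I i fun w => (u w : ℂ)) z).re

lemma coeff_conj (he : e ∈ atlas (Cn n) M) (hz : z ∈ e.target) (k l : Fin n) :
    (starRingEnd ℂ) (h.coeff e z l k) = h.coeff e z k l :=
  congrFun (congrFun (h.posDef e he z hz).1.eq k) l

lemma cderiv_bar_coeff (he : e ∈ atlas (Cn n) M) (hz : z ∈ e.target) (i k l : Fin n) :
    cderiv Complex.I i (fun w => h.coeff e w k l) z =
      (starRingEnd ℂ) (cderiv (-Complex.I) i (fun w => h.coeff e w l k) z) := by
  have h1 : (fun w => h.coeff e w k l) =ᶠ[nhds z]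
      fun w => (starRingEnd ℂ) (h.coeff e w l k) := by
    filter_upwards [e.open_target.mem_nhds hz] with w hw using (coeff_conj he hw k l).symm
  rw [cderiv_congr h1, cderiv_conj, Complex.conj_I]

lemma closed_bar_eq (he : e ∈ atlas (Cn n) M) (hz : z ∈ e.target) (i k l : Fin n) :
    cderiv Complex.I i (fun w => h.coeff e w k l) z =
      cderiv Complex.I l (fun w => h.coeff e w k i) z := by
  rw [cderiv_bar_coeff he hz, cderiv_bar_coeff he hz, closed_eq he hz]

lemma logDet_contDiffAt (he : e ∈ atlas (Cn n) M) (hz : z ∈ e.target)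
    [IsManifold 𝓘(ℂ, Cn n) ω M] : ContDiffAt ℝ ∞ (logDet h e) z :=
  ((Complex.reCLM.contDiff.contDiffAt).comp z (contDiffAt_det (coeff_contDiffAt he hz))).log
    (det_re_pos he hz).ne'

variable [IsManifold 𝓘(ℂ, Cn n) ω M]

/-- Jacobi's formula, differentiated once more. The left side is minus a diagonal component of the
Ricci form of h; the last trace is the square norm of ∂_i h, since ∂_ī h is the adjoint of ∂_i h. -/
lemma flat_logDet (he : e ∈ atlas (Cn n) M) (hz : z ∈ e.target) (i : Fin n) :
    flat i (logDet h e) z = ((h.coeff e z)⁻¹ * of fun k l =>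
        cderiv (-Complex.I) i (cderiv Complex.I i fun w => h.coeff e w k l) z).trace.re -
      ((h.coeff e z)⁻¹ * (of fun k l => cderiv (-Complex.I) i (fun w => h.coeff e w k l) z) *
        (h.coeff e z)⁻¹ *
        (of fun k l => cderiv (-Complex.I) i (fun w => h.coeff e w k l) z)ᴴ).trace.re := by
  have hA : ∀ w ∈ e.target, ∀ k l, ContDiffAt ℝ ∞ (fun w => h.coeff e w k l) w := fun w hw k l =>
    coeff_contDiffAt he hw k l
  have h1 : ∀ w ∈ e.target, cderiv Complex.I i (fun w => (logDet h e w : ℂ)) w =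
      ∑ p : Fin n × Fin n, (h.coeff e w)⁻¹ p.1 p.2 *
        cderiv Complex.I i (fun w => h.coeff e w p.2 p.1) w := by
    intro w hw
    have hd : DifferentiableAt ℝ (fun w => (h.coeff e w).det.re) w :=
      Complex.reCLM.differentiableAt.comp w
        ((contDiffAt_det (hA w hw)).differentiableAt (by simp))
    have hpos := det_re_pos (g := h) he hw
    simp only [logDet]
    rw [cderiv_comp_real hd (Real.hasDerivAt_log hpos.ne')]
    have hc : (fun w => (((h.coeff e w).det.re : ℝ) : ℂ)) =ᶠ[nhds w] fun w => (h.coeff e w).det := by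
      filter_upwards [e.open_target.mem_nhds hw] with y hy using det_coe he hy
    rw [cderiv_congr hc, cderiv_det (fun k l => (hA w hw k l).differentiableAt (by simp))
      (isUnit_det he hw).ne_zero, Complex.ofReal_inv, det_coe he hw,
      inv_mul_cancel_left₀ (isUnit_det he hw).ne_zero, trace, Fintype.sum_prod_type]
    rfl
  have h2 : cderiv Complex.I i (fun w => (logDet h e w : ℂ)) =ᶠ[nhds z] fun w =>
      ∑ p : Fin n × Fin n, (h.coeff e w)⁻¹ p.1 p.2 *
        cderiv Complex.I i (fun w => h.coeff e w p.2 p.1) w := by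
    filter_upwards [e.open_target.mem_nhds hz] with w hw using h1 w hw
  have hinv := cderiv_inv (c := -Complex.I) (i := i) (A := h.coeff e) (z := z)
    (fun k l => (hA z hz k l).of_le (by norm_cast)) (isUnit_det he hz).ne_zero
  rw [flat, cderiv_congr h2, cderiv_sum_mul _
    (fun p _ => (coeff_inv_contDiffAt he hz p.1 p.2).differentiableAt (by simp))
    (fun p _ => (contDiffAt_cderiv (m := 1) ((hA z hz p.2 p.1).of_le
      (by norm_cast))).differentiableAt (by simp)), Finset.sum_add_distrib, add_comm,
    sub_eq_add_neg, ← Complex.neg_re, ← Complex.add_re, Fintype.sum_prod_type,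
    Fintype.sum_prod_type]
  congr 2
  set B : Matrix (Fin n) (Fin n) ℂ :=
    of fun k l => cderiv (-Complex.I) i (fun w => h.coeff e w k l) z with hB
  rw [← trace_neg, ← Matrix.neg_mul, ← hinv, trace]
  refine Finset.sum_congr rfl fun k _ => ?_
  rw [diag_apply, mul_apply]
  refine Finset.sum_congr rfl fun l _ => ?_
  rw [cderiv_bar_coeff he hz, conjTranspose_apply, hB, of_apply, of_apply, Complex.star_def]

/-- Closedness in the barred and in the unbarred index gives ∂_k ∂_l̄ h_{i ī} = ∂_i ∂_ī h_{k l̄}, so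
the Laplacian of a component shares its second order term with `flat_logDet`. -/
lemma lapC_coeff (he : e ∈ atlas (Cn n) M) (hz : z ∈ e.target) (i : Fin n) :
    lapC (h.coeff e z) (fun w => h.coeff e w i i) z = ((h.coeff e z)⁻¹ * of fun k l =>
        cderiv (-Complex.I) i (cderiv Complex.I i fun w => h.coeff e w k l) z).trace.re := by
  rw [lapC, trace, Finset.sum_comm]
  congr 1
  refine Finset.sum_congr rfl fun l _ => ?_
  rw [diag_apply, mul_apply]
  refine Finset.sum_congr rfl fun k _ => ?_
  congr 1
  have hA : ∀ k l, ContDiffAt ℝ 2 (fun w => h.coeff e w k l) z := fun k l =>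
    (coeff_contDiffAt he hz k l).of_le (by norm_cast)
  have h1 : cderiv Complex.I l (fun w => h.coeff e w i i) =ᶠ[nhds z]
      cderiv Complex.I i (fun w => h.coeff e w i l) := by
    filter_upwards [e.open_target.mem_nhds hz] with w hw using closed_bar_eq he hw l i i
  have h2 : cderiv (-Complex.I) k (fun w => h.coeff e w i l) =ᶠ[nhds z]
      cderiv (-Complex.I) i (fun w => h.coeff e w k l) := by
    filter_upwards [e.open_target.mem_nhds hz] with w hw using closed_eq he hw k i l
  rw [cderiv_congr h1, cderiv_comm (hA i l), cderiv_congr h2, cderiv_comm (hA k l), of_apply]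

/-- The logarithm of a diagonal component of a Kähler metric is subharmonic up to the Ricci form. -/
lemma flat_logDet_le (he : e ∈ atlas (Cn n) M) (hz : z ∈ e.target) (i : Fin n) :
    flat i (logDet h e) z ≤ lapC (h.coeff e z) (fun w => (((h.coeff e w i i).re : ℝ) : ℂ)) z -
      qform (h.coeff e z)⁻¹ (gradC (fun w => (((h.coeff e w i i).re : ℝ) : ℂ)) z) /
        (h.coeff e z i i).re := by
  have hpos : 0 < (h.coeff e z i i).re :=
    (Complex.lt_def.mp ((h.posDef e he z hz).diag_pos (i := i))).1
  have hev : (fun w => (((h.coeff e w i i).re : ℝ) : ℂ)) =ᶠ[nhds z] fun w => h.coeff e w i i := by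
    filter_upwards [e.open_target.mem_nhds hz] with w hw
    exact Complex.conj_eq_iff_re.mp (coeff_conj he hw i i)
  rw [lapC_congr hev, gradC_congr hev, lapC_coeff he hz, flat_logDet he hz]
  -- By closedness the gradient of h_{i ī} is the i-th column of ∂_i h. `qform_inv_col_le` therefore
  -- bounds its square length by the quadratic term of `flat_logDet`.
  have hg : gradC (fun w => h.coeff e w i i) z = fun k =>
      (of fun k l => cderiv (-Complex.I) i (fun w => h.coeff e w k l) z :
        Matrix (Fin n) (Fin n) ℂ) k i := by
    funext k; exact closed_eq he hz k i i
  have h1 := qform_inv_col_le (h.posDef e he z hz)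
    (of fun k l => cderiv (-Complex.I) i (fun w => h.coeff e w k l) z) i
  rw [hg]
  have h2 := (div_le_iff₀' hpos).mpr h1
  linarith

end ComponentInequality

/-! ### The cut-off trace and its differential inequality -/

section CutTrace

open Matrix

variable {n : ℕ} {M : Type*} [TopologicalSpace M] [ChartedSpace (Cn n) M]
  {ι : Type*} [Fintype ι] {cv : Cover n M ι} {g h : KahlerMetric n M}
  {e : OpenPartialHomeomorph M (Cn n)} {z : Cn n} {f : M → ℝ}

lemma Cover.le_one (cv : Cover n M ι) (a : ι) (x : M) : cv.η a x ≤ 1 := by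
  rw [← cv.sum_eq_one x]
  exact Finset.single_le_sum (fun b _ => cv.nonneg b x) (Finset.mem_univ a)

lemma Cover.one_le_card_mul_sum_sq (cv : Cover n M ι) (x : M) :
    1 ≤ Fintype.card ι * ∑ a, cv.η a x ^ 2 := by
  have := sq_sum_le_card_mul_sum_sq (s := Finset.univ) (f := fun a => cv.η a x)
  rwa [cv.sum_eq_one, one_pow, Finset.card_univ] at this

/-- The component `h_{i ī}` in the chart with index `p.1`, where `i = p.2`. -/
def comp (h : KahlerMetric n M) (cv : Cover n M ι) (p : ι × Fin n) (x : M) : ℝ :=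
  (h.coeff (cv.e p.1) (cv.e p.1 x) p.2 p.2).re

/-- The component `h_{i ī}` cut off by the square of a function of the partition of unity. -/
def cutComp (h : KahlerMetric n M) (cv : Cover n M ι) (p : ι × Fin n) (x : M) : ℝ :=
  cv.η p.1 x * cv.η p.1 x * comp h cv p x

/-- The trace of `h` with respect to `∑ η² δ⁻¹`, a substitute for `tr_g h`. -/
def cutTrace (h : KahlerMetric n M) (cv : Cover n M ι) (x : M) : ℝ := ∑ p, cutComp h cv p x

/-- The operator `∑ η² ∑ ∂²/∂zⁱ∂z̄ⁱ`. -/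
def cutLap (cv : Cover n M ι) (F : M → ℝ) (x : M) : ℝ :=
  ∑ p : ι × Fin n, cv.η p.1 x ^ 2 * flat p.2 (fun w => F ((cv.e p.1).symm w)) (cv.e p.1 x)

lemma trace_re_nonneg {m : Type*} [Fintype m] {A : Matrix m m ℂ} (hA : A.PosSemidef) :
    0 ≤ A.trace.re := (Complex.le_def.mp hA.trace_nonneg).1

lemma coeff_posDef {x : M} (h : KahlerMetric n M) (he : e ∈ atlas (Cn n) M) (hx : x ∈ e.source) :
    (h.coeff e (e x)).PosDef := h.posDef e he _ (e.map_source hx)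

lemma comp_pos {p : ι × Fin n} {x : M} (hx : x ∈ (cv.e p.1).source) : 0 < comp h cv p x :=
  (Complex.lt_def.mp ((coeff_posDef h (cv.mem p.1) hx).diag_pos (i := p.2))).1

variable [CompactSpace M]

lemma Cover.mem_source (cv : Cover n M ι) {a : ι} {x : M} (hx : cv.η a x ≠ 0) :
    x ∈ (cv.e a).source := cv.tsupport_subset a (subset_tsupport _ hx)

lemma cutComp_nonneg (p : ι × Fin n) (x : M) : 0 ≤ cutComp h cv p x := by
  by_cases hx : cv.η p.1 x = 0
  · simp [cutComp, hx]
  · exact mul_nonneg (mul_self_nonneg _) (comp_pos (cv.mem_source hx)).le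

lemma cutTrace_nonneg (x : M) : 0 ≤ cutTrace h cv x :=
  Finset.sum_nonneg fun p _ => cutComp_nonneg p x

/-- Source of the constants below: each function is continuous on a chart and only evaluated on the
compact support of a cut-off. No constant obtained in this way depends on the varying metric h. -/
lemma exists_bound {f : ι → Cn n → ℝ} (hf : ∀ a, ContinuousOn (f a) (cv.e a).target) :
    ∃ C, 1 ≤ C ∧ ∀ a, ∀ x ∈ tsupport (cv.η a), |f a (cv.e a x)| ≤ C := by
  have h1 : ∀ a, ∃ C, ∀ z ∈ cv.e a '' tsupport (cv.η a), ‖f a z‖ ≤ C := fun a => by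
    obtain ⟨hK, hKT⟩ := isCompact_chart_image (cv.isCompact_tsupport a) (cv.tsupport_subset a)
    exact hK.exists_bound_of_continuousOn ((hf a).mono hKT)
  choose C hC using h1
  refine ⟨1 + ∑ a, |C a|, by
    have : 0 ≤ ∑ a, |C a| := Finset.sum_nonneg fun _ _ => abs_nonneg _
    linarith, fun a x hx => ?_⟩
  have h2 := hC a _ ⟨x, hx, rfl⟩
  have h3 : |C a| ≤ ∑ a, |C a| :=
    Finset.single_le_sum (f := fun a => |C a|) (fun _ _ => abs_nonneg _) (Finset.mem_univ a)
  rw [Real.norm_eq_abs] at h2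
  linarith [le_abs_self (C a)]

lemma trace_re_continuousOn {A : Cn n → Matrix (Fin n) (Fin n) ℂ} {T : Set (Cn n)}
    (hA : ∀ i j, ContinuousOn (fun z => A z i j) T) :
    ContinuousOn (fun z => (A z).trace.re) T := by
  refine Complex.continuous_re.comp_continuousOn ?_
  simp only [trace, diag_apply]
  exact continuousOn_finsetSum _ fun i _ => hA i i

lemma exists_trace_bound (g : KahlerMetric n M) (cv : Cover n M ι) :
    ∃ C, 1 ≤ C ∧ ∀ a, ∀ x ∈ tsupport (cv.η a), (g.coeff (cv.e a) (cv.e a x)).trace.re ≤ C ∧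
      (g.coeff (cv.e a) (cv.e a x))⁻¹.trace.re ≤ C := by
  obtain ⟨C, hC1, hC⟩ := exists_bound (cv := cv)
    (f := fun a z => (g.coeff (cv.e a) z).trace.re)
    fun a => trace_re_continuousOn (coeff_continuousOn (cv.mem a))
  obtain ⟨D, hD1, hD⟩ := exists_bound (cv := cv)
    (f := fun a z => (g.coeff (cv.e a) z)⁻¹.trace.re)
    fun a => trace_re_continuousOn (coeff_inv_continuousOn (cv.mem a))
  refine ⟨max C D, hC1.trans (le_max_left _ _), fun a x hx => ⟨?_, ?_⟩⟩
  · exact ((le_abs_self _).trans (hC a x hx)).trans (le_max_left _ _)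
  · exact ((le_abs_self _).trans (hD a x hx)).trans (le_max_right _ _)

variable [IsManifold 𝓘(ℂ, Cn n) ω M]

lemma trM_eq_of_mem (g h : KahlerMetric n M) (he : e ∈ atlas (Cn n) M) {x : M}
    (hx : x ∈ e.source) : g.trM h x = ((g.coeff e (e x))⁻¹ * h.coeff e (e x)).trace.re := by
  have := trM_eq (g := g) (h := h) he (e.map_source hx)
  rwa [e.left_inv hx] at this

lemma trM_nonneg (x : M) : 0 ≤ g.trM h x := by
  have hx := mem_chart_source (Cn n) x
  rw [trM_eq_of_mem g h (chart_mem_atlas _ x) hx]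
  obtain ⟨l, hl, h1, -, -⟩ := trace_inv_mul_eigen (coeff_posDef g (chart_mem_atlas _ x) hx)
    (coeff_posDef h (chart_mem_atlas _ x) hx)
  rw [h1]
  exact Finset.sum_nonneg fun i _ => (hl i).le

lemma exists_comp_le (g : KahlerMetric n M) (cv : Cover n M ι) :
    ∃ C, 1 ≤ C ∧ ∀ (h : KahlerMetric n M) (p : ι × Fin n), ∀ x ∈ tsupport (cv.η p.1),
      comp h cv p x ≤ C * g.trM h x := by
  obtain ⟨C, hC1, hC⟩ := exists_trace_bound g cv
  refine ⟨C, hC1, fun h p x hx => ?_⟩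
  have hxs := cv.tsupport_subset _ hx
  have h1 := norm_entry_le_trace (coeff_posDef h (cv.mem p.1) hxs).posSemidef p.2 p.2
  have h2 := trace_le_trace_inv_mul (coeff_posDef g (cv.mem p.1) hxs)
    (coeff_posDef h (cv.mem p.1) hxs)
  rw [← trM_eq_of_mem g h (cv.mem p.1) hxs] at h2
  have h3 : comp h cv p x ≤ ‖h.coeff (cv.e p.1) (cv.e p.1 x) p.2 p.2‖ :=
    (le_abs_self _).trans (Complex.abs_re_le_norm _)
  have h4 := mul_le_mul_of_nonneg_right (hC p.1 x hx).1 (trM_nonneg (g := g) (h := h) x)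
  linarith

lemma exists_cutTrace_le (g : KahlerMetric n M) (cv : Cover n M ι) :
    ∃ C, 1 ≤ C ∧ ∀ (h : KahlerMetric n M) (x : M), cutTrace h cv x ≤ C * g.trM h x := by
  obtain ⟨C, hC1, hC⟩ := exists_comp_le g cv
  refine ⟨1 + Fintype.card (ι × Fin n) * C, by
    have : (0 : ℝ) ≤ Fintype.card (ι × Fin n) * C := by positivity
    linarith, fun h x => ?_⟩
  have ht := trM_nonneg (g := g) (h := h) x
  have h1 : ∀ p : ι × Fin n, cutComp h cv p x ≤ C * g.trM h x := fun p => by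
    by_cases hx : cv.η p.1 x = 0
    · rw [cutComp, hx]; simp only [zero_mul]; positivity
    · have hp := comp_pos (h := h) (cv.mem_source hx)
      have h2 := hC h p x (subset_tsupport _ hx)
      have h3 : cv.η p.1 x * cv.η p.1 x ≤ 1 := mul_le_one₀ (cv.le_one _ _) (cv.nonneg _ _)
        (cv.le_one _ _)
      rw [cutComp]
      nlinarith
  calc cutTrace h cv x ≤ ∑ _p : ι × Fin n, C * g.trM h x := Finset.sum_le_sum fun p _ => h1 p
    _ = Fintype.card (ι × Fin n) * C * g.trM h x := by
      rw [Finset.sum_const, Finset.card_univ, nsmul_eq_mul]; ring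
    _ ≤ _ := by nlinarith

/-- The converse of `exists_cutTrace_le`: the squares η² sum to at least the inverse of the number
of charts. Together they make the cut-off trace comparable to tr_g h, uniformly in h. -/
lemma exists_trM_le (g : KahlerMetric n M) (cv : Cover n M ι) :
    ∃ C, 1 ≤ C ∧ ∀ (h : KahlerMetric n M) (x : M), g.trM h x ≤ C * cutTrace h cv x := by
  obtain ⟨C, hC1, hC⟩ := exists_trace_bound g cv
  refine ⟨1 + Fintype.card ι * C, by
    have : (0 : ℝ) ≤ Fintype.card ι * C := by positivity
    linarith, fun h x => ?_⟩
  have ht := trM_nonneg (g := g) (h := h) x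
  have h1 : ∀ a, cv.η a x ^ 2 * g.trM h x ≤ C * ∑ i, cutComp h cv (a, i) x := fun a => by
    by_cases hx : cv.η a x = 0
    · simp only [cutComp, hx]; simp
    · have hxs := cv.mem_source hx
      have h2 := trace_inv_mul_le (coeff_posDef g (cv.mem a) hxs) (coeff_posDef h (cv.mem a) hxs)
      rw [← trM_eq_of_mem g h (cv.mem a) hxs] at h2
      have h3 := trace_re_nonneg (coeff_posDef h (cv.mem a) hxs).posSemidef
      have h4 := mul_le_mul_of_nonneg_right (hC a x (subset_tsupport _ hx)).2 h3
      have h5 : (h.coeff (cv.e a) (cv.e a x)).trace.re = ∑ i, comp h cv (a, i) x := by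
        rw [trace, Complex.re_sum]; rfl
      have h6 : ∑ i, cutComp h cv (a, i) x = cv.η a x ^ 2 * ∑ i, comp h cv (a, i) x := by
        rw [Finset.mul_sum]
        exact Finset.sum_congr rfl fun i _ => by rw [cutComp]; ring
      rw [h6, ← h5]
      nlinarith [mul_le_mul_of_nonneg_left (h2.trans h4) (sq_nonneg (cv.η a x))]
  have h2 := cv.one_le_card_mul_sum_sq x
  have h3 := cutTrace_nonneg (h := h) (cv := cv) x
  have h4 : (∑ a, cv.η a x ^ 2) * g.trM h x ≤ C * cutTrace h cv x := by
    rw [Finset.sum_mul, cutTrace, Fintype.sum_prod_type, Finset.mul_sum]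
    exact Finset.sum_le_sum fun a _ => h1 a
  have h5 : (0 : ℝ) ≤ Fintype.card ι := Nat.cast_nonneg _
  nlinarith [mul_le_mul_of_nonneg_right h2 ht, mul_le_mul_of_nonneg_left h4 h5]

/-- Extension by zero: off the closed set S the function vanishes locally, and on S every other
chart overlaps with `e`. -/
lemma sm_of_tsupport {G : M → ℝ} {S : Set M} {e : OpenPartialHomeomorph M (Cn n)}
    (he : e ∈ atlas (Cn n) M) (hS : IsClosed S) (hSe : S ⊆ e.source)
    (h0 : ∀ x, x ∉ S → G x = 0) (hG : ContDiffOn ℝ ∞ (fun z => G (e.symm z)) e.target) :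
    Sm (n := n) G := by
  intro e' he' z hz
  refine ContDiffAt.contDiffWithinAt ?_
  by_cases hzS : e'.symm z ∈ S
  · have hz' := hSe hzS
    have h1 : (fun w => G (e'.symm w)) =ᶠ[nhds z] (fun w => G (e.symm w)) ∘ (e ∘ e'.symm) := by
      filter_upwards [eventually_chart e' e hz hz'] with w hw
      simp [e.left_inv hw.2]
    refine ContDiffAt.congr_of_eventuallyEq ?_ h1
    exact (hG.contDiffAt (e.open_target.mem_nhds (e.map_source hz'))).comp z
      (contDiffAt_transition_real he' he hz hz')
  · refine (contDiffAt_const (c := (0 : ℝ))).congr_of_eventuallyEq ?_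
    filter_upwards [(e'.continuousAt_symm hz).eventually (hS.isOpen_compl.mem_nhds hzS)] with w hw
    exact h0 _ hw

lemma cutComp_chart (p : ι × Fin n) {z : Cn n} (hz : z ∈ (cv.e p.1).target) :
    cutComp h cv p ((cv.e p.1).symm z) = cv.η p.1 ((cv.e p.1).symm z) *
      cv.η p.1 ((cv.e p.1).symm z) * (h.coeff (cv.e p.1) z p.2 p.2).re := by
  rw [cutComp, comp, (cv.e p.1).right_inv hz]

lemma sm_cutComp (p : ι × Fin n) : Sm (n := n) (cutComp h cv p) := by
  refine sm_of_tsupport (cv.mem p.1) (isClosed_tsupport (cv.η p.1)) (cv.tsupport_subset p.1)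
    (fun x hx => by rw [cutComp, cv.eq_zero_of_notMem _ hx, zero_mul, zero_mul]) ?_
  have hη := cv.smooth p.1 _ (cv.mem p.1)
  refine ((hη.mul hη).mul (Complex.reCLM.contDiff.comp_contDiffOn
    (h.smooth _ (cv.mem p.1) p.2 p.2))).congr fun z hz => cutComp_chart p hz

lemma sm_cutTrace : Sm (n := n) (cutTrace h cv) := Sm.sum fun p _ => sm_cutComp p

/-- A zero of a nonnegative function is a minimum. This supplies the vanishing condition of
`qform_inv_sum_le` for the cut-off components. -/
lemma grad_eq_zero_of_min (hf : Sm (n := n) f) (hf0 : ∀ x, 0 ≤ f x) (he : e ∈ atlas (Cn n) M)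
    (hz : z ∈ e.target) (h0 : f (e.symm z) = 0) : grad e f z = 0 := by
  have hmin : IsLocalMin (fun w => f (e.symm w)) z :=
    Filter.Eventually.of_forall fun w => by
      show f (e.symm z) ≤ f (e.symm w)
      rw [h0]; exact hf0 _
  funext i
  have hd := hf.differentiableAt he hz
  rw [grad, show inChart e f = fun w => ((f (e.symm w) : ℝ) : ℂ) from rfl, cderiv,
    fderiv_ofReal hd, fderiv_ofReal hd, hmin.fderiv_eq_zero]
  simp

lemma laplacian_sum {κ : Type*} (t : Finset κ) {F : κ → M → ℝ}
    (hF : ∀ a ∈ t, Sm (n := n) (F a)) (x : M) :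
    h.laplacian (fun y => ∑ a ∈ t, F a y) x = ∑ a ∈ t, h.laplacian (F a) x := by
  simp only [KahlerMetric.laplacian_eq_lapE, lapE]
  have hx := mem_chart_target (Cn n) x
  have he := chart_mem_atlas (Cn n) x
  set e := chartAt (Cn n) x
  have h1 : hess e (fun y => ∑ a ∈ t, F a y) (e x) = ∑ a ∈ t, hess e (F a) (e x) := by
    ext i j
    rw [Matrix.sum_apply]
    simp only [hess_apply]
    rw [← cderiv_sum t fun a ha => (contDiffAt_cderiv (m := 1)
      (((hF a ha).inChart_contDiffAt he hx).of_le (by norm_cast))).differentiableAt (by simp)]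
    refine cderiv_congr ?_
    filter_upwards [e.open_target.mem_nhds hx] with w hw
    rw [← cderiv_sum t fun a ha => (hF a ha).inChart_differentiableAt he hw]
    congr 1
    funext w; simp [inChart]
  rw [h1, Matrix.mul_sum, trace_sum, Complex.re_sum]

lemma laplacian_eq_lapC (hf : Sm (n := n) f) (he : e ∈ atlas (Cn n) M) {x : M}
    (hx : x ∈ e.source) : h.laplacian f x = lapC (h.coeff e (e x)) (inChart e f) (e x) := by
  have h1 := laplacian_eq (g := h) hf he (e.map_source hx)
  rw [e.left_inv hx, lapE_eq_sum] at h1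
  exact h1

lemma pairM_self_eq (hf : Sm (n := n) f) (he : e ∈ atlas (Cn n) M) {x : M}
    (hx : x ∈ e.source) :
    h.pairM f f x = qform (h.coeff e (e x))⁻¹ (gradC (inChart e f) (e x)) := by
  have h1 := pairM_eq (g := h) hf hf he (e.map_source hx)
  rw [e.left_inv hx] at h1
  exact h1

lemma laplacian_eq_zero {S : Set M} (hS : IsClosed S) (h0 : ∀ x, x ∉ S → f x = 0) {x : M}
    (hx : x ∉ S) : h.laplacian f x = 0 := by
  have hxt := mem_chart_target (Cn n) x
  set e := chartAt (Cn n) x with he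
  have hev : inChart e f =ᶠ[nhds (e x)] fun _ => (0 : ℂ) := by
    have hx' : e.symm (e x) ∉ S := by rwa [e.left_inv (mem_chart_source _ x)]
    filter_upwards [(e.continuousAt_symm hxt).eventually (hS.isOpen_compl.mem_nhds hx')] with w hw
    simp [inChart, h0 _ hw]
  rw [KahlerMetric.laplacian_eq_lapE, lapE_eq_sum]
  have h1 : ∀ i j, cderiv (-Complex.I) i (cderiv Complex.I j (inChart e f)) (e x) = 0 :=
    fun i j => by
      rw [cderiv_congr (cderiv_congr' hev)]
      rw [show cderiv Complex.I j (fun _ : Cn n => (0 : ℂ)) = fun _ => 0 from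
        funext fun w => cderiv_const 0, cderiv_const]
  rw [← he]
  simp [h1]

/-- The second derivatives of the cut-off functions only contribute a multiple of
`tr_h g · tr_g h`. -/
lemma exists_cutComp_bound (g : KahlerMetric n M) (cv : Cover n M ι) :
    ∃ C, 1 ≤ C ∧ ∀ (h : KahlerMetric n M) (p : ι × Fin n) (x : M),
      cv.η p.1 x ^ 2 * flat p.2 (logDet h (cv.e p.1)) (cv.e p.1 x) -
          C * (h.trM g x * g.trM h x) ≤
        h.laplacian (cutComp h cv p) x -
          h.pairM (cutComp h cv p) (cutComp h cv p) x / cutComp h cv p x := by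
  obtain ⟨C₁, hC₁, hC₁'⟩ := exists_comp_le g cv
  obtain ⟨C₂, hC₂, hC₂'⟩ := exists_bound (cv := cv) (f := fun a z =>
      (g.coeff (cv.e a) z)⁻¹.trace.re * (2 * ∑ i, ∑ j, ‖hess (cv.e a) (cv.η a) z i j‖ +
        2 * nsq (grad (cv.e a) (cv.η a) z))) fun a =>
    (trace_re_continuousOn (coeff_inv_continuousOn (cv.mem a))).mul
      ((continuousOn_const.mul (continuousOn_finsetSum _ fun i _ => continuousOn_finsetSum _
        fun j _ => ((cv.smooth a).hess_contDiffOn (cv.mem a) i j).continuousOn.norm)).add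
      (continuousOn_const.mul (continuousOn_finsetSum _ fun i _ =>
        ((cv.smooth a).grad_contDiffOn (cv.mem a) i).continuousOn.norm.pow 2)))
  refine ⟨C₁ * C₂, one_le_mul_of_one_le_of_one_le hC₁ hC₂, fun h p x => ?_⟩
  have hτ := trM_nonneg (g := h) (h := g) x
  have hu := trM_nonneg (g := g) (h := h) x
  by_cases hx : x ∈ tsupport (cv.η p.1)
  · have hxs := cv.tsupport_subset _ hx
    have he := cv.mem p.1
    have hcp := comp_pos (h := h) hxs
    have hcl := hC₁' h p x hx
    have hb := (le_abs_self _).trans (hC₂' p.1 x hx)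
    have hz := (cv.e p.1).map_source hxs
    set e := cv.e p.1 with hedef
    have hA := coeff_posDef h he hxs
    have hG := coeff_posDef g he hxs
    -- All dependence on h of the error terms sits in the coordinate trace of h⁻¹, which is a
    -- multiple of τ = tr_h g, and in the component itself, which is a multiple of u = tr_g h.
    have htr := trace_inv_le hG hA
    rw [← trM_eq_of_mem h g he hxs] at htr
    have hs := sm_cutComp (h := h) (cv := cv) p
    have hηz : cv.η p.1 (e.symm (e x)) = cv.η p.1 x := by rw [e.left_inv hxs]
    have hev : inChart e (cutComp h cv p) =ᶠ[nhds (e x)] fun w =>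
        (((cv.η p.1 (e.symm w) * cv.η p.1 (e.symm w)) * (h.coeff e w p.2 p.2).re : ℝ) : ℂ) := by
      filter_upwards [e.open_target.mem_nhds hz] with w hw
      rw [inChart, cutComp_chart p hw]
    have key := lapC_sq_mul_sub (η := fun w => cv.η p.1 (e.symm w))
      (k := fun w => (h.coeff e w p.2 p.2).re) hA
      (((cv.smooth p.1).contDiffAt he hz).of_le (by norm_cast))
      ((Complex.reCLM.contDiff.contDiffAt.comp (e x) (coeff_contDiffAt he hz p.2 p.2)).of_le
        (by norm_cast)) hcp (flat_logDet_le he hz p.2)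
    rw [← lapC_congr hev, ← gradC_congr hev, ← laplacian_eq_lapC hs he hxs,
      ← pairM_self_eq hs he hxs] at key
    simp only [hηz] at key
    refine le_trans ?_ key
    change _ ≤ _ + comp h cv p x * _
    have hη1 := cv.le_one p.1 x
    have hη0 := cv.nonneg p.1 x
    have hlap := (abs_le.mp (abs_lapC_le hA (fun w => ((cv.η p.1 (e.symm w) : ℝ) : ℂ)) (e x))).1
    have hq := qform_inv_le_trace hA (gradC (fun w => ((cv.η p.1 (e.symm w) : ℝ) : ℂ)) (e x))
    set lη := lapC (h.coeff e (e x)) (fun w => ((cv.η p.1 (e.symm w) : ℝ) : ℂ)) (e x)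
    set qη := qform (h.coeff e (e x))⁻¹ (gradC (fun w => ((cv.η p.1 (e.symm w) : ℝ) : ℂ)) (e x))
    simp only [hess_apply] at hb
    change _ * (2 * ∑ i, ∑ j, ‖cderiv (-Complex.I) i (cderiv Complex.I j
      (fun w => ((cv.η p.1 (e.symm w) : ℝ) : ℂ))) (e x)‖ +
      2 * nsq (gradC (fun w => ((cv.η p.1 (e.symm w) : ℝ) : ℂ)) (e x))) ≤ C₂ at hb
    set S1 := ∑ i, ∑ j, ‖cderiv (-Complex.I) i (cderiv Complex.I j
      (fun w => ((cv.η p.1 (e.symm w) : ℝ) : ℂ))) (e x)‖ with hS1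
    set S2 := nsq (gradC (fun w => ((cv.η p.1 (e.symm w) : ℝ) : ℂ)) (e x))
    have hS1' : 0 ≤ S1 := Finset.sum_nonneg fun _ _ => Finset.sum_nonneg fun _ _ => norm_nonneg _
    have hS2' : 0 ≤ S2 := nsq_nonneg _
    have htA := trace_re_nonneg hA.inv.posSemidef
    have h1 : -((h.coeff e (e x))⁻¹.trace.re * S1) ≤ cv.η p.1 x * lη := by
      have : 0 ≤ (h.coeff e (e x))⁻¹.trace.re * S1 := mul_nonneg htA hS1'
      nlinarith
    have h2 : -((h.coeff e (e x))⁻¹.trace.re * (2 * S1 + 2 * S2)) ≤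
        2 * cv.η p.1 x * lη - 2 * qη := by nlinarith
    have h3 : (h.coeff e (e x))⁻¹.trace.re * (2 * S1 + 2 * S2) ≤ C₂ * h.trM g x := by
      have := mul_le_mul_of_nonneg_right htr (by positivity : 0 ≤ 2 * S1 + 2 * S2)
      nlinarith [mul_le_mul_of_nonneg_right hb hτ]
    have h4 : -(C₂ * h.trM g x) ≤ 2 * cv.η p.1 x * lη - 2 * qη := by linarith
    have h5 : comp h cv p x * (C₂ * h.trM g x) ≤ C₁ * g.trM h x * (C₂ * h.trM g x) :=
      mul_le_mul_of_nonneg_right hcl (by positivity)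
    nlinarith [mul_le_mul_of_nonneg_left h4 hcp.le]
  -- Off the support everything vanishes, the quotient being 0/0 = 0, and only the nonpositive error
  -- remains on the left.
  · have h0 : ∀ y, y ∉ tsupport (cv.η p.1) → cutComp h cv p y = 0 := fun y hy => by
      rw [cutComp, cv.eq_zero_of_notMem _ hy, zero_mul, zero_mul]
    rw [laplacian_eq_zero (isClosed_tsupport _) h0 hx, h0 x hx, cv.eq_zero_of_notMem _ hx]
    have : 0 ≤ C₁ * C₂ * (h.trM g x * g.trM h x) := by positivity
    simp only [div_zero]
    linarith

/-- The differential inequality for the logarithm of the cut-off trace. -/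
lemma exists_cutTrace_bound (g : KahlerMetric n M) (cv : Cover n M ι) :
    ∃ C, 1 ≤ C ∧ ∀ (h : KahlerMetric n M) (F : M → ℝ), Sm (n := n) F →
      (∀ e ∈ atlas (Cn n) M, ∀ z ∈ e.target, logDet h e z = F (e.symm z) + logDet g e z) →
      ∀ x, 0 < cutTrace h cv x → cutLap cv F x - C - C * (h.trM g x * g.trM h x) ≤
        h.laplacian (cutTrace h cv) x -
          h.pairM (cutTrace h cv) (cutTrace h cv) x / cutTrace h cv x := by
  obtain ⟨C, hC1, hC⟩ := exists_cutComp_bound g cv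
  have hld : ∀ a i, ContinuousOn (flat i (logDet g (cv.e a))) (cv.e a).target := fun a i =>
    Complex.continuous_re.comp_continuousOn (contDiffOn_cderiv (cv.e a).open_target
      (contDiffOn_cderiv (cv.e a).open_target (contDiffOn_ofReal fun z hz =>
        (logDet_contDiffAt (cv.mem a) hz).contDiffWithinAt))).continuousOn
  obtain ⟨D, hD1, hD⟩ := exists_bound (cv := cv)
    (f := fun a z => ∑ i, |flat i (logDet g (cv.e a)) z|) fun a =>
      continuousOn_finsetSum _ fun i _ => (hld a i).abs
  set N : ℝ := ((Fintype.card (ι × Fin n) : ℕ) : ℝ)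
  have hN : 0 ≤ N := Nat.cast_nonneg _
  refine ⟨1 + N * C + N * D, by nlinarith, fun h F hF hFe x hU => ?_⟩
  have hτ := trM_nonneg (g := h) (h := g) x
  have hu := trM_nonneg (g := g) (h := h) x
  have hx := mem_chart_target (Cn n) x
  have hxs := mem_chart_source (Cn n) x
  have hsm : ∀ p ∈ (Finset.univ : Finset (ι × Fin n)), Sm (n := n) (cutComp h cv p) :=
    fun p _ => sm_cutComp p
  have h1 : h.laplacian (cutTrace h cv) x = ∑ p, h.laplacian (cutComp h cv p) x :=
    laplacian_sum Finset.univ hsm x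
  have h2 : h.pairM (cutTrace h cv) (cutTrace h cv) x ≤ cutTrace h cv x *
      ∑ p, h.pairM (cutComp h cv p) (cutComp h cv p) x / cutComp h cv p x := by
    have hg := grad_sum (e := chartAt (Cn n) x) (z := chartAt (Cn n) x x) Finset.univ
      fun p hp => (hsm p hp).inChart_differentiableAt (chart_mem_atlas _ x) hx
    have := qform_inv_sum_le (coeff_posDef h (chart_mem_atlas _ x) hxs) Finset.univ
      (fun p => cutComp h cv p x)
      (fun p => grad (chartAt (Cn n) x) (cutComp h cv p) (chartAt (Cn n) x x))
      (fun p _ => cutComp_nonneg p x) fun p _ hp => grad_eq_zero_of_min (sm_cutComp p)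
        (cutComp_nonneg p) (chart_mem_atlas _ x) hx
        (by rwa [(chartAt (Cn n) x).left_inv hxs])
    rw [← hg] at this
    exact this
  have h3 : h.pairM (cutTrace h cv) (cutTrace h cv) x / cutTrace h cv x ≤
      ∑ p, h.pairM (cutComp h cv p) (cutComp h cv p) x / cutComp h cv p x :=
    (div_le_iff₀' hU).mpr h2
  have h4 : ∀ p : ι × Fin n,
      cv.η p.1 x ^ 2 * flat p.2 (fun w => F ((cv.e p.1).symm w)) (cv.e p.1 x) - D -
        C * (h.trM g x * g.trM h x) ≤ h.laplacian (cutComp h cv p) x -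
          h.pairM (cutComp h cv p) (cutComp h cv p) x / cutComp h cv p x := by
    intro p
    refine le_trans ?_ (hC h p x)
    refine sub_le_sub_right ?_ _
    by_cases hp : cv.η p.1 x = 0
    · rw [hp]; simp only [ne_eq, OfNat.ofNat_ne_zero, not_false_eq_true, zero_pow, zero_mul]
      linarith
    · have hps := cv.mem_source hp
      have hz := (cv.e p.1).map_source hps
      have he := cv.mem p.1
      -- The Monge-Ampère equation enters here: the Ricci term of h becomes a second derivative of F
      -- plus a term determined by g.
      have hfl : flat p.2 (logDet h (cv.e p.1)) (cv.e p.1 x) =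
          flat p.2 (fun w => F ((cv.e p.1).symm w)) (cv.e p.1 x) +
          flat p.2 (logDet g (cv.e p.1)) (cv.e p.1 x) := by
        have hev : (cderiv Complex.I p.2 fun w => (logDet h (cv.e p.1) w : ℂ))
            =ᶠ[nhds (cv.e p.1 x)] fun w =>
            cderiv Complex.I p.2 (fun w => ((F ((cv.e p.1).symm w) : ℝ) : ℂ)) w +
            cderiv Complex.I p.2 (fun w => (logDet g (cv.e p.1) w : ℂ)) w := by
          filter_upwards [(cv.e p.1).open_target.mem_nhds hz] with w hw
          refine Eq.trans (cderiv_congr ?_) (cderiv_add (hF.inChart_differentiableAt he hw)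
            ((contDiffAt_ofReal (logDet_contDiffAt he hw)).differentiableAt (by simp)))
          filter_upwards [(cv.e p.1).open_target.mem_nhds hw] with y hy
          rw [hFe _ he y hy, Complex.ofReal_add]
        rw [flat, cderiv_congr hev, cderiv_add, Complex.add_re]
        · rfl
        · exact (contDiffAt_cderiv (m := 1) ((hF.inChart_contDiffAt he hz).of_le
            (by norm_cast))).differentiableAt (by simp)
        · exact (contDiffAt_cderiv (m := 1) ((contDiffAt_ofReal
            (logDet_contDiffAt he hz)).of_le (by norm_cast))).differentiableAt (by simp)
      have h5 := (le_abs_self _).trans (hD p.1 x (subset_tsupport _ hp))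
      have h6 : |flat p.2 (logDet g (cv.e p.1)) (cv.e p.1 x)| ≤ D :=
        (Finset.single_le_sum (f := fun i => |flat i (logDet g (cv.e p.1)) (cv.e p.1 x)|)
          (fun _ _ => abs_nonneg _) (Finset.mem_univ p.2)).trans h5
      have h7 : cv.η p.1 x ^ 2 ≤ 1 := pow_le_one₀ (cv.nonneg _ _) (cv.le_one _ _)
      rw [hfl]
      nlinarith [neg_abs_le (flat p.2 (logDet g (cv.e p.1)) (cv.e p.1 x)),
        sq_nonneg (cv.η p.1 x)]
  have h5 := Finset.sum_le_sum fun p (_ : p ∈ (Finset.univ : Finset (ι × Fin n))) => h4 p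
  rw [Finset.sum_sub_distrib, Finset.sum_sub_distrib, Finset.sum_sub_distrib, Finset.sum_const,
    Finset.sum_const, Finset.card_univ, nsmul_eq_mul, nsmul_eq_mul, ← h1] at h5
  have h6 : 0 ≤ h.trM g x * g.trM h x := mul_nonneg hτ hu
  change cutLap cv F x - N * D - N * (C * (h.trM g x * g.trM h x)) ≤ _ at h5
  nlinarith [mul_nonneg hN (zero_le_one.trans hC1), mul_nonneg hN (zero_le_one.trans hD1),
    mul_nonneg (mul_nonneg hN (zero_le_one.trans hD1)) h6]

end CutTrace

/-! ### Integration by parts for the second derivatives of F -/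

section CutLap

open Matrix

variable {n : ℕ} {M : Type*} [TopologicalSpace M] [ChartedSpace (Cn n) M] [CompactSpace M]
  [IsManifold 𝓘(ℂ, Cn n) ω M] {ι : Type*} [Fintype ι] {cv : Cover n M ι}
  {g h : KahlerMetric n M} {e : OpenPartialHomeomorph M (Cn n)} {z : Cn n} {f : M → ℝ}

lemma gradNorm_sq (g : KahlerMetric n M) (f : M → ℝ) (x : M) :
    g.gradNorm f x ^ 2 = g.pairM f f x := by
  rw [g.gradNorm_eq, Real.sq_sqrt (pairM_self_nonneg f x)]

lemma gradNorm_nonneg (g : KahlerMetric n M) (f : M → ℝ) (x : M) : 0 ≤ g.gradNorm f x :=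
  Real.sqrt_nonneg _

lemma continuous_gradNorm (hf : Sm (n := n) f) : Continuous (g.gradNorm f) :=
  (Real.continuous_sqrt.comp (continuous_pairM (g := g) hf hf)).congr
    fun x => (g.gradNorm_eq f x).symm

lemma exists_nsq_grad_le (g : KahlerMetric n M) (cv : Cover n M ι) :
    ∃ C, 1 ≤ C ∧ ∀ (f : M → ℝ), Sm (n := n) f → ∀ a, ∀ x ∈ tsupport (cv.η a),
      nsq (grad (cv.e a) f (cv.e a x)) ≤ C * g.pairM f f x := by
  obtain ⟨C, hC1, hC⟩ := exists_trace_bound g cv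
  refine ⟨C, hC1, fun f hf a x hx => ?_⟩
  have hxs := cv.tsupport_subset _ hx
  have h1 := nsq_le_qform_inv (coeff_posDef g (cv.mem a) hxs) (grad (cv.e a) f (cv.e a x))
  have h2 : g.pairM f f x = qform (g.coeff (cv.e a) (cv.e a x))⁻¹ (grad (cv.e a) f (cv.e a x)) :=
    pairM_self_eq hf (cv.mem a) hxs
  rw [← h2] at h1
  exact h1.trans (mul_le_mul_of_nonneg_right (hC a x hx).1 (pairM_self_nonneg f x))

lemma exists_norm_grad_le (g : KahlerMetric n M) (cv : Cover n M ι) :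
    ∃ C, 1 ≤ C ∧ ∀ (f : M → ℝ), Sm (n := n) f → ∀ a, ∀ x ∈ tsupport (cv.η a), ∀ i,
      ‖grad (cv.e a) f (cv.e a x) i‖ ≤ C * g.gradNorm f x := by
  obtain ⟨C, hC1, hC⟩ := exists_nsq_grad_le g cv
  refine ⟨C, hC1, fun f hf a x hx i => ?_⟩
  have h1 := hC f hf a x hx
  have h2 : ‖grad (cv.e a) f (cv.e a x) i‖ ^ 2 ≤ nsq (grad (cv.e a) f (cv.e a x)) :=
    Finset.single_le_sum (f := fun i => ‖grad (cv.e a) f (cv.e a x) i‖ ^ 2)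
      (fun _ _ => sq_nonneg _) (Finset.mem_univ i)
  rw [← gradNorm_sq] at h1
  have h3 := gradNorm_nonneg g f x
  -- The same constant serves after taking the root, because C ≤ C² for C ≥ 1.
  refine abs_le_of_sq_le_sq' ?_ (by positivity) |>.2
  nlinarith [sq_nonneg (g.gradNorm f x)]

lemma sm_cutLap_term {F : M → ℝ} (hF : Sm (n := n) F) (p : ι × Fin n) :
    Sm (n := n) fun x =>
      cv.η p.1 x ^ 2 * flat p.2 (fun w => F ((cv.e p.1).symm w)) (cv.e p.1 x) := by
  refine sm_of_tsupport (cv.mem p.1) (isClosed_tsupport (cv.η p.1)) (cv.tsupport_subset p.1)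
    (fun x hx => by rw [cv.eq_zero_of_notMem _ hx]; ring) ?_
  have hη := cv.smooth p.1 _ (cv.mem p.1)
  refine ((hη.pow 2).mul (Complex.reCLM.contDiff.comp_contDiffOn
    (contDiffOn_cderiv (c := -Complex.I) (i := p.2) (cv.e p.1).open_target
      (contDiffOn_cderiv (c := Complex.I) (i := p.2) (cv.e p.1).open_target
        (hF.inChart_contDiffOn (cv.mem p.1)))))).congr fun z hz => ?_
  rw [(cv.e p.1).right_inv hz]
  rfl

/-- The derivative of `η² det (g) exp ω` in a chart. -/
lemma cderiv_weight {η d v : Cn n → ℝ} {i : Fin n} {c : ℂ} (hη : DifferentiableAt ℝ η z)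
    (hd : DifferentiableAt ℝ d z) (hv : DifferentiableAt ℝ v z) (hd0 : d z ≠ 0) :
    cderiv c i (fun w => ((η w * (η w * d w) * Real.exp (v w) : ℝ) : ℂ)) z =
      ((d z * (η z * Real.exp (v z)) : ℝ) : ℂ) * (2 * cderiv c i (fun w => (η w : ℂ)) z +
        η z * (cderiv c i (fun w => (d w : ℂ)) z / d z) +
        η z * cderiv c i (fun w => (v w : ℂ)) z) := by
  have hη' := differentiableAt_ofReal hη
  have hd' := differentiableAt_ofReal hd
  have hv' : DifferentiableAt ℝ (fun w => ((Real.exp (v w) : ℝ) : ℂ)) z :=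
    differentiableAt_ofReal hv.exp
  have h0 : (d z : ℂ) ≠ 0 := Complex.ofReal_ne_zero.mpr hd0
  simp only [Complex.ofReal_mul]
  rw [cderiv_mul (hη'.fun_mul (hη'.fun_mul hd')) hv', cderiv_mul hη' (hη'.fun_mul hd'),
    cderiv_mul hη' hd', cderiv_comp_real hv (Real.hasDerivAt_exp _)]
  field_simp
  ring

variable [MeasurableSpace M] [BorelSpace M]

lemma integral_cutVol_le_vol {G : M → ℝ} (hG : Continuous G) (h0 : ∀ x, 0 ≤ G x) (a : ι) :
    ∫ x, G x ∂(cutVol g cv a) ≤ ∫ x, G x ∂(vol g cv) := by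
  rw [vol, integral_finsetSum_measure fun a _ => integrable_vol hG]
  exact Finset.single_le_sum (f := fun a => ∫ x, G x ∂(cutVol g cv a))
    (fun _ _ => integral_nonneg h0) (Finset.mem_univ a)

/-- Integration by parts against the operator `∑ η² ∑ ∂²/∂zⁱ∂z̄ⁱ`. -/
lemma exists_integral_cutLap_le (g : KahlerMetric n M) (cv : Cover n M ι) :
    ∃ C, 1 ≤ C ∧ ∀ F v : M → ℝ, Sm (n := n) F → Sm (n := n) v →
      |∫ x, Real.exp (v x) * cutLap cv F x ∂(vol g cv)| ≤
        C * ∫ x, Real.exp (v x) * ((1 + g.gradNorm v x) * g.gradNorm F x) ∂(vol g cv) := by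
  obtain ⟨C₁, hC₁, hC₁'⟩ := exists_norm_grad_le g cv
  have hdc : ∀ a i, ContinuousOn (cderiv (-Complex.I) i
      (fun w => (((g.coeff (cv.e a) w).det.re : ℝ) : ℂ))) (cv.e a).target := fun a i =>
    (contDiffOn_cderiv (cv.e a).open_target (contDiffOn_ofReal fun z hz =>
      (Complex.reCLM.contDiff.contDiffAt.comp z
        (contDiffAt_det (coeff_contDiffAt (cv.mem a) hz))).contDiffWithinAt)).continuousOn
  obtain ⟨C₂, hC₂, hC₂'⟩ := exists_bound (cv := cv) (f := fun a z =>
      ∑ i, (2 * ‖grad (cv.e a) (cv.η a) z i‖ + ‖cderiv (-Complex.I) i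
        (fun w => (((g.coeff (cv.e a) w).det.re : ℝ) : ℂ)) z‖ / (g.coeff (cv.e a) z).det.re))
    fun a => continuousOn_finsetSum _ fun i _ => (continuousOn_const.mul
      ((cv.smooth a).grad_contDiffOn (cv.mem a) i).continuousOn.norm).add
        ((hdc a i).norm.div (det_re_continuousOn (cv.mem a))
          fun z hz => (det_re_pos (cv.mem a) hz).ne')
  set N : ℝ := ((Fintype.card (ι × Fin n) : ℕ) : ℝ)
  have hN : 0 ≤ N := Nat.cast_nonneg _
  refine ⟨1 + N * ((C₁ + C₂) * C₁), by
    have : 0 ≤ N * ((C₁ + C₂) * C₁) := by positivity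
    linarith, fun F v hF hv => ?_⟩
  set H : M → ℝ := fun x => Real.exp (v x) * ((1 + g.gradNorm v x) * g.gradNorm F x) with hH
  have hHc : Continuous H := (Real.continuous_exp.comp hv.continuous).mul
    ((continuous_const.add (continuous_gradNorm hv)).mul (continuous_gradNorm hF))
  have hH0 : ∀ x, 0 ≤ H x := fun x => mul_nonneg (Real.exp_pos _).le (mul_nonneg
    (add_nonneg zero_le_one (gradNorm_nonneg g v x)) (gradNorm_nonneg g F x))
  have key : ∀ p : ι × Fin n, |∫ x, Real.exp (v x) * (cv.η p.1 x ^ 2 *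
      flat p.2 (fun w => F ((cv.e p.1).symm w)) (cv.e p.1 x)) ∂(vol g cv)| ≤
      (C₁ + C₂) * C₁ * ∫ x, H x ∂(vol g cv) := by
    intro p
    have he := cv.mem p.1
    have hT := (cv.e p.1).open_target
    have hS := cv.isCompact_tsupport p.1
    have hSe := cv.tsupport_subset p.1
    obtain ⟨hK, hKT⟩ := isCompact_chart_image hS hSe
    have hC' := hC₁' F hF p.1
    have hCv := hC₁' v hv p.1
    have hC2 := hC₂' p.1
    have hηs := cv.smooth p.1 _ he
    have hη0 := cv.nonneg p.1
    have hη1 := cv.le_one p.1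
    have hη2 := fun x => cv.eq_zero_of_notMem p.1 (x := x)
    have hcut := integral_cutVol (g := g) (cv := cv) p.1 (hHc.const_mul ((C₁ + C₂) * C₁))
    have hgc := integrableOn_chart hS hSe (X := fun z => (g.coeff (cv.e p.1) z).det.re *
      (cv.η p.1 ((cv.e p.1).symm z) * ((C₁ + C₂) * C₁ * H ((cv.e p.1).symm z))))
      ((det_re_continuousOn he).mul (hηs.continuousOn.mul (continuousOn_const.mul
        (hHc.comp_continuousOn (cv.e p.1).continuousOn_symm)))) fun z _ hz => by
          rw [hη2 _ hz, zero_mul, mul_zero]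
    have hcc : Continuous fun x => Real.exp (v x) * (cv.η p.1 x ^ 2 *
        flat p.2 (fun w => F ((cv.e p.1).symm w)) (cv.e p.1 x)) :=
      (Real.continuous_exp.comp hv.continuous).mul (sm_cutLap_term hF p).continuous
    rw [integral_vol_chart he hcc hS hSe fun x hx => by rw [hη2 x hx]; ring]
    set e := cv.e p.1
    set η := cv.η p.1
    have hds : ContDiffOn ℝ ∞ (fun z => (g.coeff e z).det.re) e.target := fun z hz =>
      (Complex.reCLM.contDiff.contDiffAt.comp z
        (contDiffAt_det (coeff_contDiffAt he hz))).contDiffWithinAt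
    have hQs : ContDiffOn ℝ ∞ (fun z => η (e.symm z) * (η (e.symm z) * (g.coeff e z).det.re) *
        Real.exp (v (e.symm z))) e.target := (hηs.mul (hηs.mul hds)).mul (hv e he).exp
    have hQ0 : ∀ z ∈ e.target, z ∉ e '' tsupport η → η (e.symm z) *
        (η (e.symm z) * (g.coeff e z).det.re) * Real.exp (v (e.symm z)) = 0 := fun z hz hzK => by
      rw [vanishing_chart hη2 hz hzK]; ring
    have hibp := integral_mul_flat (i := p.2) hT hK hKT hQs (hF e he) (Or.inl hQ0)
    have h1 : ∫ z in e.target, (g.coeff e z).det.re * (Real.exp (v (e.symm z)) *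
        (η (e.symm z) ^ 2 * flat p.2 (fun w => F (e.symm w)) (e (e.symm z)))) =
        ∫ z in e.target, η (e.symm z) * (η (e.symm z) * (g.coeff e z).det.re) *
        Real.exp (v (e.symm z)) * (cderiv (-Complex.I) p.2 (cderiv Complex.I p.2
          fun w => (F (e.symm w) : ℂ)) z).re := by
      refine setIntegral_congr_fun hT.measurableSet fun z hz => ?_
      simp only [e.right_inv hz, flat]
      ring
    rw [h1, hibp, abs_neg, ← integral_const_mul, ← Real.norm_eq_abs]
    -- Differentiating η² leaves one factor η outside (`cderiv_weight`), so the bound is again an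
    -- integral against the cut-off measure, which lies below `vol`.
    refine le_trans ?_ (integral_cutVol_le_vol (cv := cv) (hHc.const_mul _)
      (fun x => mul_nonneg (by positivity) (hH0 x)) p.1)
    rw [hcut]
    refine norm_integral_le_of_norm_le hgc ((ae_restrict_iff' hT.measurableSet).mpr
      (Filter.Eventually.of_forall fun z hz => ?_))
    have hd := det_re_pos (g := g) he hz
    by_cases hzK : z ∈ e '' tsupport η
    · obtain ⟨x, hx, rfl⟩ := hzK
      have hxs := hSe hx
      rw [cderiv_weight ((hηs.contDiffAt (hT.mem_nhds hz)).differentiableAt (by simp))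
        ((hds.contDiffAt (hT.mem_nhds hz)).differentiableAt (by simp))
        (hv.differentiableAt he hz) hd.ne', Real.norm_eq_abs]
      refine (Complex.abs_re_le_norm _).trans ?_
      rw [norm_mul, norm_mul, Complex.norm_real, Real.norm_of_nonneg (mul_nonneg hd.le
        (mul_nonneg (hη0 _) (Real.exp_pos _).le))]
      have hFb : ‖cderiv Complex.I p.2 (fun w => (F (e.symm w) : ℂ)) (e x)‖ ≤
          C₁ * g.gradNorm F x := by
        rw [show (fun w => (F (e.symm w) : ℂ)) = inChart e F from rfl, grad_conj,
          RCLike.norm_conj]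
        exact hC' x hx p.2
      have hvb := hCv x hx p.2
      have h2 := (Finset.single_le_sum (f := fun i => 2 * ‖grad e η (e x) i‖ +
        ‖cderiv (-Complex.I) i (fun w => (((g.coeff e w).det.re : ℝ) : ℂ)) (e x)‖ /
          (g.coeff e (e x)).det.re) (fun i _ => by positivity) (Finset.mem_univ p.2)).trans
        ((le_abs_self _).trans (hC2 x hx))
      rw [e.left_inv hxs]
      have hn1 : ‖2 * cderiv (-Complex.I) p.2 (fun w => (η (e.symm w) : ℂ)) (e x) +
          η x * (cderiv (-Complex.I) p.2 (fun w => (((g.coeff e w).det.re : ℝ) : ℂ)) (e x) /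
            ((g.coeff e (e x)).det.re : ℂ)) +
          η x * cderiv (-Complex.I) p.2 (fun w => (v (e.symm w) : ℂ)) (e x)‖ ≤
          (C₁ + C₂) * (1 + g.gradNorm v x) := by
        have hgv := gradNorm_nonneg g v x
        have hηn : ‖(η x : ℂ)‖ ≤ 1 := by
          rw [Complex.norm_real, Real.norm_of_nonneg (hη0 x)]; exact hη1 x
        refine (norm_add₃_le ..).trans ?_
        rw [norm_mul, norm_mul, norm_mul, norm_div, Complex.norm_real (g.coeff e (e x)).det.re,
          Real.norm_of_nonneg hd.le, Complex.norm_ofNat]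
        change 2 * ‖grad e η (e x) p.2‖ + ‖(η x : ℂ)‖ * (_ / _) +
          ‖(η x : ℂ)‖ * ‖grad e v (e x) p.2‖ ≤ _
        have a1 := mul_le_of_le_one_left (norm_nonneg (grad e v (e x) p.2)) hηn
        have a2 := mul_le_of_le_one_left (div_nonneg (norm_nonneg (cderiv (-Complex.I) p.2
          (fun w => (((g.coeff e w).det.re : ℝ) : ℂ)) (e x))) hd.le) hηn
        nlinarith
      calc _ ≤ (g.coeff e (e x)).det.re * (η x * Real.exp (v x)) *
            ((C₁ + C₂) * (1 + g.gradNorm v x)) * (C₁ * g.gradNorm F x) :=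
            mul_le_mul (mul_le_mul_of_nonneg_left hn1 (mul_nonneg hd.le
              (mul_nonneg (hη0 _) (Real.exp_pos _).le))) hFb (norm_nonneg _)
              (mul_nonneg (mul_nonneg hd.le (mul_nonneg (hη0 _) (Real.exp_pos _).le))
                (mul_nonneg (by positivity) (add_nonneg zero_le_one (gradNorm_nonneg g v x))))
        _ = _ := by simp only [hH]; ring
    · have hQ0' : ∀ z ∈ e.target, z ∉ e '' tsupport η → ((η (e.symm z) *
          (η (e.symm z) * (g.coeff e z).det.re) * Real.exp (v (e.symm z)) : ℝ) : ℂ) = 0 :=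
        fun z hz hzK => by rw [hQ0 z hz hzK]; rfl
      rw [cderiv_eq_zero_of_vanishing hT hK hQ0' hz hzK, zero_mul, Complex.zero_re, norm_zero]
      exact mul_nonneg hd.le (mul_nonneg (hη0 _) (mul_nonneg (by positivity) (hH0 _)))
  have hsplit : ∫ x, Real.exp (v x) * cutLap cv F x ∂(vol g cv) =
      ∑ p : ι × Fin n, ∫ x, Real.exp (v x) * (cv.η p.1 x ^ 2 *
        flat p.2 (fun w => F ((cv.e p.1).symm w)) (cv.e p.1 x)) ∂(vol g cv) := by
    simp only [cutLap, Finset.mul_sum]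
    exact integral_finsetSum _ fun p _ => integrable_vol
      ((Real.continuous_exp.comp hv.continuous).mul (sm_cutLap_term hF p).continuous)
  rw [hsplit]
  have hI : 0 ≤ ∫ x, H x ∂(vol g cv) := integral_nonneg hH0
  calc _ ≤ ∑ p : ι × Fin n, (C₁ + C₂) * C₁ * ∫ x, H x ∂(vol g cv) :=
        (Finset.abs_sum_le_sum_abs _ _).trans (Finset.sum_le_sum fun p _ => key p)
    _ = N * ((C₁ + C₂) * C₁ * ∫ x, H x ∂(vol g cv)) := by
        rw [Finset.sum_const, Finset.card_univ, nsmul_eq_mul]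
    _ ≤ _ := by nlinarith

end CutLap

/-! ### The differential inequality for log U - lφ -/

section Energy

open Matrix

variable {n : ℕ} {M : Type*} [TopologicalSpace M] [ChartedSpace (Cn n) M] [CompactSpace M]
  [IsManifold 𝓘(ℂ, Cn n) ω M] {ι : Type*} [Fintype ι] {cv : Cover n M ι}
  {g h : KahlerMetric n M} {e : OpenPartialHomeomorph M (Cn n)} {z : Cn n} {f U φ F : M → ℝ}

lemma Sm.const_mul (a : ℝ) (hf : Sm (n := n) f) : Sm (n := n) (fun x => a * f x) :=
  (Sm.const a).mul hf

lemma hess_sub_const_mul (hf : Sm (n := n) f) (hφ : Sm (n := n) φ) (l : ℝ)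
    (he : e ∈ atlas (Cn n) M) (hz : z ∈ e.target) :
    hess e (fun x => f x - l * φ x) z = hess e f z - (l : ℂ) • hess e φ z := by
  ext i j
  rw [Matrix.sub_apply, Matrix.smul_apply, smul_eq_mul]
  simp only [hess_apply]
  have hd : ∀ {u : M → ℝ}, Sm (n := n) u → ∀ w ∈ e.target,
      DifferentiableAt ℝ (cderiv Complex.I j (inChart e u)) w := fun hu w hw =>
    (contDiffAt_cderiv (m := 1) ((hu.inChart_contDiffAt he hw).of_le
      (by norm_cast))).differentiableAt (by simp)
  have hev : cderiv Complex.I j (inChart e fun x => f x - l * φ x) =ᶠ[nhds z] fun w =>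
      cderiv Complex.I j (inChart e f) w - (l : ℂ) * cderiv Complex.I j (inChart e φ) w := by
    filter_upwards [e.open_target.mem_nhds hz] with w hw
    have h1 := hf.inChart_differentiableAt he hw
    have h2 := hφ.inChart_differentiableAt he hw
    rw [← cderiv_const_mul _ h2, ← cderiv_sub h1 (h2.const_mul _)]
    congr 1
    funext w; simp [inChart]
  rw [cderiv_congr hev, cderiv_sub (hd hf z hz) ((hd hφ z hz).const_mul _),
    cderiv_const_mul _ (hd hφ z hz)]

lemma laplacian_sub_const_mul (hf : Sm (n := n) f) (hφ : Sm (n := n) φ) (l : ℝ) (x : M) :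
    h.laplacian (fun x => f x - l * φ x) x = h.laplacian f x - l * h.laplacian φ x := by
  simp only [KahlerMetric.laplacian_eq_lapE, lapE]
  rw [hess_sub_const_mul hf hφ l (chart_mem_atlas _ x) (mem_chart_target _ x), Matrix.mul_sub,
    Matrix.mul_smul, trace_sub, trace_smul, Complex.sub_re, smul_eq_mul, Complex.re_ofReal_mul]

lemma hess_log (hU : Sm (n := n) U) (hU0 : ∀ x, 0 < U x) (he : e ∈ atlas (Cn n) M)
    (hz : z ∈ e.target) (i j : Fin n) :
    hess e (fun x => Real.log (U x)) z i j = ((U (e.symm z))⁻¹ : ℝ) * hess e U z i j -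
      (((U (e.symm z)) ^ 2)⁻¹ : ℝ) * ((starRingEnd ℂ) (grad e U z j) * grad e U z i) := by
  simp only [hess_apply]
  have hev : cderiv Complex.I j (inChart e fun x => Real.log (U x)) =ᶠ[nhds z] fun w =>
      (((U (e.symm w))⁻¹ : ℝ) : ℂ) * cderiv Complex.I j (inChart e U) w := by
    filter_upwards [e.open_target.mem_nhds hz] with w hw
    exact cderiv_comp_real (hU.differentiableAt he hw) (Real.hasDerivAt_log (hU0 _).ne')
  have hd1 : DifferentiableAt ℝ (fun w => (((U (e.symm w))⁻¹ : ℝ) : ℂ)) z :=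
    differentiableAt_ofReal ((hU.differentiableAt he hz).inv (hU0 _).ne')
  have hd2 : DifferentiableAt ℝ (cderiv Complex.I j (inChart e U)) z :=
    (contDiffAt_cderiv (m := 1) ((hU.inChart_contDiffAt he hz).of_le
      (by norm_cast))).differentiableAt (by simp)
  rw [cderiv_congr hev, cderiv_mul hd1 hd2,
    cderiv_comp_real (hU.differentiableAt he hz) (hasDerivAt_inv (hU0 _).ne'), grad_conj]
  rw [show (fun w => ((U (e.symm w) : ℝ) : ℂ)) = inChart e U from rfl]
  simp only [grad, Complex.ofReal_neg]
  ring

lemma laplacian_log (hU : Sm (n := n) U) (hU0 : ∀ x, 0 < U x) (x : M) :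
    h.laplacian (fun x => Real.log (U x)) x =
      h.laplacian U x / U x - h.pairM U U x / U x ^ 2 := by
  have he := chart_mem_atlas (Cn n) x
  have hx := mem_chart_target (Cn n) x
  have hs := (chartAt (Cn n) x).left_inv (mem_chart_source (Cn n) x)
  simp only [KahlerMetric.laplacian_eq_lapE, lapE, KahlerMetric.pairM, pairE]
  set e := chartAt (Cn n) x
  have h1 : hess e (fun x => Real.log (U x)) (e x) = (((U x)⁻¹ : ℝ) : ℂ) • hess e U (e x) -
      (((U x ^ 2)⁻¹ : ℝ) : ℂ) • vecMulVec (grad e U (e x)) (star (grad e U (e x))) := by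
    ext i j
    rw [hess_log hU hU0 he hx, hs]
    simp only [Matrix.sub_apply, Matrix.smul_apply, smul_eq_mul, vecMulVec_apply, Pi.star_apply,
      Complex.star_def]
    ring
  rw [h1, Matrix.mul_sub, Matrix.mul_smul, Matrix.mul_smul, trace_sub, trace_smul, trace_smul,
    Complex.sub_re, smul_eq_mul, smul_eq_mul, Complex.re_ofReal_mul, Complex.re_ofReal_mul,
    mul_vecMulVec, trace_vecMulVec, dotProduct_comm]
  ring

/-- Here ∂∂̄φ = h - g and tr_h h = n. Subtracting lφ from the logarithm thus produces the good term
lτ. -/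
lemma laplacian_potential
    (hh : ∀ e ∈ atlas (Cn n) M, ∀ z ∈ e.target, h.coeff e z = g.coeff e z + hess e φ z) (x : M) :
    h.laplacian φ x = n - h.trM g x := by
  have he := chart_mem_atlas (Cn n) x
  have hx := mem_chart_target (Cn n) x
  rw [KahlerMetric.laplacian_eq_lapE, lapE, KahlerMetric.trM, trE,
    eq_sub_of_add_eq' (hh _ he _ hx).symm, Matrix.mul_sub, trace_sub, Complex.sub_re,
    nonsing_inv_mul _ (isUnit_det he hx), trace_one, Fintype.card_fin, Complex.natCast_re]

lemma trM_potential
    (hh : ∀ e ∈ atlas (Cn n) M, ∀ z ∈ e.target, h.coeff e z = g.coeff e z + hess e φ z) (x : M) :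
    g.trM h x = n + g.laplacian φ x := by
  have he := chart_mem_atlas (Cn n) x
  have hx := mem_chart_target (Cn n) x
  rw [KahlerMetric.laplacian_eq_lapE, lapE, KahlerMetric.trM, trE, hh _ he _ hx, Matrix.mul_add,
    trace_add, Complex.add_re, nonsing_inv_mul _ (isUnit_det he hx), trace_one, Fintype.card_fin,
    Complex.natCast_re]

lemma trM_pos (hn : 1 ≤ n) (x : M) : 0 < g.trM h x := by
  have : Nonempty (Fin n) := ⟨⟨0, hn⟩⟩
  exact trace_inv_mul_pos (g.posDef _ (chart_mem_atlas _ x) _ (mem_chart_target _ x))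
    (h.posDef _ (chart_mem_atlas _ x) _ (mem_chart_target _ x))

lemma pairM_exp (hf : Sm (n := n) f) (p : ℝ) (x : M) :
    g.pairM f (fun y => Real.exp (p * f y)) x = p * Real.exp (p * f x) * g.pairM f f x := by
  have he := chart_mem_atlas (Cn n) x
  have hx := mem_chart_target (Cn n) x
  have hs := (chartAt (Cn n) x).left_inv (mem_chart_source (Cn n) x)
  refine pairE_smul_right ?_
  rw [grad_comp (θ := fun t => Real.exp (p * t)) (θ' := p * Real.exp (p * f x))
    (hf.differentiableAt he hx)]
  rw [hs]
  have := ((hasDerivAt_id (f x)).const_mul p).exp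
  simp only [id, mul_one] at this
  rwa [mul_comm]

lemma grad_const_mul (l : ℝ) (hf : DifferentiableAt ℝ (inChart e f) z) :
    grad e (fun x => l * f x) z = (l : ℂ) • grad e f z := by
  funext i
  rw [Pi.smul_apply, smul_eq_mul, grad, grad, ← cderiv_const_mul _ hf]
  congr 1
  funext w; simp [inChart]

/-- Cauchy-Schwarz for three summands with unit weights, whence the factor 3. -/
lemma gradNorm_sq_add_le (hf : Sm (n := n) f) (hF : Sm (n := n) F) (hφ : Sm (n := n) φ)
    (a b : ℝ) (x : M) :
    g.gradNorm (fun y => a * f y + (F y + b * φ y)) x ^ 2 ≤ 3 * (a ^ 2 * g.gradNorm f x ^ 2 +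
      (g.gradNorm F x ^ 2 + b ^ 2 * g.gradNorm φ x ^ 2)) := by
  have he := chart_mem_atlas (Cn n) x
  have hx := mem_chart_target (Cn n) x
  have hG := g.posDef _ he _ hx
  have hf' := hf.inChart_differentiableAt he hx
  have hF' := hF.inChart_differentiableAt he hx
  have hφ' := hφ.inChart_differentiableAt he hx
  have hbφ := (hφ.const_mul b).inChart_differentiableAt he hx
  simp only [gradNorm_sq, KahlerMetric.pairM, pairE_self]
  have h1 := grad_add ((hf.const_mul a).inChart_differentiableAt he hx)
    ((hF.add (hφ.const_mul b)).inChart_differentiableAt he hx)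
  rw [grad_add hF' hbφ, grad_const_mul a hf', grad_const_mul b hφ'] at h1
  rw [h1]
  set G := g.coeff (chartAt (Cn n) x) (chartAt (Cn n) x x)
  set v := grad (chartAt (Cn n) x) f (chartAt (Cn n) x x)
  set w := grad (chartAt (Cn n) x) F (chartAt (Cn n) x x)
  set y := grad (chartAt (Cn n) x) φ (chartAt (Cn n) x x)
  have h2 := qform_inv_sum_le hG (Finset.univ : Finset (Fin 3)) (fun _ => 1)
    ![(a : ℂ) • v, w, (b : ℂ) • y] (fun _ _ => zero_le_one) (fun _ _ h => absurd h one_ne_zero)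
  simp only [Fin.sum_univ_three, Matrix.cons_val_zero, Matrix.cons_val_one, Matrix.cons_val,
    div_one, qform_smul] at h2
  rw [add_assoc] at h2
  linarith

/-- The volume ratio of two metrics whose volume densities differ by `exp F`. -/
lemma det_eq_exp_mul
    (hFe : ∀ e ∈ atlas (Cn n) M, ∀ z ∈ e.target, logDet h e z = F (e.symm z) + logDet g e z)
    (he : e ∈ atlas (Cn n) M) (hz : z ∈ e.target) :
    (h.coeff e z).det.re = Real.exp (F (e.symm z)) * (g.coeff e z).det.re := by
  have h1 := hFe e he z hz
  rw [← Real.exp_log (det_re_pos (g := h) he hz), ← Real.exp_log (det_re_pos (g := g) he hz),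
    ← Real.exp_add]
  exact congrArg Real.exp h1

lemma trM_le_exp_mul_pow
    (hFe : ∀ e ∈ atlas (Cn n) M, ∀ z ∈ e.target, logDet h e z = F (e.symm z) + logDet g e z)
    (x : M) : g.trM h x ≤ n * (Real.exp (F x) * h.trM g x ^ (n - 1)) := by
  have he := chart_mem_atlas (Cn n) x
  have hx := mem_chart_target (Cn n) x
  have h1 := trace_le_det_mul_trace_pow (g.posDef _ he _ hx) (h.posDef _ he _ hx)
  have h2 := det_eq_exp_mul hFe he hx
  rw [(chartAt (Cn n) x).left_inv (mem_chart_source _ x)] at h2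
  rw [← det_coe (g := h) he hx, ← det_coe (g := g) he hx, ← Complex.ofReal_div, Complex.ofReal_re,
    h2, mul_div_cancel_right₀ _ (det_re_pos he hx).ne', Fintype.card_fin] at h1
  exact h1

/-- The pointwise differential inequality for the logarithm of the cut-off trace. -/
lemma exists_laplacian_bound (hn : 1 ≤ n) (g : KahlerMetric n M) (cv : Cover n M ι) :
    ∃ l, 1 ≤ l ∧ ∀ K : ℝ, ∃ C, 1 ≤ C ∧ ∀ (h : KahlerMetric n M) (φ F : M → ℝ), Sm (n := n) φ →
      Sm (n := n) F →
      (∀ e ∈ atlas (Cn n) M, ∀ z ∈ e.target, h.coeff e z = g.coeff e z + hess e φ z) →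
      (∀ e ∈ atlas (Cn n) M, ∀ z ∈ e.target, logDet h e z = F (e.symm z) + logDet g e z) →
      (∀ x, F x ≤ K) → (∀ x, 0 < cutTrace h cv x) →
      ∀ x, (cutLap cv F x - C) / cutTrace h cv x ≤
        h.laplacian (fun y => Real.log (cutTrace h cv y) - l * φ y) x := by
  obtain ⟨C₁, hC₁, hC₁'⟩ := exists_cutTrace_bound g cv
  obtain ⟨C₂, hC₂, hC₂'⟩ := exists_trM_le g cv
  obtain ⟨C₃, hC₃, hC₃'⟩ := exists_cutTrace_le g cv
  -- The part C₁ C₂ absorbs the error C₁ τu/U, and the extra 1 leaves a full τ to be used against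
  -- the constant ln. This l is fixed before K, so it does not depend on the bound of F.
  set l := C₁ * C₂ + 1 with hl
  have hl1 : 1 ≤ l := by nlinarith
  refine ⟨l, hl1, fun K => ?_⟩
  have hpos : 0 ≤ l * n * (C₃ * (n * (Real.exp K * (l * n) ^ (n - 1)))) := by positivity
  refine ⟨C₁ + l * n * (C₃ * (n * (Real.exp K * (l * n) ^ (n - 1)))), by linarith,
    fun h φ F hφ hF hh hFe hK hU x => ?_⟩
  have hUx := hU x
  have hτ := trM_nonneg (g := h) (h := g) x
  have hu := trM_nonneg (g := g) (h := h) x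
  rw [laplacian_sub_const_mul (sm_cutTrace.log fun y => (hU y).ne') hφ,
    laplacian_log sm_cutTrace hU, laplacian_potential hh]
  have h1 := hC₁' h F hF hFe x hUx
  have h2 := hC₂' h x
  have h3 := hC₃' h x
  have h4 := trM_le_exp_mul_pow hFe x
  set U := cutTrace h cv x
  set τ := h.trM g x
  set u := g.trM h x
  have h5 : (cutLap cv F x - C₁ - C₁ * (τ * u)) / U ≤
      h.laplacian (cutTrace h cv) x / U -
        h.pairM (cutTrace h cv) (cutTrace h cv) x / U ^ 2 := by
    rw [pow_two, ← div_div, ← sub_div]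
    exact div_le_div_of_nonneg_right h1 hUx.le
  have h6 : C₁ * (τ * u) / U ≤ C₁ * C₂ * τ := by
    rw [div_le_iff₀ hUx]
    calc C₁ * (τ * u) ≤ C₁ * (τ * (C₂ * U)) := by gcongr
      _ = _ := by ring
  -- If τ ≥ ln the left side is nonpositive. Otherwise τ, hence u by the determinant, hence U is
  -- bounded, and a constant is a multiple of 1/U.
  have h7 : l * n - τ ≤ l * n * (C₃ * (n * (Real.exp K * (l * n) ^ (n - 1)))) / U := by
    rcases le_total (l * n) τ with hc | hc
    · exact (sub_nonpos.mpr hc).trans (div_nonneg hpos hUx.le)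
    · have h8 : U ≤ C₃ * (n * (Real.exp K * (l * n) ^ (n - 1))) := by
        refine h3.trans (mul_le_mul_of_nonneg_left (h4.trans ?_) (by linarith))
        gcongr
        exact hK x
      have h9 : 1 ≤ (C₃ * (n * (Real.exp K * (l * n) ^ (n - 1)))) / U := (one_le_div hUx).mpr h8
      rw [mul_div_assoc]
      have : 0 ≤ l * n := by positivity
      nlinarith
  rw [sub_div, sub_div] at h5
  rw [← sub_sub, sub_div, sub_div]
  nlinarith

variable [MeasurableSpace M] [BorelSpace M]

lemma integral_vol_eq_exp {G : M → ℝ} (hG : Continuous G) (hF : Continuous F)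
    (hFe : ∀ e ∈ atlas (Cn n) M, ∀ z ∈ e.target, logDet h e z = F (e.symm z) + logDet g e z) :
    ∫ x, G x ∂(vol h cv) = ∫ x, Real.exp (F x) * G x ∂(vol g cv) := by
  have hc : Continuous fun x => Real.exp (F x) * G x := (Real.continuous_exp.comp hF).mul hG
  rw [integral_vol hG, integral_vol hc]
  refine Finset.sum_congr rfl fun a _ => ?_
  refine setIntegral_congr_fun (cv.e a).open_target.measurableSet fun z hz => ?_
  simp only [det_eq_exp_mul hFe (cv.mem a) hz]
  ring

end Energy

/-! ### The energy estimate -/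

section EnergyBound

open Matrix

variable {n : ℕ} {M : Type*} [TopologicalSpace M] [ChartedSpace (Cn n) M] [CompactSpace M]
  [IsManifold 𝓘(ℂ, Cn n) ω M] {ι : Type*} [Fintype ι] {cv : Cover n M ι}
  {g h : KahlerMetric n M} {f U φ F : M → ℝ}

/-- Young's inequality for X·Y with weight 3cdp. This weight makes the coefficient of Z² equal to
p/(2d), half of the good term p/d of the energy estimate, while the remaining coefficient is still
linear in p. -/
lemma weighted_young {c d p q X Y Z L : ℝ} (hc : 1 ≤ c) (hd : 1 ≤ d) (hp : 1 ≤ p) (hq : 0 ≤ q)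
    (hqp : q ≤ p) (hL : 0 ≤ L) (hX : X ^ 2 ≤ 3 * (q ^ 2 * Z ^ 2 + (Y ^ 2 + L))) :
    c * ((1 + X) * Y) ≤ p / (2 * d) * Z ^ 2 + p * (c * (1 + L + 3 * (c * d))) * (1 + Y ^ 2) := by
  set t := 3 * (c * d) with ht
  have hcd : 1 ≤ c * d := one_le_mul_of_one_le_of_one_le hc hd
  have htp : 0 < t * p := by positivity
  have hqZ : q ^ 2 * Z ^ 2 ≤ p ^ 2 * Z ^ 2 := by gcongr
  have h1 : X * Y ≤ (3 * (p ^ 2 * Z ^ 2 + (Y ^ 2 + L)) + (t * p) ^ 2 * Y ^ 2) / (2 * (t * p)) := by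
    rw [le_div_iff₀ (by positivity)]
    nlinarith [sq_nonneg (X - t * p * Y)]
  have h2 : (3 * (p ^ 2 * Z ^ 2 + (Y ^ 2 + L)) + (t * p) ^ 2 * Y ^ 2) / (2 * (t * p)) =
      p / (2 * (c * d)) * Z ^ 2 + (Y ^ 2 + L) * (3 / (2 * (t * p))) + t * p * Y ^ 2 / 2 := by
    rw [ht]; field_simp
  have h3 : 3 / (2 * (t * p)) ≤ 1 / 2 := by
    rw [div_le_div_iff₀ (by positivity) (by norm_num), ht]
    nlinarith
  have h4 : (Y ^ 2 + L) * (3 / (2 * (t * p))) ≤ (Y ^ 2 + L) * (1 / 2) :=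
    mul_le_mul_of_nonneg_left h3 (by positivity)
  have h5 : X * Y ≤ p / (2 * (c * d)) * Z ^ 2 + (Y ^ 2 + L) / 2 + t * p * Y ^ 2 / 2 := by
    linarith
  have h6 : c * (p / (2 * (c * d)) * Z ^ 2) = p / (2 * d) * Z ^ 2 := by field_simp
  have h7 := mul_le_mul_of_nonneg_left h5 (zero_le_one.trans hc)
  have ht0 : 0 ≤ t := by positivity
  have h8 : Y + ((Y ^ 2 + L) / 2 + t * p * Y ^ 2 / 2) ≤ p * (1 + L + t) * (1 + Y ^ 2) := by
    have a1 : 1 + L + t ≤ p * (1 + L + t) := le_mul_of_one_le_left (by positivity) hp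
    have a2 : t * p * Y ^ 2 + (1 + L) * (1 + Y ^ 2) ≤ p * (1 + L + t) * (1 + Y ^ 2) := by
      have : (1 + L) * (1 + Y ^ 2) ≤ p * ((1 + L) * (1 + Y ^ 2)) :=
        le_mul_of_one_le_left (by positivity) hp
      nlinarith [mul_nonneg ht0 (zero_le_one.trans hp)]
    nlinarith [sq_nonneg (Y - 1), mul_nonneg hL (sq_nonneg Y),
      mul_nonneg (mul_nonneg ht0 (zero_le_one.trans hp)) (sq_nonneg Y)]
  have h9 := mul_le_mul_of_nonneg_left h8 (zero_le_one.trans hc)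
  nlinarith

/-- The comparison of `exists_trM_le` with h itself as background metric, since tr_h h > 0. -/
lemma cutTrace_pos (hn : 1 ≤ n) (h : KahlerMetric n M) (cv : Cover n M ι) (x : M) :
    0 < cutTrace h cv x := by
  obtain ⟨C, hC1, hC⟩ := exists_trM_le h cv
  have h1 := trM_pos (g := h) (h := h) hn x
  exact pos_of_mul_pos_right (h1.trans_le (hC h x)) (by linarith)

variable [MeasurableSpace M] [BorelSpace M]

lemma integral_mono_vol {G H : M → ℝ} {μ : Measure M} [IsFiniteMeasure μ] (hG : Continuous G)
    (hH : Continuous H) (hGH : ∀ x, G x ≤ H x) : ∫ x, G x ∂μ ≤ ∫ x, H x ∂μ :=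
  integral_mono (integrable_vol hG) (integrable_vol hH) hGH

/-- The reverse Poincaré inequality for powers of `exp (log U - l φ)`, where `U` is the cut-off
trace. -/
theorem exists_energy_bound (hn : 1 ≤ n) (g : KahlerMetric n M) (cv : Cover n M ι) :
    ∃ l, 1 ≤ l ∧ ∀ A B K : ℝ, ∃ C, ∀ (h : KahlerMetric n M) (φ F : M → ℝ), Sm (n := n) φ →
      Sm (n := n) F →
      (∀ e ∈ atlas (Cn n) M, ∀ z ∈ e.target, h.coeff e z = g.coeff e z + hess e φ z) →
      (∀ e ∈ atlas (Cn n) M, ∀ z ∈ e.target, logDet h e z = F (e.symm z) + logDet g e z) →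
      (∀ x, |φ x| ≤ A) → (∀ x, g.gradNorm φ x ≤ B) → (∀ x, |F x| ≤ K) → ∀ s, 0 ≤ s →
      ∫ x, Real.exp (2 * s * (Real.log (cutTrace h cv x) - l * φ x)) *
        g.gradNorm (fun y => Real.log (cutTrace h cv y) - l * φ y) x ^ 2 ∂(vol g cv) ≤
      C * ∫ x, Real.exp (2 * s * (Real.log (cutTrace h cv x) - l * φ x)) *
        (1 + g.gradNorm F x ^ 2) ∂(vol g cv) := by
  obtain ⟨l, hl1, hl⟩ := exists_laplacian_bound hn g cv
  obtain ⟨C₂, hC₂, hC₂'⟩ := exists_trM_le g cv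
  obtain ⟨C₄, hC₄, hC₄'⟩ := exists_integral_cutLap_le g cv
  refine ⟨l, hl1, fun A B K => ?_⟩
  obtain ⟨C₁, hC₁, hC₁'⟩ := hl K
  set L := l ^ 2 * B ^ 2 with hL
  have hL0 : 0 ≤ L := by positivity
  set C₅ := C₁ + C₄ * (1 + L + 3 * (C₄ * C₂)) with hC₅
  set R := K + l * A with hR
  refine ⟨Real.exp R * (2 * C₂ * C₅) * Real.exp R, fun h φ F hφ hF hh hFe hA hB hK s hs => ?_⟩
  have hU := cutTrace_pos hn h cv
  have hUs : Sm (n := n) (cutTrace h cv) := sm_cutTrace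
  set f : M → ℝ := fun x => Real.log (cutTrace h cv x) - l * φ x with hf
  have hfs : Sm (n := n) f := (hUs.log fun x => (hU x).ne').sub (hφ.const_mul l)
  -- The exponent exceeds 2s by one so that the volume factor times the test function is e^v U: this
  -- U cancels the denominator of the differential inequality.
  set p := 1 + 2 * s with hp
  have hp1 : 1 ≤ p := by linarith
  -- The new weight e^v differs from e^{2sf} only by the factor e^{F - lφ}, which is bounded above
  -- and below.
  set v : M → ℝ := fun x => 2 * s * f x + (F x + (-l) * φ x) with hv
  have hvs : Sm (n := n) v := (hfs.const_mul (2 * s)).add (hF.add (hφ.const_mul (-l)))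
  have hψs : Sm (n := n) fun x => Real.exp (p * f x) := (hfs.const_mul p).exp
  have hlap : Continuous (h.laplacian f) := continuous_laplacian hfs
  have hE : Continuous (h.pairM f f) := continuous_pairM hfs hfs
  have hgf : Continuous (g.gradNorm f) := continuous_gradNorm hfs
  have hgF : Continuous (g.gradNorm F) := continuous_gradNorm hF
  have hgv : Continuous (g.gradNorm v) := continuous_gradNorm hvs
  have hFc := hF.continuous
  have hvc := hvs.continuous
  have hfc := hfs.continuous
  have hψc : Continuous fun x => Real.exp (p * f x) := hψs.continuous
  have hUc := hUs.continuous
  have hcl : Continuous (cutLap cv F) := continuous_finsetSum _ fun q _ =>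
    (sm_cutLap_term hF q).continuous
  have hfac : ∀ x, Real.exp (F x) * Real.exp (p * f x) = Real.exp (v x) * cutTrace h cv x := by
    intro x
    rw [← Real.exp_log (hU x), ← Real.exp_add, ← Real.exp_add]
    congr 1
    simp only [hv, hp, hf]; ring
  have green := integral_mul_laplacian (g := h) (cv := cv) hfs hψs
  have hψl : Continuous fun x => Real.exp (p * f x) * h.laplacian f x := hψc.mul hlap
  rw [integral_vol_eq_exp hψl hFc hFe,
    integral_vol_eq_exp (continuous_pairM hfs hψs) hFc hFe] at green
  have h1 : ∫ x, Real.exp (v x) * (cutLap cv F x - C₁) ∂(vol g cv) ≤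
      ∫ x, Real.exp (F x) * (Real.exp (p * f x) * h.laplacian f x) ∂(vol g cv) := by
    refine integral_mono_vol (by fun_prop) (by fun_prop) fun x => ?_
    have h2 := hC₁' h φ F hφ hF hh hFe (fun y => (le_abs_self _).trans (hK y)) hU x
    rw [← mul_assoc, hfac, mul_assoc]
    refine mul_le_mul_of_nonneg_left ?_ (Real.exp_pos _).le
    exact (div_le_iff₀' (hU x)).mp h2
  have h2 : p / C₂ * ∫ x, Real.exp (v x) * g.gradNorm f x ^ 2 ∂(vol g cv) ≤
      ∫ x, Real.exp (F x) * h.pairM f (fun y => Real.exp (p * f y)) x ∂(vol g cv) := by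
    rw [← integral_const_mul]
    refine integral_mono_vol (by fun_prop)
      ((Real.continuous_exp.comp hFc).mul (continuous_pairM hfs hψs)) fun x => ?_
    rw [pairM_exp hfs]
    -- The second use of the factor U: |∇f|²_g ≤ u |∇f|²_h ≤ C₂ U |∇f|²_h trades the unknown metric
    -- for g.
    have h3 : g.gradNorm f x ^ 2 ≤ C₂ * (cutTrace h cv x * h.pairM f f x) := by
      have h4 := qform_inv_le (g.posDef _ (chart_mem_atlas _ x) _ (mem_chart_target _ x))
        (h.posDef _ (chart_mem_atlas _ x) _ (mem_chart_target _ x))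
        (grad (chartAt (Cn n) x) f (chartAt (Cn n) x x))
      rw [gradNorm_sq]
      have h5 : g.pairM f f x ≤ g.trM h x * h.pairM f f x := h4
      refine h5.trans ?_
      rw [← mul_assoc]
      exact mul_le_mul_of_nonneg_right (hC₂' h x) (pairM_self_nonneg f x)
    have h6 : Real.exp (F x) * (p * Real.exp (p * f x) * h.pairM f f x) =
        p * (Real.exp (v x) * (cutTrace h cv x * h.pairM f f x)) := by
      rw [← mul_assoc (Real.exp (v x)), ← hfac]; ring
    rw [h6, div_mul_eq_mul_div, mul_div_assoc]
    refine mul_le_mul_of_nonneg_left ?_ (by linarith)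
    rw [div_le_iff₀' (by linarith)]
    calc _ ≤ Real.exp (v x) * (C₂ * (cutTrace h cv x * h.pairM f f x)) :=
          mul_le_mul_of_nonneg_left h3 (Real.exp_pos _).le
      _ = _ := by ring
  have h3 := (abs_le.mp (hC₄' F v hF hvs)).1
  have h4 : ∫ x, Real.exp (v x) * (cutLap cv F x - C₁) ∂(vol g cv) =
      ∫ x, Real.exp (v x) * cutLap cv F x ∂(vol g cv) -
        C₁ * ∫ x, Real.exp (v x) ∂(vol g cv) := by
    rw [← integral_const_mul, ← integral_sub (integrable_vol (by fun_prop))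
      (integrable_vol (by fun_prop))]
    congr 1
    funext x; ring
  set I₁ := ∫ x, Real.exp (v x) * g.gradNorm f x ^ 2 ∂(vol g cv) with hI₁
  set I₂ := ∫ x, Real.exp (v x) * (1 + g.gradNorm F x ^ 2) ∂(vol g cv) with hI₂
  have h5 : C₄ * ∫ x, Real.exp (v x) * ((1 + g.gradNorm v x) * g.gradNorm F x) ∂(vol g cv) ≤
      p / (2 * C₂) * I₁ + p * (C₄ * (1 + L + 3 * (C₄ * C₂))) * I₂ := by
    rw [hI₁, hI₂, ← integral_const_mul, ← integral_const_mul, ← integral_const_mul,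
      ← integral_add (integrable_vol (by fun_prop)) (integrable_vol (by fun_prop))]
    refine integral_mono_vol (by fun_prop) (by fun_prop) fun x => ?_
    have h6 := gradNorm_sq_add_le (g := g) hfs hF hφ (2 * s) (-l) x
    have h7 : (-l) ^ 2 * g.gradNorm φ x ^ 2 ≤ L := by
      rw [hL, neg_sq]
      have := gradNorm_nonneg g φ x
      gcongr
      exact hB x
    have h8 := weighted_young (X := g.gradNorm v x) (Y := g.gradNorm F x) (Z := g.gradNorm f x)
      hC₄ hC₂ hp1 (by positivity : 0 ≤ 2 * s) (by linarith) hL0 (h6.trans (by linarith))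
    have h9 := mul_le_mul_of_nonneg_left h8 (Real.exp_pos (v x)).le
    linarith
  have h6 : ∫ x, Real.exp (v x) ∂(vol g cv) ≤ I₂ :=
    integral_mono_vol (by fun_prop) (by fun_prop) fun x =>
      le_mul_of_one_le_right (Real.exp_pos _).le (by nlinarith [sq_nonneg (g.gradNorm F x)])
  have hI₂0 : 0 ≤ I₂ := integral_nonneg fun x => by positivity
  have h7 : I₁ ≤ 2 * C₂ * C₅ * I₂ := by
    -- Half of the gradient term is absorbed. Every other term carries a factor p, which is divided
    -- out, so the constant does not depend on s.
    have a1 : p / C₂ * I₁ - p / (2 * C₂) * I₁ ≤ p * C₅ * I₂ := by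
      have a2 : C₁ * ∫ x, Real.exp (v x) ∂(vol g cv) ≤ p * C₁ * I₂ := by
        have := mul_le_mul_of_nonneg_left h6 (zero_le_one.trans hC₁)
        have := le_mul_of_one_le_left (mul_nonneg (zero_le_one.trans hC₁) hI₂0) hp1
        linarith
      have a3 : p * C₅ * I₂ = p * C₁ * I₂ + p * (C₄ * (1 + L + 3 * (C₄ * C₂))) * I₂ := by
        rw [hC₅]; ring
      linarith
    have a4 : p / C₂ * I₁ - p / (2 * C₂) * I₁ = p * (I₁ / (2 * C₂)) := by field_simp; ring
    rw [a4, mul_assoc] at a1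
    have a5 := le_of_mul_le_mul_left a1 (by linarith : 0 < p)
    rw [div_le_iff₀ (by linarith)] at a5
    linarith
  have hRb : ∀ x, |F x + (-l) * φ x| ≤ R := fun x => by
    refine (abs_add_le _ _).trans ?_
    rw [abs_mul, abs_neg, abs_of_nonneg (by linarith : 0 ≤ l)]
    exact add_le_add (hK x) (mul_le_mul_of_nonneg_left (hA x) (by linarith))
  have h8 : ∫ x, Real.exp (2 * s * f x) * g.gradNorm f x ^ 2 ∂(vol g cv) ≤ Real.exp R * I₁ := by
    rw [hI₁, ← integral_const_mul]
    refine integral_mono_vol (by fun_prop) (by fun_prop) fun x => ?_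
    rw [← mul_assoc]
    refine mul_le_mul_of_nonneg_right ?_ (sq_nonneg _)
    rw [← Real.exp_add, Real.exp_le_exp]
    have := (abs_le.mp (hRb x)).1
    simp only [hv]; linarith
  have h9 : I₂ ≤ Real.exp R *
      ∫ x, Real.exp (2 * s * f x) * (1 + g.gradNorm F x ^ 2) ∂(vol g cv) := by
    rw [hI₂, ← integral_const_mul]
    refine integral_mono_vol (by fun_prop) (by fun_prop) fun x => ?_
    rw [← mul_assoc]
    refine mul_le_mul_of_nonneg_right ?_ (by positivity)
    rw [← Real.exp_add, Real.exp_le_exp]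
    have := (abs_le.mp (hRb x)).2
    simp only [hv]; linarith
  have hC₅0 : 0 ≤ C₅ := by positivity
  calc _ ≤ Real.exp R * I₁ := h8
    _ ≤ Real.exp R * (2 * C₂ * C₅ * I₂) := by gcongr
    _ ≤ Real.exp R * (2 * C₂ * C₅ * (Real.exp R *
        ∫ x, Real.exp (2 * s * f x) * (1 + g.gradNorm F x ^ 2) ∂(vol g cv))) := by gcongr
    _ = _ := by ring

end EnergyBound

/-! ### Sobolev inequality in ℂⁿ -/

section FlatSobolev

open scoped NNReal ENNReal

variable {n : ℕ} {K : Set (Cn n)}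

lemma finrank_Cn : Module.finrank ℝ (Cn n) = 2 * n := by
  rw [Module.finrank_pi_fintype]
  simp [Complex.finrank_real_complex, mul_comm]

lemma hasCompactSupport_of_forall_notMem {F : Type*} [Zero F] {u : Cn n → F} (hK : IsCompact K)
    (h0 : ∀ z, z ∉ K → u z = 0) : HasCompactSupport u := HasCompactSupport.intro hK h0

lemma fderiv_eq_zero_of_notMem {u : Cn n → ℝ} (hK : IsCompact K) (h0 : ∀ z, z ∉ K → u z = 0)
    {z : Cn n} (hz : z ∉ K) : fderiv ℝ u z = 0 := by
  have : u =ᶠ[nhds z] fun _ => 0 := by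
    filter_upwards [hK.isClosed.isOpen_compl.mem_nhds hz] with w hw using h0 w hw
  rw [this.fderiv_eq, fderiv_const_apply]

/-- The Sobolev inequality for functions with support in a fixed compact set. -/
lemma exists_flat_sobolev (hn : 1 ≤ n) (hK : IsCompact K) {q : ℝ} (hq : 2 ≤ q)
    (hqn : 1 / 2 - 1 / (2 * (n : ℝ)) < 1 / q) :
    ∃ C, 0 ≤ C ∧ ∀ u : Cn n → ℝ, ContDiff ℝ 1 u → (∀ z, z ∉ K → u z = 0) →
      (∫ z, ‖u z‖ ^ q) ^ q⁻¹ ≤ C * (∫ z, ‖fderiv ℝ u z‖ ^ (2 : ℝ)) ^ (2 : ℝ)⁻¹ := by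
  have hq0 : 0 < q := by linarith
  have hn' : (1 : ℝ) ≤ n := by exact_mod_cast hn
  have hn0 : (0 : ℝ) < n := by linarith
  have h2n : 1 / (2 * (n : ℝ)) ≤ 1 / 2 := one_div_le_one_div_of_le (by norm_num) (by linarith)
  have hqi : 1 / q ≤ 1 / 2 := one_div_le_one_div_of_le (by norm_num) hq
  -- The inverse of the exponent P < 2 whose Sobolev conjugate in real dimension 2n is q. Hölder's
  -- inequality on the compact set K then passes from P to 2; this also covers n = 1, where 2 is the
  -- critical exponent.
  set r : ℝ := 1 / q + 1 / (2 * (n : ℝ)) with hr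
  have hr0 : 0 < r := by positivity
  have hr1 : 1 / 2 < r := by linarith
  set P : ℝ≥0 := ⟨r⁻¹, (inv_pos.mpr hr0).le⟩ with hP
  have hPr : (P : ℝ) = r⁻¹ := rfl
  set q' : ℝ≥0 := ⟨q, hq0.le⟩ with hq'
  have hqq : (q' : ℝ) = q := rfl
  have hP1 : 1 ≤ P := by
    rw [← NNReal.coe_le_coe, NNReal.coe_one, hPr]
    exact (one_le_inv₀ hr0).mpr (by linarith)
  have hP2 : P < 2 := by
    rw [← NNReal.coe_lt_coe, hPr, NNReal.coe_ofNat, inv_lt_comm₀ hr0 (by norm_num)]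
    linarith
  set c₀ := eLpNormLESNormFDerivOfLeConst ℝ (volume : Measure (Cn n)) K P q'
  set V : ℝ≥0∞ := (volume K) ^ (1 / (P : ℝ≥0∞).toReal - 1 / (2 : ℝ≥0∞).toReal) with hV
  have hVt : V ≠ ⊤ := by
    refine ENNReal.rpow_ne_top_of_nonneg ?_ hK.measure_lt_top.ne
    rw [ENNReal.coe_toReal, hPr, one_div, inv_inv, ENNReal.toReal_ofNat]
    linarith
  refine ⟨(c₀ * V).toReal, ENNReal.toReal_nonneg, fun u hu h0 => ?_⟩
  have hcu : HasCompactSupport u := hasCompactSupport_of_forall_notMem hK h0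
  have hdc : Continuous (fderiv ℝ u) := hu.continuous_fderiv (by simp)
  have hdu : HasCompactSupport (fderiv ℝ u) := hcu.fderiv ℝ
  have hsu : Function.support u ⊆ K := fun z hz => by
    by_contra h; exact hz (h0 z h)
  have hsd : Function.support (fderiv ℝ u) ⊆ K := fun z hz => by
    by_contra h; exact hz (fderiv_eq_zero_of_notMem hK h0 h)
  have hfr : (Module.finrank ℝ (Cn n) : ℝ) = 2 * n := by
    rw [finrank_Cn]; push_cast; ring
  have h1 := eLpNorm_le_eLpNorm_fderiv_of_le (μ := volume) (F := ℝ) (p := P) (q := q') hu hsu hP1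
    (by
      rw [finrank_Cn]
      refine hP2.trans_le ?_
      have : (1 : ℝ≥0) ≤ n := by exact_mod_cast hn
      push_cast
      exact le_mul_of_one_le_right (by norm_num) this)
    (by rw [hfr, NNReal.coe_inv, hPr, hqq, inv_inv, hr, one_div, one_div, add_sub_cancel_right])
    hK.isBounded
  have h2 : eLpNorm (fderiv ℝ u) P volume ≤ eLpNorm (fderiv ℝ u) 2 volume * V := by
    have hres : ∀ p : ℝ≥0∞, eLpNorm (fderiv ℝ u) p (volume.restrict K) =
        eLpNorm (fderiv ℝ u) p volume := fun p =>
      eLpNorm_restrict_eq_of_support_subset (f := fderiv ℝ u) hsd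
    rw [← hres, ← hres]
    refine (eLpNorm_le_eLpNorm_mul_rpow_measure_univ (q := 2) (by exact_mod_cast hP2.le)
      hdc.aestronglyMeasurable).trans_eq ?_
    rw [Measure.restrict_apply_univ]
  have h3 : MemLp u q' volume := hu.continuous.memLp_of_hasCompactSupport hcu
  have h4 : MemLp (fderiv ℝ u) 2 volume := hdc.memLp_of_hasCompactSupport hdu
  have h5 := h1.trans (mul_le_mul' le_rfl h2)
  have hq'0 : (q' : ℝ≥0∞) ≠ 0 := by
    rw [ne_eq, ENNReal.coe_eq_zero, ← NNReal.coe_eq_zero, hqq]; exact hq0.ne'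
  rw [h3.eLpNorm_eq_integral_rpow_norm hq'0 ENNReal.coe_ne_top,
    h4.eLpNorm_eq_integral_rpow_norm (by norm_num) (by norm_num), ENNReal.coe_toReal, hqq,
    ENNReal.toReal_ofNat] at h5
  have hI : 0 ≤ (∫ z, ‖fderiv ℝ u z‖ ^ (2 : ℝ)) ^ (2 : ℝ)⁻¹ :=
    Real.rpow_nonneg (integral_nonneg fun z => by positivity) _
  have h6 : (c₀ : ℝ≥0∞) * (ENNReal.ofReal ((∫ z, ‖fderiv ℝ u z‖ ^ (2 : ℝ)) ^ (2 : ℝ)⁻¹) * V) =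
      ENNReal.ofReal ((c₀ * V).toReal * (∫ z, ‖fderiv ℝ u z‖ ^ (2 : ℝ)) ^ (2 : ℝ)⁻¹) := by
    rw [ENNReal.ofReal_mul ENNReal.toReal_nonneg,
      ENNReal.ofReal_toReal (ENNReal.mul_ne_top ENNReal.coe_ne_top hVt)]
    ring
  rw [h6] at h5
  exact (ENNReal.ofReal_le_ofReal_iff (mul_nonneg ENNReal.toReal_nonneg hI)).mp h5

/-- The factor 4 comes from adding the ∂ and ∂̄ parts, of equal modulus for real u, and n from
comparing a sum with the sum of squares. -/
lemma norm_fderiv_sq_le {u : Cn n → ℝ} {z : Cn n} (hu : DifferentiableAt ℝ u z) :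
    ‖fderiv ℝ u z‖ ^ 2 ≤ 4 * n * nsq (gradC (fun w => (u w : ℂ)) z) := by
  have h1 : ‖fderiv ℝ u z‖ ≤ 2 * ∑ k, ‖gradC (fun w => (u w : ℂ)) z k‖ := by
    refine ContinuousLinearMap.opNorm_le_bound _ (by positivity) fun v => ?_
    have h2 := realLinear_eq_sum (fderiv ℝ (fun w => (u w : ℂ)) z) v
    rw [fderiv_ofReal hu] at h2
    have h3 : ‖fderiv ℝ u z v‖ = ‖((fderiv ℝ u z v : ℝ) : ℂ)‖ := (Complex.norm_real _).symm
    rw [h3, h2, Finset.mul_sum, Finset.sum_mul]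
    refine (norm_sum_le _ _).trans (Finset.sum_le_sum fun k _ => ?_)
    refine (norm_add_le _ _).trans ?_
    rw [norm_mul, norm_mul, RCLike.norm_conj]
    change ‖v k‖ * ‖gradC (fun w => (u w : ℂ)) z k‖ +
      ‖v k‖ * ‖cderiv Complex.I k (fun w => (u w : ℂ)) z‖ ≤ _
    rw [cderiv_bar_ofReal, RCLike.norm_conj]
    have := mul_le_mul_of_nonneg_right (norm_le_pi_norm v k)
      (norm_nonneg (gradC (fun w => (u w : ℂ)) z k))
    linarith
  have h2 := sq_sum_le_card_mul_sum_sq (s := Finset.univ)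
    (f := fun k => ‖gradC (fun w => (u w : ℂ)) z k‖)
  rw [Finset.card_univ, Fintype.card_fin] at h2
  calc ‖fderiv ℝ u z‖ ^ 2 ≤ (2 * ∑ k, ‖gradC (fun w => (u w : ℂ)) z k‖) ^ 2 := by gcongr
    _ = 4 * (∑ k, ‖gradC (fun w => (u w : ℂ)) z k‖) ^ 2 := by ring
    _ ≤ 4 * (n * ∑ k, ‖gradC (fun w => (u w : ℂ)) z k‖ ^ 2) := by gcongr
    _ = _ := by rw [nsq]; ring

end FlatSobolev

/-! ### Sobolev inequality on the manifold -/

section Sobolev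

open Matrix

variable {n : ℕ} {M : Type*} [TopologicalSpace M] [ChartedSpace (Cn n) M] [CompactSpace M]
  [IsManifold 𝓘(ℂ, Cn n) ω M] {ι : Type*} [Fintype ι] {cv : Cover n M ι}
  {g : KahlerMetric n M} [MeasurableSpace M] [BorelSpace M]

lemma continuous_rpow_of_nonneg {G : M → ℝ} (hG : Continuous G) {q : ℝ} (hq : 0 ≤ q) :
    Continuous fun x => G x ^ q := hG.rpow_const fun _ => Or.inr hq

lemma gradNorm_mul_sq_le {f φ : M → ℝ} (hf : Sm (n := n) f) (hφ : Sm (n := n) φ) (x : M) :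
    g.gradNorm (fun y => f y * φ y) x ^ 2 ≤
      2 * (φ x ^ 2 * g.gradNorm f x ^ 2 + f x ^ 2 * g.gradNorm φ x ^ 2) := by
  have he := chart_mem_atlas (Cn n) x
  have hx := mem_chart_target (Cn n) x
  have hG := g.posDef _ he _ hx
  simp only [gradNorm_sq, KahlerMetric.pairM, pairE_self]
  rw [grad_mul (hf.inChart_differentiableAt he hx) (hφ.inChart_differentiableAt he hx),
    (chartAt (Cn n) x).left_inv (mem_chart_source _ x)]
  have h2 := qform_inv_sum_le hG (Finset.univ : Finset (Fin 2)) (fun _ => 1)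
    ![(φ x : ℂ) • grad (chartAt (Cn n) x) f (chartAt (Cn n) x x),
      (f x : ℂ) • grad (chartAt (Cn n) x) φ (chartAt (Cn n) x x)]
    (fun _ _ => zero_le_one) (fun _ _ h => absurd h one_ne_zero)
  simp only [Fin.sum_univ_two, Matrix.cons_val_zero, Matrix.cons_val_one, div_one,
    qform_smul] at h2
  linarith

/-- The Sobolev inequality for functions supported in the support of a cut-off function. -/
lemma exists_chart_sobolev (hn : 1 ≤ n) (g : KahlerMetric n M) (cv : Cover n M ι) (a : ι) {q : ℝ}
    (hq : 2 ≤ q) (hqn : 1 / 2 - 1 / (2 * (n : ℝ)) < 1 / q) :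
    ∃ C, 0 ≤ C ∧ ∀ ψ : M → ℝ, Sm (n := n) ψ → (∀ x, x ∉ tsupport (cv.η a) → ψ x = 0) →
      ∫ x, |ψ x| ^ q ∂(vol g cv) ≤ C * (∫ x, g.gradNorm ψ x ^ 2 ∂(vol g cv)) ^ (q / 2) := by
  have he := cv.mem a
  have hT := (cv.e a).open_target
  have hS := cv.isCompact_tsupport a
  have hSe := cv.tsupport_subset a
  obtain ⟨hK, hKT⟩ := isCompact_chart_image hS hSe
  obtain ⟨C₁, hC₁, hC₁'⟩ := exists_flat_sobolev hn hK hq hqn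
  obtain ⟨C₂, hC₂, hC₂'⟩ := exists_bound (cv := cv)
    (f := fun a z => (g.coeff (cv.e a) z).det.re) fun a => det_re_continuousOn (cv.mem a)
  obtain ⟨C₃, hC₃, hC₃'⟩ := exists_bound (cv := cv)
    (f := fun a z => ((g.coeff (cv.e a) z).det.re)⁻¹) fun a =>
      (det_re_continuousOn (cv.mem a)).inv₀ fun z hz => (det_re_pos (cv.mem a) hz).ne'
  obtain ⟨C₄, hC₄, hC₄'⟩ := exists_nsq_grad_le g cv
  refine ⟨C₂ * (C₁ ^ q * (4 * n * C₄ * C₃) ^ (q / 2)), by positivity, fun ψ hψ h0 => ?_⟩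
  have hq0 : 0 < q := by linarith
  replace hC₂' := hC₂' a
  replace hC₃' := hC₃' a
  replace hC₄' := hC₄' ψ hψ a
  have hψc := hψ.continuous
  have hgc : Continuous (g.gradNorm ψ) := continuous_gradNorm hψ
  have hg0 : ∀ x, x ∉ tsupport (cv.η a) → g.gradNorm ψ x = 0 := fun x hx => by
    have : grad (chartAt (Cn n) x) ψ (chartAt (Cn n) x x) = 0 :=
      grad_eq_zero (isClosed_tsupport (cv.η a)) h0 (mem_chart_target _ x)
        (by rwa [(chartAt (Cn n) x).left_inv (mem_chart_source _ x)])
    rw [g.gradNorm_eq]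
    simp [KahlerMetric.pairM, pairE, this]
  have hgc2 : Continuous fun x => g.gradNorm ψ x ^ 2 := hgc.pow 2
  rw [integral_vol_chart he (continuous_rpow_of_nonneg hψc.abs hq0.le) hS hSe fun x hx => by
      rw [h0 x hx, abs_zero, Real.zero_rpow hq0.ne'],
    integral_vol_chart he hgc2 hS hSe fun x hx => by rw [hg0 x hx]; ring]
  set e := cv.e a
  set S := tsupport (cv.η a)
  set u : Cn n → ℝ := e.target.indicator fun z => ψ (e.symm z) with hu
  have hv0 : ∀ z ∈ e.target, z ∉ e '' S → ψ (e.symm z) = 0 := fun z hz hzK =>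
    vanishing_chart h0 hz hzK
  have hus : ContDiff ℝ 1 u :=
    contDiff_indicator hT hK hKT ((hψ e he).of_le (by norm_cast)) hv0
  have hu0 : ∀ z, z ∉ e '' S → u z = 0 := fun z hz => by
    by_cases hzT : z ∈ e.target
    · rw [hu, Set.indicator_of_mem hzT]; exact hv0 z hzT hz
    · rw [hu, Set.indicator_of_notMem hzT]
  have hsob := hC₁' u hus hu0
  have hdu : Continuous (fderiv ℝ u) := hus.continuous_fderiv (by simp)
  have hi1 : IntegrableOn (fun z => (g.coeff e z).det.re * |ψ (e.symm z)| ^ q) e.target :=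
    integrableOn_chart hS hSe ((det_re_continuousOn he).mul
      ((continuous_rpow_of_nonneg hψc.abs hq0.le).comp_continuousOn e.continuousOn_symm))
      fun z _ hz => by rw [h0 _ hz, abs_zero, Real.zero_rpow hq0.ne', mul_zero]
  have hi2 : IntegrableOn (fun z => (g.coeff e z).det.re * g.gradNorm ψ (e.symm z) ^ 2) e.target :=
    integrableOn_chart hS hSe ((det_re_continuousOn he).mul
      ((hgc.pow 2).comp_continuousOn e.continuousOn_symm))
      fun z _ hz => by rw [hg0 _ hz]; ring
  have hi3 : Integrable fun z => ‖u z‖ ^ q :=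
    (hus.continuous.norm.rpow_const fun _ => Or.inr hq0.le).integrable_of_hasCompactSupport
      (hasCompactSupport_of_forall_notMem hK fun z hz => by
        rw [hu0 z hz, norm_zero, Real.zero_rpow hq0.ne'])
  have h1 : ∫ z in e.target, (g.coeff e z).det.re * |ψ (e.symm z)| ^ q ≤
      C₂ * ∫ z, ‖u z‖ ^ q := by
    have h2 : ∫ z, ‖u z‖ ^ q = ∫ z in e.target, ‖u z‖ ^ q :=
      (setIntegral_eq_integral_of_forall_compl_eq_zero fun z hz => by
        rw [hu, Set.indicator_of_notMem hz, norm_zero, Real.zero_rpow hq0.ne']).symm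
    rw [h2, ← integral_const_mul]
    refine setIntegral_mono_on hi1 (hi3.integrableOn.const_mul _) hT.measurableSet fun z hz => ?_
    rw [hu, Set.indicator_of_mem hz, Real.norm_eq_abs]
    by_cases hzS : e.symm z ∈ S
    · have := (le_abs_self _).trans (hC₂' _ hzS)
      rw [e.right_inv hz] at this
      exact mul_le_mul_of_nonneg_right this (by positivity)
    · rw [h0 _ hzS, abs_zero, Real.zero_rpow hq0.ne']; simp
  have h2 : ∫ z, ‖fderiv ℝ u z‖ ^ (2 : ℝ) ≤ 4 * n * C₄ * C₃ *
      ∫ z in e.target, (g.coeff e z).det.re * g.gradNorm ψ (e.symm z) ^ 2 := by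
    have h3 : ∫ z, ‖fderiv ℝ u z‖ ^ (2 : ℝ) = ∫ z in e.target, ‖fderiv ℝ u z‖ ^ (2 : ℝ) :=
      (setIntegral_eq_integral_of_forall_compl_eq_zero fun z hz => by
        rw [fderiv_eq_zero_of_notMem hK hu0 fun h => hz (hKT h), norm_zero,
          Real.zero_rpow two_ne_zero]).symm
    rw [h3, ← integral_const_mul]
    have hi4 : Integrable fun z => ‖fderiv ℝ u z‖ ^ (2 : ℝ) :=
      (hdu.norm.rpow_const fun _ => Or.inr zero_le_two).integrable_of_hasCompactSupport
        (hasCompactSupport_of_forall_notMem hK fun z hz => by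
          rw [fderiv_eq_zero_of_notMem hK hu0 hz, norm_zero, Real.zero_rpow two_ne_zero])
    refine setIntegral_mono_on hi4.integrableOn (hi2.const_mul _) hT.measurableSet fun z hz => ?_
    have hd := det_re_pos (g := g) he hz
    by_cases hzS : e.symm z ∈ S
    · have hev : u =ᶠ[nhds z] fun w => ψ (e.symm w) := by
        filter_upwards [hT.mem_nhds hz] with w hw using Set.indicator_of_mem hw _
      rw [hev.fderiv_eq, Real.rpow_two]
      refine (norm_fderiv_sq_le (hψ.differentiableAt he hz)).trans ?_
      have h4 := hC₄' _ hzS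
      have h5 := (le_abs_self _).trans (hC₃' _ hzS)
      rw [e.right_inv hz] at h4 h5
      rw [← gradNorm_sq] at h4
      -- Inserts the volume density, which is bounded below on the support.
      have h6 : 1 ≤ C₃ * (g.coeff e z).det.re := by
        have := mul_le_mul_of_nonneg_right h5 hd.le
        rwa [inv_mul_cancel₀ hd.ne'] at this
      calc 4 * n * nsq (grad e ψ z) ≤ 4 * n * (C₄ * g.gradNorm ψ (e.symm z) ^ 2) := by gcongr
        _ ≤ 4 * n * (C₄ * g.gradNorm ψ (e.symm z) ^ 2) * (C₃ * (g.coeff e z).det.re) :=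
          le_mul_of_one_le_right (by positivity) h6
        _ = _ := by ring
    · rw [fderiv_eq_zero_of_notMem hK hu0 fun h => by
        obtain ⟨y, hy, rfl⟩ := h; exact hzS (by rwa [e.left_inv (hSe hy)]), norm_zero,
        Real.zero_rpow two_ne_zero]
      positivity
  set J := ∫ z in e.target, (g.coeff e z).det.re * g.gradNorm ψ (e.symm z) ^ 2
  have hIu : 0 ≤ ∫ z, ‖u z‖ ^ q := integral_nonneg fun z => by positivity
  have hID : 0 ≤ ∫ z, ‖fderiv ℝ u z‖ ^ (2 : ℝ) := integral_nonneg fun z => by positivity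
  have hJ : 0 ≤ J := setIntegral_nonneg hT.measurableSet fun z hz =>
    mul_nonneg (det_re_pos he hz).le (sq_nonneg _)
  have h3 : ∫ z, ‖u z‖ ^ q ≤ C₁ ^ q * (∫ z, ‖fderiv ℝ u z‖ ^ (2 : ℝ)) ^ (q / 2) := by
    have := Real.rpow_le_rpow (Real.rpow_nonneg hIu _) hsob hq0.le
    rwa [Real.mul_rpow hC₁ (Real.rpow_nonneg hID _), ← Real.rpow_mul hIu, ← Real.rpow_mul hID,
      inv_mul_cancel₀ hq0.ne', Real.rpow_one, inv_mul_eq_div] at this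
  calc _ ≤ C₂ * ∫ z, ‖u z‖ ^ q := h1
    _ ≤ C₂ * (C₁ ^ q * (∫ z, ‖fderiv ℝ u z‖ ^ (2 : ℝ)) ^ (q / 2)) := by gcongr
    _ ≤ C₂ * (C₁ ^ q * (4 * n * C₄ * C₃ * J) ^ (q / 2)) := by gcongr
    _ = _ := by rw [Real.mul_rpow (by positivity) hJ]; ring

/-- The Sobolev inequality on a compact Kähler manifold. -/
theorem exists_sobolev (hn : 1 ≤ n) (g : KahlerMetric n M) (cv : Cover n M ι) {q : ℝ}
    (hq : 2 ≤ q) (hqn : 1 / 2 - 1 / (2 * (n : ℝ)) < 1 / q) :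
    ∃ C, 0 ≤ C ∧ ∀ w : M → ℝ, Sm (n := n) w →
      ∫ x, |w x| ^ q ∂(vol g cv) ≤
        C * (∫ x, (w x ^ 2 + g.gradNorm w x ^ 2) ∂(vol g cv)) ^ (q / 2) := by
  have hq0 : 0 < q := by linarith
  choose C hC0 hC using fun a => exists_chart_sobolev hn g cv a hq hqn
  have hb : ∀ a, ∃ B, ∀ x, g.gradNorm (cv.η a) x ^ 2 ≤ B := fun a => by
    obtain ⟨B, hB⟩ := isCompact_univ.exists_bound_of_continuousOn
      ((continuous_gradNorm (g := g) (cv.smooth a)).pow 2).continuousOn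
    exact ⟨B, fun x => (le_abs_self _).trans (hB x (Set.mem_univ x))⟩
  choose B hB using hb
  -- The constant of `gradNorm_mul_sq_le` for the product w η, with η ≤ 1 and |∇η|² ≤ |B|.
  set D : ι → ℝ := fun a => 2 * (1 + |B a|) with hD
  have hD0 : ∀ a, 0 ≤ D a := fun a => by positivity
  refine ⟨Fintype.card ι ^ (q - 1) * ∑ a, C a * D a ^ (q / 2),
    mul_nonneg (by positivity) (Finset.sum_nonneg fun a _ => mul_nonneg (hC0 a)
      (Real.rpow_nonneg (hD0 a) _)), fun w hw => ?_⟩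
  have hwa : ∀ a, Sm (n := n) fun x => w x * cv.η a x := fun a => hw.mul (cv.smooth a)
  have hwc := hw.continuous
  have hgw : Continuous (g.gradNorm w) := continuous_gradNorm hw
  set J := ∫ x, (w x ^ 2 + g.gradNorm w x ^ 2) ∂(vol g cv) with hJ
  have hJ0 : 0 ≤ J := integral_nonneg fun x => by positivity
  have h1 : ∀ a, ∫ x, |w x * cv.η a x| ^ q ∂(vol g cv) ≤ C a * D a ^ (q / 2) * J ^ (q / 2) := by
    intro a
    have hga : Continuous (g.gradNorm fun x => w x * cv.η a x) := continuous_gradNorm (hwa a)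
    have h2 : ∫ x, g.gradNorm (fun x => w x * cv.η a x) x ^ 2 ∂(vol g cv) ≤ D a * J := by
      rw [hJ, ← integral_const_mul]
      refine integral_mono_vol (by fun_prop) (by fun_prop) fun x => ?_
      refine (gradNorm_mul_sq_le hw (cv.smooth a) x).trans ?_
      have h3 : cv.η a x ^ 2 ≤ 1 := pow_le_one₀ (cv.nonneg a x) (cv.le_one a x)
      have h4 : g.gradNorm (cv.η a) x ^ 2 ≤ |B a| := (hB a x).trans (le_abs_self _)
      rw [hD]
      nlinarith [mul_le_mul_of_nonneg_right h3 (sq_nonneg (g.gradNorm w x)),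
        mul_le_mul_of_nonneg_left h4 (sq_nonneg (w x)), abs_nonneg (B a),
        mul_nonneg (abs_nonneg (B a)) (sq_nonneg (g.gradNorm w x)), sq_nonneg (w x)]
    refine (hC a _ (hwa a) fun x hx => by rw [cv.eq_zero_of_notMem a hx, mul_zero]).trans ?_
    rw [mul_assoc, ← Real.mul_rpow (hD0 a) hJ0]
    exact mul_le_mul_of_nonneg_left (Real.rpow_le_rpow (integral_nonneg fun x => sq_nonneg _) h2
      (by positivity)) (hC0 a)
  have hca : ∀ a, Continuous fun x => |w x * cv.η a x| ^ q := fun a =>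
    continuous_rpow_of_nonneg (hwa a).continuous.abs hq0.le
  calc ∫ x, |w x| ^ q ∂(vol g cv) ≤
        ∫ x, (Fintype.card ι : ℝ) ^ (q - 1) * ∑ a, |w x * cv.η a x| ^ q ∂(vol g cv) := by
        refine integral_mono_vol (continuous_rpow_of_nonneg hwc.abs hq0.le)
          (continuous_const.mul (continuous_finsetSum _ fun a _ => hca a)) fun x => ?_
        -- Since w = ∑ wη, convexity of the q-th power reduces the estimate to functions supported
        -- in one chart.
        have h3 := Real.rpow_sum_le_const_mul_sum_rpow Finset.univ (fun a => w x * cv.η a x)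
          (p := q) (by linarith)
        rw [Finset.card_univ] at h3
        refine le_trans (Real.rpow_le_rpow (abs_nonneg _) ?_ hq0.le) h3
        refine le_trans (le_of_eq ?_) (Finset.abs_sum_le_sum_abs _ _)
        rw [← Finset.mul_sum, cv.sum_eq_one, mul_one]
    _ = (Fintype.card ι : ℝ) ^ (q - 1) * ∑ a, ∫ x, |w x * cv.η a x| ^ q ∂(vol g cv) := by
        rw [integral_const_mul, integral_finsetSum _ fun a _ => integrable_vol (hca a)]
    _ ≤ (Fintype.card ι : ℝ) ^ (q - 1) * ∑ a, C a * D a ^ (q / 2) * J ^ (q / 2) := by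
        gcongr with a; exact h1 a
    _ = _ := by rw [← Finset.sum_mul, mul_assoc]

end Sobolev

/-! ### Numerical part of the iteration -/

section Iteration

/-- The bookkeeping of Moser's iteration. -/
lemma exists_iteration_bound {β q B : ℝ} (hβ : 1 < β) (hq : 0 ≤ q) (hB : 1 ≤ B) :
    ∃ S : ℝ, ∀ I : ℕ → ℝ, (∀ k, 0 < I k) →
      (∀ k, I (k + 1) ≤ B * (1 + (β ^ k) ^ 2) ^ q * I k ^ β) →
      ∀ k, Real.log (I k) ≤ β ^ k * (Real.log (I 0) + S) := by
  have hβ0 : 0 < β := by linarith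
  set b₁ := Real.log B + q * Real.log 2 with hb₁
  set b₂ := q * (2 * Real.log β) with hb₂
  have hb₁0 : 0 ≤ b₁ := add_nonneg (Real.log_nonneg hB) (mul_nonneg hq (Real.log_nonneg one_le_two))
  have hb₂0 : 0 ≤ b₂ := mul_nonneg hq (mul_nonneg zero_le_two (Real.log_nonneg hβ.le))
  -- After taking logarithms, dividing by powers of β bounds the increment at step k by (b₁ +
  -- b₂k)/β^k. These are summable; the factor 1/β that the division also yields is given away.
  set a : ℕ → ℝ := fun k => b₁ * (β⁻¹) ^ k + b₂ * ((k : ℝ) ^ 1 * (β⁻¹) ^ k) with ha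
  have hr1 : ‖β⁻¹‖ < 1 := by
    rw [Real.norm_of_nonneg (inv_nonneg.mpr hβ0.le)]; exact inv_lt_one_of_one_lt₀ hβ
  have hsum : Summable a := ((summable_geometric_of_norm_lt_one hr1).mul_left b₁).add
    ((summable_pow_mul_geometric_of_norm_lt_one 1 hr1).mul_left b₂)
  have ha0 : ∀ k, 0 ≤ a k := fun k => by positivity
  refine ⟨∑' k, a k, fun I hI hstep => ?_⟩
  have key : ∀ k, Real.log (I k) ≤ β ^ k * (Real.log (I 0) + ∑ j ∈ Finset.range k, a j) := by
    intro k
    induction k with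
    | zero => simp
    | succ k ih =>
      have h1 := Real.log_le_log (hI (k + 1)) (hstep k)
      have hpk : 1 ≤ β ^ k := one_le_pow₀ hβ.le
      have hp1 : (0 : ℝ) < 1 + (β ^ k) ^ 2 := by positivity
      rw [Real.log_mul (by positivity) (Real.rpow_pos_of_pos (hI k) _).ne',
        Real.log_mul (by positivity) (Real.rpow_pos_of_pos hp1 _).ne', Real.log_rpow hp1,
        Real.log_rpow (hI k)] at h1
      have h2 : Real.log (1 + (β ^ k) ^ 2) ≤ Real.log 2 + k * (2 * Real.log β) := by
        have h3 : 1 + (β ^ k) ^ 2 ≤ 2 * (β ^ k) ^ 2 := by nlinarith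
        refine (Real.log_le_log hp1 h3).trans_eq ?_
        rw [Real.log_mul two_ne_zero (by positivity), Real.log_pow, Real.log_pow]
        push_cast; ring
      have h4 := mul_le_mul_of_nonneg_left h2 hq
      have h5 := mul_le_mul_of_nonneg_left ih hβ0.le
      rw [Finset.sum_range_succ, pow_succ]
      have h6 : b₁ + b₂ * k ≤ β ^ k * β * a k := by
        have h7 : β ^ k * a k = b₁ + b₂ * k := by
          simp only [ha, pow_one, inv_pow]
          field_simp
        have h8 : 0 ≤ b₁ + b₂ * k := by positivity
        calc b₁ + b₂ * k ≤ β * (b₁ + b₂ * k) := le_mul_of_one_le_left h8 hβ.le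
          _ = _ := by rw [← h7]; ring
      have h9 : Real.log B + q * (Real.log 2 + k * (2 * Real.log β)) = b₁ + b₂ * k := by
        rw [hb₁, hb₂]; ring
      nlinarith
  intro k
  refine (key k).trans (mul_le_mul_of_nonneg_left ?_ (by positivity))
  have := hsum.sum_le_tsum (Finset.range k) fun j _ => ha0 j
  linarith

end Iteration

/-! ### Moser iteration -/

section Moser

variable {n : ℕ} {M : Type*} [TopologicalSpace M] [ChartedSpace (Cn n) M] [CompactSpace M]
  [IsManifold 𝓘(ℂ, Cn n) ω M] {ι : Type*} [Fintype ι] {cv : Cover n M ι}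
  {g : KahlerMetric n M} [MeasurableSpace M] [BorelSpace M]

/-- Makes the logarithms in the iteration legitimate, and detects at the end that a continuous
function exceeds its claimed bound at one point. -/
lemma integral_vol_pos {G : M → ℝ} (hG : Continuous G) (h0 : ∀ x, 0 ≤ G x) {x : M}
    (hx : 0 < G x) : 0 < ∫ y, G y ∂(vol g cv) := by
  obtain ⟨a, ha⟩ : ∃ a, cv.η a x ≠ 0 := by
    by_contra! hne
    have := cv.sum_eq_one x
    simp [hne] at this
  refine lt_of_lt_of_le ?_ (integral_cutVol_le_vol hG h0 a)
  rw [integral_cutVol a hG]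
  have he := cv.mem a
  have hxs := cv.mem_source ha
  have hT := (cv.e a).open_target
  have hη2 := fun x => cv.eq_zero_of_notMem a (x := x)
  have hc : ContinuousOn (fun z => (g.coeff (cv.e a) z).det.re *
      (cv.η a ((cv.e a).symm z) * G ((cv.e a).symm z))) (cv.e a).target :=
    (det_re_continuousOn he).mul (((cv.smooth a) _ he).continuousOn.mul
      (hG.comp_continuousOn (cv.e a).continuousOn_symm))
  rw [setIntegral_pos_iff_support_of_nonneg_ae]
  · have ho : IsOpen ((cv.e a).target ∩ (fun z => (g.coeff (cv.e a) z).det.re *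
        (cv.η a ((cv.e a).symm z) * G ((cv.e a).symm z))) ⁻¹' {0}ᶜ) :=
      hc.isOpen_inter_preimage hT isOpen_compl_singleton
    refine (ho.measure_pos volume ⟨cv.e a x, (cv.e a).map_source hxs, ?_⟩).trans_le
      (measure_mono fun z hz => ⟨hz.2, hz.1⟩)
    simp only [Set.mem_preimage, Set.mem_compl_iff, Set.mem_singleton_iff,
      (cv.e a).left_inv hxs]
    exact mul_ne_zero (det_re_pos he ((cv.e a).map_source hxs)).ne' (mul_ne_zero ha hx.ne')
  · exact (ae_restrict_iff' hT.measurableSet).mpr (Filter.Eventually.of_forall fun z hz =>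
      mul_nonneg (det_re_pos he hz).le (mul_nonneg (cv.nonneg a _) (h0 _)))
  · exact integrableOn_chart (cv.isCompact_tsupport a) (cv.tsupport_subset a) hc
      fun z _ hz => by rw [hη2 _ hz, zero_mul, mul_zero]

/-- One step of Moser's iteration. -/
lemma exists_moser_step (hn : 1 ≤ n) (g : KahlerMetric n M) (cv : Cover n M ι) {p₀ : ℝ}
    (hp₀ : 2 * (n : ℝ) < p₀) (C₀ K : ℝ) :
    ∃ β q B : ℝ, 1 < β ∧ 0 ≤ q ∧ 1 ≤ B ∧ ∀ f G : M → ℝ, Sm (n := n) f → Continuous G →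
      (∀ x, 1 ≤ G x) → ∫ x, G x ^ (p₀ / 2) ∂(vol g cv) ≤ K →
      (∀ s, 0 ≤ s → ∫ x, Real.exp (2 * s * f x) * g.gradNorm f x ^ 2 ∂(vol g cv) ≤
        C₀ * ∫ x, Real.exp (2 * s * f x) * G x ∂(vol g cv)) →
      ∀ t, 0 ≤ t → ∫ x, Real.exp (t * β * f x) ∂(vol g cv) ≤
        B * (1 + t ^ 2) ^ q * (∫ x, Real.exp (t * f x) ∂(vol g cv)) ^ β := by
  have hn' : (1 : ℝ) ≤ n := by exact_mod_cast hn
  have hp2 : 2 < p₀ := by linarith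
  have hp0 : 0 < p₀ := by linarith
  have hinv : 1 / p₀ < 1 / (2 * (n : ℝ)) := one_div_lt_one_div_of_lt (by linarith) hp₀
  have h2n : 1 / (2 * (n : ℝ)) ≤ 1 / 2 := one_div_le_one_div_of_le (by norm_num) (by linarith)
  have hpi : 0 < 1 / p₀ := by positivity
  -- Here 1/2 - r is the midpoint of 1/p₀ and 1/(2n). Being below 1/(2n) makes Q = 1/r subcritical
  -- for Sobolev; being above 1/p₀ makes the gain β = Q/(2d) exceed 1. The hypothesis p₀ > 2n is
  -- used exactly here.
  set r : ℝ := 1 / 2 - (1 / (2 * (n : ℝ)) + 1 / p₀) / 2 with hr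
  have hr0 : 0 < r := by linarith
  set Q : ℝ := 1 / r with hQ
  have hQr : 1 / Q = r := one_div_one_div r
  have hQ2 : 2 ≤ Q := by
    rw [hQ, le_div_iff₀ hr0]; linarith
  have hQ0 : 0 < Q := by linarith
  obtain ⟨C₁, hC₁, hC₁'⟩ := exists_sobolev hn g cv hQ2 (by rw [hQr]; linarith)
  have hconj : (p₀ / 2).HolderConjugate (p₀ / (p₀ - 2)) := by
    rw [Real.holderConjugate_iff]
    refine ⟨by linarith, ?_⟩
    have : p₀ - 2 ≠ 0 := by linarith
    field_simp
    ring
  set d : ℝ := p₀ / (p₀ - 2) with hd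
  have hd1 : 1 < d := hconj.symm.lt
  have hd0 : 0 < d := by linarith
  set β : ℝ := Q / 2 / d with hβ
  have hβ1 : 1 < β := by
    rw [hβ, lt_div_iff₀ hd0, one_mul, hd, hQ, div_div, div_lt_div_iff₀ (by linarith) (by linarith)]
    have h1 : r < 1 / 2 - 1 / p₀ := by linarith
    have h2 : p₀ * (r * 2) < p₀ * ((1 / 2 - 1 / p₀) * 2) := by gcongr
    have h3 : p₀ * ((1 / 2 - 1 / p₀) * 2) = p₀ - 2 := by field_simp
    linarith
  set K₁ : ℝ := |K| ^ (1 / (p₀ / 2)) with hK₁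
  have hK₁0 : 0 ≤ K₁ := by positivity
  set B := C₁ * ((1 + |C₀|) * K₁) ^ (Q / 2) + 1 with hB
  have hB1 : 1 ≤ B := by
    have : 0 ≤ C₁ * ((1 + |C₀|) * K₁) ^ (Q / 2) := by positivity
    linarith
  refine ⟨β, Q / 2, B, hβ1, by positivity, hB1, fun f G hf hG hG1 hGK hE t ht => ?_⟩
  have hfc := hf.continuous
  have hgf : Continuous (g.gradNorm f) := continuous_gradNorm hf
  -- Hölder raises e^{2sf} to the power d and Sobolev raises e^{sf} to the power Q; with this s the
  -- exponents become t and tβ.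
  set s := t / (2 * d) with hs
  have hs0 : 0 ≤ s := by positivity
  have hst : s ≤ t := div_le_self ht (by linarith)
  have hw : Sm (n := n) fun x => Real.exp (s * f x) := (hf.const_mul s).exp
  have hG0 : ∀ x, 0 ≤ G x := fun x => zero_le_one.trans (hG1 x)
  set I := ∫ x, Real.exp (t * f x) ∂(vol g cv) with hI
  have hI0 : 0 ≤ I := integral_nonneg fun x => (Real.exp_pos _).le
  set J := ∫ x, Real.exp (2 * s * f x) * G x ∂(vol g cv) with hJ
  have hJ0 : 0 ≤ J := integral_nonneg fun x => mul_nonneg (Real.exp_pos _).le (hG0 x)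
  have h1 : J ≤ K₁ * I ^ (1 / d) := by
    have h2 := integral_mul_le_Lp_mul_Lq_of_nonneg (μ := vol g cv) hconj
      (f := G) (g := fun x => Real.exp (2 * s * f x)) (Filter.Eventually.of_forall hG0)
      (Filter.Eventually.of_forall fun x => (Real.exp_pos _).le)
      (hG.memLp_of_hasCompactSupport (HasCompactSupport.of_compactSpace _))
      (Continuous.memLp_of_hasCompactSupport (by fun_prop) (HasCompactSupport.of_compactSpace _))
    have h3 : ∀ x, Real.exp (2 * s * f x) ^ d = Real.exp (t * f x) := fun x => by
      rw [← Real.exp_mul]; congr 1; rw [hs]; field_simp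
    simp_rw [h3] at h2
    calc J = ∫ x, G x * Real.exp (2 * s * f x) ∂(vol g cv) := by simp_rw [hJ, mul_comm]
      _ ≤ _ := h2
      _ ≤ _ := by
        refine mul_le_mul_of_nonneg_right (Real.rpow_le_rpow
          (integral_nonneg fun x => Real.rpow_nonneg (hG0 x) _) (hGK.trans (le_abs_self K))
          (by positivity)) (by positivity)
  have h2 : ∀ x, g.gradNorm (fun x => Real.exp (s * f x)) x ^ 2 =
      s ^ 2 * (Real.exp (2 * s * f x) * g.gradNorm f x ^ 2) := fun x => by
    have hx := mem_chart_target (Cn n) x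
    simp only [gradNorm_sq, KahlerMetric.pairM, pairE_self]
    rw [grad_comp (θ := fun t => Real.exp (s * t)) (θ' := s * Real.exp (s * f x))
      (hf.differentiableAt (chart_mem_atlas _ x) hx), qform_smul]
    · rw [show 2 * s * f x = s * f x + s * f x by ring, Real.exp_add]; ring
    · rw [(chartAt (Cn n) x).left_inv (mem_chart_source _ x)]
      have := ((hasDerivAt_id (f x)).const_mul s).exp
      simp only [id, mul_one] at this
      rwa [mul_comm]
  have h3 : ∫ x, (Real.exp (s * f x) ^ 2 + g.gradNorm (fun x => Real.exp (s * f x)) x ^ 2)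
      ∂(vol g cv) ≤ (1 + |C₀|) * (1 + t ^ 2) * J := by
    have h4 : ∀ x, Real.exp (s * f x) ^ 2 = Real.exp (2 * s * f x) := fun x => by
      rw [← Real.exp_nat_mul]; congr 1; push_cast; ring
    simp_rw [h2, h4]
    rw [integral_add (integrable_vol (by fun_prop)) (integrable_vol (by fun_prop)),
      integral_const_mul]
    have h5 : ∫ x, Real.exp (2 * s * f x) ∂(vol g cv) ≤ J :=
      integral_mono_vol (by fun_prop) (by fun_prop) fun x =>
        le_mul_of_one_le_right (Real.exp_pos _).le (hG1 x)
    have h6 : ∫ x, Real.exp (2 * s * f x) * g.gradNorm f x ^ 2 ∂(vol g cv) ≤ |C₀| * J :=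
      (hE s hs0).trans (mul_le_mul_of_nonneg_right (le_abs_self C₀) hJ0)
    have h7 : s ^ 2 ≤ t ^ 2 := by gcongr
    have h8 := mul_nonneg (abs_nonneg C₀) hJ0
    have h9 := mul_le_mul_of_nonneg_left h6 (sq_nonneg s)
    have h10 := mul_le_mul_of_nonneg_right h7 h8
    nlinarith [mul_nonneg (sq_nonneg t) hJ0]
  have h4 := hC₁' _ hw
  have h5 : ∀ x, |Real.exp (s * f x)| ^ Q = Real.exp (t * β * f x) := fun x => by
    rw [abs_of_pos (Real.exp_pos _), ← Real.exp_mul]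
    congr 1; rw [hs, hβ]; field_simp
  simp_rw [h5] at h4
  refine h4.trans ?_
  calc C₁ * _ ^ (Q / 2) ≤ C₁ * ((1 + |C₀|) * (1 + t ^ 2) * (K₁ * I ^ (1 / d))) ^ (Q / 2) := by
        refine mul_le_mul_of_nonneg_left (Real.rpow_le_rpow
          (integral_nonneg fun x => by positivity) (h3.trans ?_) (by positivity)) hC₁
        gcongr
    _ = C₁ * ((1 + |C₀|) * K₁) ^ (Q / 2) * (1 + t ^ 2) ^ (Q / 2) * I ^ β := by
        rw [show (1 + |C₀|) * (1 + t ^ 2) * (K₁ * I ^ (1 / d)) =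
          ((1 + |C₀|) * K₁) * (1 + t ^ 2) * I ^ (1 / d) by ring,
          Real.mul_rpow (by positivity) (by positivity),
          Real.mul_rpow (by positivity) (by positivity), ← Real.rpow_mul hI0,
          show 1 / d * (Q / 2) = β by rw [hβ]; ring]
        ring
    _ ≤ _ := by
        gcongr
        linarith

/-- The maximum principle of Moser: a reverse Poincaré inequality for all powers of `exp f` bounds
`exp f` by its integral. -/
theorem exists_sup_bound (hn : 1 ≤ n) (g : KahlerMetric n M) (cv : Cover n M ι) {p₀ : ℝ}
    (hp₀ : 2 * (n : ℝ) < p₀) (C₀ K : ℝ) :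
    ∃ C : ℝ, ∀ f G : M → ℝ, Sm (n := n) f → Continuous G → (∀ x, 1 ≤ G x) →
      ∫ x, G x ^ (p₀ / 2) ∂(vol g cv) ≤ K →
      (∀ s, 0 ≤ s → ∫ x, Real.exp (2 * s * f x) * g.gradNorm f x ^ 2 ∂(vol g cv) ≤
        C₀ * ∫ x, Real.exp (2 * s * f x) * G x ∂(vol g cv)) →
      ∫ x, Real.exp (f x) ∂(vol g cv) ≤ K → ∀ x, Real.exp (f x) ≤ C := by
  obtain ⟨β, q, B, hβ, hq, hB, hstep⟩ := exists_moser_step hn g cv hp₀ C₀ K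
  obtain ⟨S, hS⟩ := exists_iteration_bound hβ hq hB
  refine ⟨K * Real.exp S, fun f G hf hG hG1 hGK hE hfK x => ?_⟩
  have hfc := hf.continuous
  set I : ℕ → ℝ := fun k => ∫ x, Real.exp (β ^ k * f x) ∂(vol g cv) with hI
  have hI0 : ∀ k, 0 < I k := fun k =>
    integral_vol_pos (by fun_prop) (fun y => (Real.exp_pos _).le) (x := x) (Real.exp_pos _)
  have h1 := hS I hI0 fun k => by
    have := hstep f G hf hG hG1 hGK hE (β ^ k) (by positivity)
    simpa only [hI, pow_succ] using this
  -- The iteration says that the k-th integral is at most m to the power β^k.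
  set m := Real.exp (Real.log (I 0) + S) with hm
  have hm0 : 0 < m := Real.exp_pos _
  have hmK : m ≤ K * Real.exp S := by
    rw [hm, Real.exp_add, Real.exp_log (hI0 0)]
    refine mul_le_mul_of_nonneg_right (le_trans (le_of_eq ?_) hfK) (Real.exp_pos _).le
    simp [hI]
  refine le_trans ?_ hmK
  by_contra! hlt
  -- If e^f exceeded m' > m at a point, the positive part of e^f/m' - 1 would have positive
  -- integral. That integral is at most (m/m')^{β^k} for every k, which tends to zero.
  obtain ⟨m', hm1, hm2⟩ := exists_between hlt
  have hm'0 : 0 < m' := hm0.trans hm1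
  have hpos : 0 < ∫ y, max (Real.exp (f y) / m' - 1) 0 ∂(vol g cv) := by
    refine integral_vol_pos (by fun_prop) (fun y => le_max_right _ _) (x := x) ?_
    exact lt_max_of_lt_left (sub_pos.mpr ((one_lt_div hm'0).mpr hm2))
  have hle : ∀ k : ℕ, ∫ y, max (Real.exp (f y) / m' - 1) 0 ∂(vol g cv) ≤ (m / m') ^ (β ^ k) := by
    intro k
    have hβk : 1 ≤ β ^ k := one_le_pow₀ hβ.le
    calc _ ≤ ∫ y, (m' ^ (β ^ k))⁻¹ * Real.exp (β ^ k * f y) ∂(vol g cv) := by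
          refine integral_mono_vol (by fun_prop) (by fun_prop) fun y => ?_
          have h2 : (m' ^ (β ^ k))⁻¹ * Real.exp (β ^ k * f y) = (Real.exp (f y) / m') ^ (β ^ k) := by
            rw [Real.div_rpow (Real.exp_pos _).le hm'0.le, ← Real.exp_mul, mul_comm (f y)]
            ring
          rw [h2]
          refine max_le ?_ (by positivity)
          rcases le_total (Real.exp (f y) / m') 1 with hc | hc
          · exact (sub_nonpos.mpr hc).trans (by positivity)
          · have h3 := Real.rpow_le_rpow_of_exponent_le hc hβk
            rw [Real.rpow_one] at h3
            linarith
      _ = (m' ^ (β ^ k))⁻¹ * I k := integral_const_mul _ _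
      _ ≤ (m' ^ (β ^ k))⁻¹ * m ^ (β ^ k) := by
          refine mul_le_mul_of_nonneg_left ?_ (by positivity)
          rw [← Real.exp_log (hI0 k), hm, ← Real.exp_mul, Real.exp_le_exp, mul_comm _ (β ^ k)]
          exact h1 k
      _ = _ := by rw [Real.div_rpow hm0.le hm'0.le]; ring
  have hlim : Filter.Tendsto (fun k : ℕ => (m / m') ^ (β ^ k)) Filter.atTop (nhds 0) :=
    (tendsto_rpow_atTop_of_base_lt_one _ (by linarith [div_pos hm0 hm'0])
      ((div_lt_one hm'0).mpr hm1)).comp (tendsto_pow_atTop_atTop_of_one_lt hβ)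
  exact absurd (ge_of_tendsto' hlim hle) (not_le.mpr hpos)

end Moser

/-! ### The Laplacian estimate -/

section Estimate

open Matrix

variable {n : ℕ} {M : Type*} [TopologicalSpace M] [ChartedSpace (Cn n) M] [CompactSpace M]
  [IsManifold 𝓘(ℂ, Cn n) ω M] {ι : Type*} [Fintype ι] {cv : Cover n M ι}
  {g : KahlerMetric n M} [MeasurableSpace M] [BorelSpace M]

/-- Only this inequality between the two volumes is needed, since `dvol` occurs solely in the
assumed Sobolev bound. The factor 2ⁿ only helps. -/
lemma cutVol_le_dvol (g : KahlerMetric n M) (cv : Cover n M ι) (a : ι) :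
    cutVol g cv a ≤ g.dvol := by
  refine le_trans ?_ (le_iSup₂ (f := fun e (_ : e ∈ atlas (Cn n) M) => g.chartVolume e) (cv.e a)
    (cv.mem a))
  refine Measure.map_mono_of_aemeasurable (withDensity_mono ?_)
    ((aemeasurable_chart_symm _).mono_ac (withDensity_absolutelyContinuous _ _))
  refine (ae_restrict_iff' (cv.e a).open_target.measurableSet).mpr
    (Filter.Eventually.of_forall fun z hz => ENNReal.ofReal_le_ofReal ?_)
  have hd := det_re_pos (g := g) (cv.mem a) hz
  calc (g.coeff (cv.e a) z).det.re * cv.η a ((cv.e a).symm z)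
      ≤ (g.coeff (cv.e a) z).det.re * 1 := mul_le_mul_of_nonneg_left (cv.le_one _ _) hd.le
    _ ≤ _ := by
      rw [mul_one]; exact le_mul_of_one_le_left hd.le (one_le_pow₀ one_le_two)

/-- Each summand of `vol` lies below `dvol`, so their number appears as a factor. -/
lemma integral_rpow_le_of_eLpNorm_le {f : M → ℝ} (hf : Continuous f) {p K : ℝ} (hp : 0 < p)
    (hK : eLpNorm f (ENNReal.ofReal p) g.dvol ≤ ENNReal.ofReal K) :
    ∫ x, |f x| ^ p ∂(vol g cv) ≤ Fintype.card ι * |K| ^ p := by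
  have h1 : ∀ a, ∫ x, |f x| ^ p ∂(cutVol g cv a) ≤ |K| ^ p := by
    intro a
    have h2 := ((eLpNorm_mono_measure f (cutVol_le_dvol g cv a)).trans hK).trans
      (ENNReal.ofReal_le_ofReal (le_abs_self K))
    have h3 : MemLp f (ENNReal.ofReal p) (cutVol g cv a) :=
      hf.memLp_of_hasCompactSupport (HasCompactSupport.of_compactSpace _)
    rw [h3.eLpNorm_eq_integral_rpow_norm (by simpa using hp) ENNReal.ofReal_ne_top,
      ENNReal.toReal_ofReal hp.le, ENNReal.ofReal_le_ofReal_iff (abs_nonneg K)] at h2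
    have h4 : 0 ≤ ∫ x, ‖f x‖ ^ p ∂(cutVol g cv a) := integral_nonneg fun x => by positivity
    have h5 := Real.rpow_le_rpow (Real.rpow_nonneg h4 _) h2 hp.le
    rwa [← Real.rpow_mul h4, inv_mul_cancel₀ hp.ne', Real.rpow_one] at h5
  rw [vol, integral_finsetSum_measure fun a _ =>
    integrable_vol (continuous_rpow_of_nonneg hf.abs hp.le)]
  refine (Finset.sum_le_sum fun a _ => h1 a).trans_eq ?_
  rw [Finset.sum_const, Finset.card_univ, nsmul_eq_mul]

lemma one_add_sq_rpow_le {y p : ℝ} (hy : 0 ≤ y) (hp : 0 ≤ p) :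
    (1 + y ^ 2) ^ (p / 2) ≤ 2 ^ (p / 2) * (1 + y ^ p) := by
  have hyp : 0 ≤ y ^ p := Real.rpow_nonneg hy p
  have h2 : (0 : ℝ) ≤ 2 ^ (p / 2) := by positivity
  rcases le_total y 1 with h | h
  · refine (Real.rpow_le_rpow (by positivity) (by nlinarith : 1 + y ^ 2 ≤ 2)
      (by positivity)).trans ?_
    exact le_mul_of_one_le_right h2 (by linarith)
  · refine (Real.rpow_le_rpow (by positivity) (by nlinarith : 1 + y ^ 2 ≤ 2 * y ^ 2)
      (by positivity)).trans ?_
    rw [Real.mul_rpow (by norm_num) (by positivity), ← Real.rpow_natCast, ← Real.rpow_mul hy]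
    refine mul_le_mul_of_nonneg_left ?_ h2
    rw [show ((2 : ℕ) : ℝ) * (p / 2) = p by push_cast; ring]
    linarith

/-- Bounds that follow from a bound of the Sobolev norm. -/
lemma exists_integral_bound_of_sobolevNorm_le (g : KahlerMetric n M) (cv : Cover n M ι)
    {p₀ : ℝ} (hp₀ : 2 < p₀) (K : ℝ) :
    ∃ C : ℝ, ∀ F : M → ℝ, Sm (n := n) F → g.sobolevNorm p₀ F ≤ ENNReal.ofReal K →
      ∫ x, (1 + g.gradNorm F x ^ 2) ^ (p₀ / 2) ∂(vol g cv) ≤ C ∧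
      ∫ x, (1 + F x ^ 2) ∂(vol g cv) ≤ C := by
  have hp0 : 0 < p₀ := by linarith
  set V := ∫ _x : M, (1 : ℝ) ∂(vol g cv) with hV
  have hV0 : 0 ≤ V := integral_nonneg fun _ => zero_le_one
  set N := (Fintype.card ι : ℝ) * |K| ^ p₀ with hN
  have hN0 : 0 ≤ N := by positivity
  have h2 : (0 : ℝ) ≤ 2 ^ (p₀ / 2) := by positivity
  refine ⟨2 ^ (p₀ / 2) * (V + N) + (2 * V + N), fun F hF hK => ?_⟩
  have hFc := hF.continuous
  have hgF : Continuous (g.gradNorm F) := continuous_gradNorm hF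
  have hFp : Continuous fun x => |F x| ^ p₀ := continuous_rpow_of_nonneg hFc.abs hp0.le
  have hgp : Continuous fun x => |g.gradNorm F x| ^ p₀ := continuous_rpow_of_nonneg hgF.abs hp0.le
  have h3 : ∫ x, |F x| ^ p₀ ∂(vol g cv) ≤ N :=
    integral_rpow_le_of_eLpNorm_le hFc hp0 ((le_add_right le_rfl).trans hK)
  have h4 : ∫ x, |g.gradNorm F x| ^ p₀ ∂(vol g cv) ≤ N :=
    integral_rpow_le_of_eLpNorm_le hgF hp0 ((le_add_left le_rfl).trans hK)
  constructor
  · have h5 : ∫ x, (1 + g.gradNorm F x ^ 2) ^ (p₀ / 2) ∂(vol g cv) ≤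
        ∫ x, 2 ^ (p₀ / 2) * (1 + |g.gradNorm F x| ^ p₀) ∂(vol g cv) :=
      integral_mono_vol (continuous_rpow_of_nonneg (by fun_prop) (by positivity)) (by fun_prop)
        fun x => by
          have := one_add_sq_rpow_le (abs_nonneg (g.gradNorm F x)) hp0.le
          rwa [sq_abs] at this
    rw [integral_const_mul, integral_add (integrable_vol continuous_const) (integrable_vol hgp)]
      at h5
    have h6 := mul_le_mul_of_nonneg_left (add_le_add_right h4 V) h2
    linarith
  · have h5 : ∫ x, (1 + F x ^ 2) ∂(vol g cv) ≤ ∫ x, (2 * 1 + |F x| ^ p₀) ∂(vol g cv) := by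
      refine integral_mono_vol (by fun_prop) (by fun_prop) fun x => ?_
      have h7 : 0 ≤ |F x| ^ p₀ := by positivity
      rcases le_total |F x| 1 with h | h
      · have : |F x| ^ 2 ≤ 1 := pow_le_one₀ (abs_nonneg _) h
        rw [sq_abs] at this
        linarith
      · have := Real.rpow_le_rpow_of_exponent_le h hp₀.le
        rw [Real.rpow_two, sq_abs] at this
        linarith
    rw [integral_add (integrable_vol (by fun_prop)) (integrable_vol hFp), integral_const_mul] at h5
    have : 0 ≤ 2 ^ (p₀ / 2) * (V + N) := by positivity
    linarith

/-- The bound of `F` by its `W^{1,p}` norm. -/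
lemma exists_abs_le_of_sobolevNorm_le (hn : 1 ≤ n) (g : KahlerMetric n M) (cv : Cover n M ι)
    {p₀ : ℝ} (hp₀ : 2 * (n : ℝ) < p₀) (K : ℝ) :
    ∃ C : ℝ, ∀ F : M → ℝ, Sm (n := n) F → g.sobolevNorm p₀ F ≤ ENNReal.ofReal K →
      ∀ x, |F x| ≤ C := by
  have hn' : (1 : ℝ) ≤ n := by exact_mod_cast hn
  obtain ⟨C₁, hC₁⟩ := exists_integral_bound_of_sobolevNorm_le g cv (by linarith : 2 < p₀) K
  -- The energy hypothesis holds with constant 1 for f = log (1 + F²) and G = 1 + |∇F|², and the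
  -- integral of e^f is that of 1 + F².
  obtain ⟨C₂, hC₂⟩ := exists_sup_bound hn g cv hp₀ 1 C₁
  refine ⟨C₂, fun F hF hK x => ?_⟩
  obtain ⟨h1, h2⟩ := hC₁ F hF hK
  have hFc := hF.continuous
  have hgF : Continuous (g.gradNorm F) := continuous_gradNorm hF
  have hpos : ∀ y, 0 < 1 + F y * F y := fun y => by nlinarith [mul_self_nonneg (F y)]
  have hf : Sm (n := n) fun y => Real.log (1 + F y * F y) :=
    ((Sm.const 1).add (hF.mul hF)).log fun y => (hpos y).ne'
  have hgf : Continuous (g.gradNorm fun y => Real.log (1 + F y * F y)) := continuous_gradNorm hf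
  have hfc := hf.continuous
  -- The derivative 2t/(1 + t²) of log (1 + t²) has modulus at most 1.
  have h3 : ∀ y, g.gradNorm (fun y => Real.log (1 + F y * F y)) y ^ 2 ≤ g.gradNorm F y ^ 2 := by
    intro y
    have hy := mem_chart_target (Cn n) y
    have he := chart_mem_atlas (Cn n) y
    simp only [gradNorm_sq, KahlerMetric.pairM, pairE_self]
    rw [grad_comp (θ := fun t => Real.log (1 + t * t)) (θ' := (1 * F y + F y * 1) / (1 + F y * F y))
      (hF.differentiableAt he hy), qform_smul]
    · refine mul_le_of_le_one_left (qform_inv_nonneg (g.posDef _ he _ hy) _) ?_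
      rw [div_pow, div_le_one (pow_pos (hpos y) 2)]
      nlinarith [sq_nonneg (1 - F y * F y)]
    · rw [(chartAt (Cn n) y).left_inv (mem_chart_source _ y)]
      exact (((hasDerivAt_id (F y)).mul (hasDerivAt_id (F y))).const_add 1).log (hpos y).ne'
  have h4 := hC₂ (fun y => Real.log (1 + F y * F y)) (fun y => 1 + g.gradNorm F y ^ 2) hf
    (by fun_prop) (fun y => by nlinarith [sq_nonneg (g.gradNorm F y)]) h1 (fun s _ => by
      rw [one_mul]
      refine integral_mono_vol (by fun_prop) (by fun_prop) fun y => ?_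
      refine mul_le_mul_of_nonneg_left ?_ (Real.exp_pos _).le
      linarith [h3 y]) (by
        refine le_trans (le_of_eq ?_) h2
        congr 1
        funext y
        rw [Real.exp_log (hpos y)]; ring) x
  rw [Real.exp_log (hpos x)] at h4
  refine le_trans ?_ h4
  nlinarith [sq_nonneg (|F x| - 1), abs_mul_abs_self (F x)]

/-- The integral of the cut-off trace is bounded in terms of the potential. -/
lemma exists_integral_cutTrace_le (g : KahlerMetric n M) (cv : Cover n M ι) (A : ℝ) :
    ∃ C : ℝ, ∀ (h : KahlerMetric n M) (φ : M → ℝ), Sm (n := n) φ →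
      (∀ e ∈ atlas (Cn n) M, ∀ z ∈ e.target, h.coeff e z = g.coeff e z + hess e φ z) →
      (∀ x, |φ x| ≤ A) → ∫ x, cutTrace h cv x ∂(vol g cv) ≤ C := by
  have key : ∀ p : ι × Fin n, ∃ C : ℝ, ∀ (h : KahlerMetric n M) (φ : M → ℝ), Sm (n := n) φ →
      (∀ e ∈ atlas (Cn n) M, ∀ z ∈ e.target, h.coeff e z = g.coeff e z + hess e φ z) →
      (∀ x, |φ x| ≤ A) → ∫ x, cutComp h cv p x ∂(vol g cv) ≤ C := by
    intro p
    have he := cv.mem p.1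
    have hT := (cv.e p.1).open_target
    have hS := cv.isCompact_tsupport p.1
    have hSe := cv.tsupport_subset p.1
    obtain ⟨hK, hKT⟩ := isCompact_chart_image hS hSe
    have hη := cv.smooth p.1 _ he
    have h0 : ∀ h : KahlerMetric n M, ∀ x, x ∉ tsupport (cv.η p.1) → cutComp h cv p x = 0 :=
      fun h x hx => by rw [cutComp, cv.eq_zero_of_notMem _ hx, zero_mul, zero_mul]
    set Q : Cn n → ℝ := fun z => (g.coeff (cv.e p.1) z).det.re *
      (cv.η p.1 ((cv.e p.1).symm z) * cv.η p.1 ((cv.e p.1).symm z)) with hQ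
    have hd : ContDiffOn ℝ ∞ (fun z => (g.coeff (cv.e p.1) z).det.re) (cv.e p.1).target :=
      fun z hz => (Complex.reCLM.contDiff.contDiffAt.comp z
        (contDiffAt_det (coeff_contDiffAt he hz))).contDiffWithinAt
    have hQs : ContDiffOn ℝ ∞ Q (cv.e p.1).target := hd.mul (hη.mul hη)
    have hQ0 : ∀ z ∈ (cv.e p.1).target, z ∉ cv.e p.1 '' tsupport (cv.η p.1) → Q z = 0 :=
      fun z hz hzK => by
        rw [hQ]; simp only
        rw [vanishing_chart (fun x => cv.eq_zero_of_notMem p.1 (x := x)) hz hzK]; ring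
    have hflat : ContinuousOn (flat p.2 Q) (cv.e p.1).target :=
      Complex.continuous_re.comp_continuousOn
        (contDiffOn_cderiv hT (contDiffOn_cderiv hT (contDiffOn_ofReal hQs))).continuousOn
    have hflat0 : ∀ z ∈ (cv.e p.1).target, z ∉ cv.e p.1 '' tsupport (cv.η p.1) →
        flat p.2 Q z = 0 := fun z hz hzK => by
      rw [flat, cderiv_eq_zero_of_vanishing hT hK (fun w hw hwK =>
        cderiv_eq_zero_of_vanishing hT hK (fun y hy hyK => by rw [hQ0 y hy hyK]; rfl) hw hwK)
        hz hzK, Complex.zero_re]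
    have hfi : IntegrableOn (flat p.2 Q) (cv.e p.1).target :=
      integrableOn_of_vanishing hT hK hKT hflat hflat0
    refine ⟨∫ x, cutComp g cv p x ∂(vol g cv) + A * ∫ z in (cv.e p.1).target, |flat p.2 Q z|,
      fun h φ hφ hh hA => ?_⟩
    rw [integral_vol_chart he (sm_cutComp p).continuous hS hSe (h0 h),
      integral_vol_chart he (sm_cutComp p).continuous hS hSe (h0 g)]
    have h1 : ∀ z ∈ (cv.e p.1).target,
        (g.coeff (cv.e p.1) z).det.re * cutComp h cv p ((cv.e p.1).symm z) =
        (g.coeff (cv.e p.1) z).det.re * cutComp g cv p ((cv.e p.1).symm z) +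
        Q z * (cderiv (-Complex.I) p.2 (cderiv Complex.I p.2
          fun w => (φ ((cv.e p.1).symm w) : ℂ)) z).re := fun z hz => by
      rw [cutComp_chart p hz, cutComp_chart p hz, hh _ he z hz, Matrix.add_apply, Complex.add_re,
        hess_apply]
      simp only [hQ]
      rw [show inChart (cv.e p.1) φ = fun w => (φ ((cv.e p.1).symm w) : ℂ) from rfl]
      ring
    have hi1 : IntegrableOn (fun z => (g.coeff (cv.e p.1) z).det.re *
        cutComp g cv p ((cv.e p.1).symm z)) (cv.e p.1).target :=
      integrableOn_chart hS hSe (hd.continuousOn.mul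
        ((sm_cutComp p).continuous.comp_continuousOn (cv.e p.1).continuousOn_symm))
        fun z _ hz => by rw [h0 g _ hz, mul_zero]
    have hi2 : IntegrableOn (fun z => Q z * (cderiv (-Complex.I) p.2 (cderiv Complex.I p.2
        fun w => (φ ((cv.e p.1).symm w) : ℂ)) z).re) (cv.e p.1).target :=
      integrableOn_of_vanishing hT hK hKT (hQs.continuousOn.mul
        (Complex.continuous_re.comp_continuousOn (contDiffOn_cderiv hT (contDiffOn_cderiv hT
          (hφ.inChart_contDiffOn he))).continuousOn)) fun z hz hzK => by
            rw [hQ0 z hz hzK, zero_mul]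
    rw [setIntegral_congr_fun hT.measurableSet h1, integral_add hi1 hi2,
      -- With h_{i ī} = g_{i ī} + φ_{i ī}, both derivatives of φ go to the fixed function Q = η² det
      -- g, so only sup |φ| remains.
      integral_mul_flat_symm hT hK hKT hQs (hφ _ he) hQ0, ← integral_const_mul]
    refine add_le_add le_rfl ((le_abs_self _).trans ?_)
    rw [← Real.norm_eq_abs]
    refine norm_integral_le_of_norm_le (hfi.abs.const_mul A) (Filter.Eventually.of_forall
      fun z => ?_)
    rw [norm_mul, Real.norm_eq_abs, Real.norm_eq_abs]
    exact mul_le_mul_of_nonneg_right (hA _) (abs_nonneg _)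
  choose C hC using key
  refine ⟨∑ p, C p, fun h φ hφ hh hA => ?_⟩
  have h1 : ∫ x, cutTrace h cv x ∂(vol g cv) = ∑ p, ∫ x, cutComp h cv p x ∂(vol g cv) :=
    integral_finsetSum _ fun p _ => integrable_vol (sm_cutComp p).continuous
  rw [h1]
  exact Finset.sum_le_sum fun p _ => hC p h φ hφ hh hA

/-- The Laplacian estimate, for a Kähler metric `h` in the class of `g`. -/
theorem exists_trM_bound (hn : 1 ≤ n) (g : KahlerMetric n M) (cv : Cover n M ι)
    {p₀ : ℝ} (hp₀ : 2 * (n : ℝ) < p₀) (A B K : ℝ) :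
    ∃ C : ℝ, ∀ (h : KahlerMetric n M) (φ F : M → ℝ), Sm (n := n) φ → Sm (n := n) F →
      (∀ e ∈ atlas (Cn n) M, ∀ z ∈ e.target, h.coeff e z = g.coeff e z + hess e φ z) →
      (∀ e ∈ atlas (Cn n) M, ∀ z ∈ e.target, logDet h e z = F (e.symm z) + logDet g e z) →
      (∀ x, |φ x| ≤ A) → (∀ x, g.gradNorm φ x ≤ B) →
      g.sobolevNorm p₀ F ≤ ENNReal.ofReal K → ∀ x, g.trM h x ≤ C := by
  have hn' : (1 : ℝ) ≤ n := by exact_mod_cast hn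
  obtain ⟨K₁, hK₁⟩ := exists_abs_le_of_sobolevNorm_le hn g cv hp₀ K
  obtain ⟨K₂, hK₂⟩ := exists_integral_bound_of_sobolevNorm_le g cv (by linarith : 2 < p₀) K
  obtain ⟨K₃, hK₃⟩ := exists_integral_cutTrace_le g cv A
  obtain ⟨l, hl1, hl⟩ := exists_energy_bound hn g cv
  obtain ⟨C₀, hC₀⟩ := hl A B K₁
  -- `exists_sup_bound` uses one constant both for the power of 1 + |∇F|² and for the integral of
  -- e^f, hence the maximum; the latter is at most e^{lA} ∫ U.
  obtain ⟨C₁, hC₁⟩ := exists_sup_bound hn g cv hp₀ C₀ (max K₂ (Real.exp (l * A) * K₃))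
  obtain ⟨C₂, hC₂, hC₂'⟩ := exists_trM_le g cv
  refine ⟨C₂ * (C₁ * Real.exp (l * A)), fun h φ F hφ hF hh hFe hA hB hK x => ?_⟩
  have hU := cutTrace_pos hn h cv
  have hUs : Sm (n := n) (cutTrace h cv) := sm_cutTrace
  have hf : Sm (n := n) fun y => Real.log (cutTrace h cv y) - l * φ y :=
    (hUs.log fun x => (hU x).ne').sub (hφ.const_mul l)
  have hgF : Continuous (g.gradNorm F) := continuous_gradNorm hF
  have hφc := hφ.continuous
  have hUc := hUs.continuous
  have hlφ : ∀ y, |l * φ y| ≤ l * A := fun y => by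
    rw [abs_mul, abs_of_nonneg (by linarith : 0 ≤ l)]
    exact mul_le_mul_of_nonneg_left (hA y) (by linarith)
  have hexp : ∀ y, Real.exp (Real.log (cutTrace h cv y) - l * φ y) =
      cutTrace h cv y * Real.exp (-(l * φ y)) := fun y => by
    rw [sub_eq_add_neg, Real.exp_add, Real.exp_log (hU y)]
  have h1 := hC₁ _ (fun y => 1 + g.gradNorm F y ^ 2) hf (by fun_prop)
    (fun y => by nlinarith [sq_nonneg (g.gradNorm F y)])
    (((hK₂ F hF hK).1).trans (le_max_left _ _))
    (hC₀ h φ F hφ hF hh hFe hA hB (hK₁ F hF hK)) (by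
      refine le_trans ?_ (le_max_right _ _)
      refine le_trans ?_ (mul_le_mul_of_nonneg_left (hK₃ h φ hφ hh hA) (Real.exp_pos _).le)
      rw [← integral_const_mul]
      refine integral_mono_vol (Real.continuous_exp.comp hf.continuous) (by fun_prop) fun y => ?_
      rw [hexp, mul_comm]
      refine mul_le_mul_of_nonneg_right (Real.exp_le_exp.mpr ?_) (hU y).le
      exact (neg_le_abs _).trans (hlφ y)) x
  rw [hexp] at h1
  refine (hC₂' h x).trans (mul_le_mul_of_nonneg_left ?_ (by linarith))
  calc cutTrace h cv x = cutTrace h cv x * Real.exp (-(l * φ x)) * Real.exp (l * φ x) := by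
        rw [mul_assoc, ← Real.exp_add, neg_add_cancel, Real.exp_zero, mul_one]
    _ ≤ C₁ * Real.exp (l * φ x) := mul_le_mul_of_nonneg_right h1 (Real.exp_pos _).le
    _ ≤ C₁ * Real.exp (l * A) := by
        refine mul_le_mul_of_nonneg_left (Real.exp_le_exp.mpr ((le_abs_self _).trans (hlφ x))) ?_
        exact le_trans (mul_nonneg (hU x).le (Real.exp_pos _).le) h1

/-- The Monge-Ampère equation in an arbitrary chart. -/
lemma logDet_eq_of_volumeRatio {h : KahlerMetric n M} {φ F : M → ℝ}
    (hh : ∀ e ∈ atlas (Cn n) M, ∀ z ∈ e.target, h.coeff e z = g.coeff e z + hess e φ z)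
    (hF : ∀ x, Real.log (g.volumeRatio φ x) = F x) {e : OpenPartialHomeomorph M (Cn n)}
    (he : e ∈ atlas (Cn n) M) {z : Cn n} (hz : z ∈ e.target) :
    logDet h e z = F (e.symm z) + logDet g e z := by
  set x := e.symm z with hx
  have he' := chart_mem_atlas (Cn n) x
  have hz' := mem_chart_source (Cn n) x
  have ht := mem_chart_target (Cn n) x
  have h1 := det_transform (g := g) he he' hz hz'
  have h2 := det_transform (g := h) he he' hz hz'
  have hgp := det_re_pos (g := g) he' ht
  have hhp := det_re_pos (g := h) he' ht
  -- Both densities pick up the same Jacobian factor when passing to the preferred chart, so it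
  -- cancels in the difference of the logarithms.
  have hJ : 0 < ‖(jac e (chartAt (Cn n) x) z).det‖ ^ 2 := by
    have := det_re_pos (g := g) he hz
    rw [h1] at this
    exact pos_of_mul_pos_left this hgp.le
  have h3 : g.volumeRatio φ x = (h.coeff (chartAt (Cn n) x) (chartAt (Cn n) x x)).det.re /
      (g.coeff (chartAt (Cn n) x) (chartAt (Cn n) x x)).det.re := by
    have h4 : g.matrixAt x + hessianAt (n := n) φ x =
        h.coeff (chartAt (Cn n) x) (chartAt (Cn n) x x) := (hh _ he' _ ht).symm
    rw [KahlerMetric.volumeRatio, h4, KahlerMetric.matrixAt, ← det_coe (g := g) he' ht,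
      ← det_coe (g := h) he' ht, ← Complex.ofReal_div, Complex.ofReal_re]
    simp only [Complex.ofReal_re]
  rw [logDet, logDet, h1, h2, ← hF x, h3, Real.log_mul hJ.ne' hhp.ne',
    Real.log_mul hJ.ne' hgp.ne', Real.log_div hhp.ne' hgp.ne']
  ring

end Estimate

end KahlerMA

end

theorem theorem1p2 {n : ℕ} (hn : 1 ≤ n)
    {M : Type*} [TopologicalSpace M] [T2Space M] [CompactSpace M]
    [ChartedSpace (KahlerMA.Cn n) M] [IsManifold 𝓘(ℂ, KahlerMA.Cn n) ω M]
    [MeasurableSpace M] [BorelSpace M]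
    (g : KahlerMA.KahlerMetric n M) (p₀ : ℝ) (hp₀ : 2 * (n : ℝ) < p₀) (A B K : ℝ) :
    ∃ C : ℝ, ∀ φ F : M → ℝ,
      ContMDiff 𝓘(ℝ, KahlerMA.Cn n) 𝓘(ℝ, ℝ) ∞ F →
      g.IsSmoothSolution φ F →
      (∀ x, |φ x| ≤ A) →
      (∀ x, g.gradNorm φ x ≤ B) →
      g.sobolevNorm p₀ F ≤ ENNReal.ofReal K →
      ∀ x, 0 < (n : ℝ) + g.laplacian φ x ∧ (n : ℝ) + g.laplacian φ x ≤ C := by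
  obtain ⟨t, ⟨cv⟩⟩ := KahlerMA.exists_cover (n := n) (M := M)
  obtain ⟨C, hC⟩ := KahlerMA.exists_trM_bound hn g cv hp₀ A B K
  refine ⟨C, fun φ F hF hsol hA hB hK x => ?_⟩
  have hφ := KahlerMA.sm_of_contMDiff hsol.smooth
  have hdet : ∀ x, (g.matrixAt x + KahlerMA.hessianAt (n := n) φ x).det ≠ 0 := fun x h0 => by
    have := hsol.ratio_pos x
    rw [KahlerMA.KahlerMetric.volumeRatio, h0, zero_div, Complex.zero_re] at this
    exact lt_irrefl _ this
  -- With h known to be a Kähler metric, n + Δφ is tr_g h: positivity is immediate and the bound is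
  -- `exists_trM_bound`.
  set h := g.addHess φ hφ fun e he z hz => KahlerMA.coeff_add_hess_posDef g hφ hdet he hz
  have hh : ∀ e ∈ atlas (KahlerMA.Cn n) M, ∀ z ∈ e.target,
      h.coeff e z = g.coeff e z + KahlerMA.hess e φ z := fun _ _ _ _ => rfl
  rw [← KahlerMA.trM_potential hh]
  exact ⟨KahlerMA.trM_pos hn x, hC h φ F hφ (KahlerMA.sm_of_contMDiff hF) hh
    (fun e he z hz => KahlerMA.logDet_eq_of_volumeRatio hh hsol.equation he hz) hA hB hK x⟩
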